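/- Let $M$ be a (finite-dimensional) complex manifold and let $(f_t)_{t\in M}$ be a holomorphic family of rational maps of $\mathbb P^1=\mathbb P^1(\mathbb C)$ of degree $\lambda\ge 2$; that is, each $f_t:\mathbb P^1\to\mathbb P^1$ is a rational map $P_t/Q_t$ with $P_t,Q_t$ coprime polynomials and $\max(\deg P_t,\deg Q_t)=\lambda$, and $(t,x)\mapsto f_t(x)$ is a holomorphic map $M\times\mathbb P^1\to\mathbb P^1$. Let $\omega=\frac{1}{\pi(1+|z|^2)^2}\,d\mathrm{Leb}(z)$ be the Fubini--Study probability measure on $\mathbb P^1$, and for a holomorphic map $f:\mathbb P^1\to\mathbb P^1$ let $|f'|$ denote the norm of its differential with respect to the Fubini--Study metric, so that $f^*\omega=|f'|^2\omega$ and $|f'(z)|_{FS}=|f'(z)|\frac{1+|z|^2}{1+|f(z)|^2}$ in the affine coordinate. Then for every $t\in M$ the measures $\lambda^{-n}(f_t^n)^*\omega$ converge weakly, as $n\to\infty$, to a probability measure $\mu_t$ (the measure of maximal entropy of $f_t$), the function $\log|f_t'|$ is $\mu_t$-integrable, and the Lyapunov exponent $$\chi(t)=\int_{\mathbb P^1}\log|f_t'|\,d\mu_t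 ,\qquad t\in M,$$ is a plurisubharmonic and (locally) Hölder-continuous function of $t$: 1. $\chi$ is upper semicontinuous, and for every holomorphic map $\gamma$ from an open set $U\subseteq\mathbb C$ to $M$ the function $\chi\circ\gamma$ is subharmonic on $U$; 2. every $t_0\in M$ has a neighbourhood on which, in local coordinates, $|\chi(s)-\chi(t)|\le C\|s-t\|^{\alpha}$ for some $C\ge 0$ and some $\alpha\in(0,1]$ (depending on $t_0$). -/

import Mathlib

open Filter Topology MeasureTheory Polynomial
open scoped Manifold ContDiff ENNReal NNReal

noncomputable section

/-! ### The Riemann sphere as a complex manifold -/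

/-- The Riemann sphere `ℙ¹(ℂ) = ℂ ∪ {∞}`. -/
abbrev RiemannSphere : Type := OnePoint ℂ

namespace RiemannSphere

instance : MeasurableSpace RiemannSphere := borel _

instance : BorelSpace RiemannSphere := ⟨rfl⟩

open Classical in
/-- The inversion `z ↦ 1 / z` of the sphere, exchanging `0` and `∞`. -/
def inv : RiemannSphere → RiemannSphere
  | OnePoint.infty => ((0 : ℂ) : OnePoint ℂ)
  | OnePoint.some z => if z = 0 then OnePoint.infty else ((z⁻¹ : ℂ) : OnePoint ℂ)

theorem inv_infty : inv OnePoint.infty = ((0 : ℂ) : OnePoint ℂ) := rfl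

theorem inv_zero : inv ((0 : ℂ) : OnePoint ℂ) = OnePoint.infty := if_pos rfl

theorem inv_coe {z : ℂ} (hz : z ≠ 0) : inv (z : OnePoint ℂ) = ((z⁻¹ : ℂ) : OnePoint ℂ) :=
  if_neg hz

theorem inv_inv (x : RiemannSphere) : inv (inv x) = x := by
  induction x using OnePoint.rec with
  | infty => rw [inv_infty, inv_zero]
  | coe z =>
    by_cases hz : z = 0
    · subst hz; rw [inv_zero, inv_infty]
    · rw [inv_coe hz, inv_coe (inv_ne_zero hz), _root_.inv_inv]

theorem continuous_inv : Continuous inv := by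
  rw [OnePoint.continuous_iff]
  constructor
  · rw [coclosedCompact_eq_cocompact, ← Metric.cobounded_eq_cocompact, inv_infty]
    have h1 : Tendsto (fun z : ℂ => ((z⁻¹ : ℂ) : OnePoint ℂ)) (Bornology.cobounded ℂ)
        (𝓝 ((0 : ℂ) : OnePoint ℂ)) :=
      (OnePoint.continuous_coe.tendsto (0 : ℂ)).comp tendsto_inv₀_cobounded
    refine h1.congr' ?_
    filter_upwards [Bornology.eventually_ne_cobounded (0 : ℂ)] with z hz
    exact (inv_coe hz).symm
  · rw [continuous_iff_continuousAt]
    intro z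
    by_cases hz : z = 0
    · subst hz
      have h2 : Tendsto (fun z : ℂ => inv (z : OnePoint ℂ)) (𝓝[≠] 0)
          (𝓝 (OnePoint.infty : OnePoint ℂ)) := by
        have h3 : Tendsto (fun z : ℂ => ((z⁻¹ : ℂ) : OnePoint ℂ)) (𝓝[≠] 0)
            (𝓝 (OnePoint.infty : OnePoint ℂ)) := by
          have h4 := OnePoint.tendsto_coe_infty (X := ℂ)
          rw [coclosedCompact_eq_cocompact, ← Metric.cobounded_eq_cocompact] at h4
          exact h4.comp tendsto_inv₀_nhdsNE_zero
        refine h3.congr' ?_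
        filter_upwards [self_mem_nhdsWithin] with z hz
        exact (inv_coe hz).symm
      refine continuousAt_iff_punctured_nhds.2 ?_
      simpa only [inv_zero] using h2
    · have h1 : ContinuousAt (fun z : ℂ => ((z⁻¹ : ℂ) : OnePoint ℂ)) z :=
        OnePoint.continuous_coe.continuousAt.comp (continuousAt_inv₀ hz)
      refine h1.congr ?_
      filter_upwards [isOpen_ne.mem_nhds hz] with w hw
      exact (inv_coe hw).symm

/-- The inversion as a homeomorphism. -/
def invHomeomorph : RiemannSphere ≃ₜ RiemannSphere where
  toFun := inv
  invFun := inv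
  left_inv := inv_inv
  right_inv := inv_inv
  continuous_toFun := continuous_inv
  continuous_invFun := continuous_inv

/-- The affine chart `z ↦ z`, defined on `ℂ = ℙ¹ ∖ {∞}`. -/
def chartZero : OpenPartialHomeomorph RiemannSphere ℂ :=
  (OnePoint.isOpenEmbedding_coe.toOpenPartialHomeomorph ((↑) : ℂ → OnePoint ℂ)).symm

/-- The chart `z ↦ 1 / z`, defined on `ℙ¹ ∖ {0}`. -/
def chartInfty : OpenPartialHomeomorph RiemannSphere ℂ :=
  invHomeomorph.toOpenPartialHomeomorph.trans chartZero

theorem chartZero_source : chartZero.source = {OnePoint.infty}ᶜ := by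
  simp [chartZero, OnePoint.compl_infty]

theorem chartZero_target : chartZero.target = Set.univ := by
  simp [chartZero]

theorem chartZero_coe (z : ℂ) : chartZero (z : OnePoint ℂ) = z :=
  (OnePoint.isOpenEmbedding_coe.toOpenPartialHomeomorph ((↑) : ℂ → OnePoint ℂ)).left_inv
    (by simp)

theorem chartZero_symm_apply (z : ℂ) : chartZero.symm z = (z : OnePoint ℂ) := rfl

theorem chartInfty_apply (x : RiemannSphere) : chartInfty x = chartZero (inv x) := rfl

theorem chartInfty_symm_apply (z : ℂ) : chartInfty.symm z = inv (z : OnePoint ℂ) := rfl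

theorem chartInfty_infty : chartInfty OnePoint.infty = 0 := by
  rw [chartInfty_apply, inv_infty, chartZero_coe]

theorem mem_chartInfty_source (x : RiemannSphere) :
    x ∈ chartInfty.source ↔ inv x ≠ OnePoint.infty := by
  simp only [chartInfty, OpenPartialHomeomorph.trans_source, chartZero_source]
  simp [invHomeomorph]

open Classical in
/-- The complex structure of the sphere: the two charts `z` and `1 / z`. The preferred chart is
`z` at the points of `ℂ`, and `1 / z` at `∞`. -/
instance : ChartedSpace ℂ RiemannSphere where
  atlas := {chartZero, chartInfty}
  chartAt x := if x = OnePoint.infty then chartInfty else chartZero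
  mem_chart_source x := by
    split_ifs with h
    · rw [mem_chartInfty_source, h, inv_infty]
      exact OnePoint.coe_ne_infty 0
    · rw [chartZero_source]
      exact h
  chart_mem_atlas x := by
    split_ifs <;> simp

theorem chartAt_infty : chartAt ℂ (OnePoint.infty : RiemannSphere) = chartInfty := if_pos rfl

theorem chartAt_coe (z : ℂ) : chartAt ℂ ((z : OnePoint ℂ) : RiemannSphere) = chartZero :=
  if_neg (OnePoint.coe_ne_infty z)

instance : IsManifold 𝓘(ℂ) ω RiemannSphere := by
  have key : ∀ z : ℂ, inv (z : OnePoint ℂ) ≠ OnePoint.infty → z ≠ 0 := by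
    rintro z hz rfl
    exact hz inv_zero
  have hinv : ∀ s : Set ℂ, (∀ z ∈ s, z ≠ 0) →
      ContDiffOn ℂ ω (fun z : ℂ => chartZero (inv (z : OnePoint ℂ))) s := by
    intro s hs
    have h1 : ContDiffOn ℂ ω (fun z : ℂ => z⁻¹) s := fun z hz =>
      (contDiffAt_inv ℂ (hs z hz)).contDiffWithinAt
    refine h1.congr fun z hz => ?_
    rw [inv_coe (hs z hz), chartZero_coe]
  apply isManifold_of_contDiffOn
  rintro e e' (rfl | rfl) (rfl | rfl)
  · refine contDiffOn_id.congr fun z _ => ?_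
    exact chartZero_coe z
  · refine hinv _ fun z hz => key z ?_
    have h := hz.1
    simp only [OpenPartialHomeomorph.trans_source, Set.mem_preimage, Set.mem_inter_iff] at h
    exact (mem_chartInfty_source _).1 h.2
  · refine hinv _ fun z hz => key z ?_
    have h := hz.1
    simp only [OpenPartialHomeomorph.trans_source, Set.mem_preimage, Set.mem_inter_iff] at h
    have h2 := h.2
    rw [chartZero_source] at h2
    exact h2
  · refine contDiffOn_id.congr fun z _ => ?_
    change chartZero (inv (inv (z : OnePoint ℂ))) = z
    rw [inv_inv, chartZero_coe]

end RiemannSphere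

/-! ### Rational maps and holomorphic families -/

open Classical in
/-- The map `P / Q` of the Riemann sphere to itself (meaningful for coprime `P`, `Q`). The value
at `∞` is `lim P(z) / Q(z)` as `z → ∞`, read off from the coefficients of degree
`max (deg P) (deg Q)`. -/
def ratMap (P Q : ℂ[X]) : RiemannSphere → RiemannSphere
  | OnePoint.some z =>
      if Q.eval z = 0 then OnePoint.infty else ((P.eval z / Q.eval z : ℂ) : OnePoint ℂ)
  | OnePoint.infty =>
      if Q.coeff (max P.natDegree Q.natDegree) = 0 then OnePoint.infty
      else ((P.coeff (max P.natDegree Q.natDegree) / Q.coeff (max P.natDegree Q.natDegree) : ℂ) :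
        OnePoint ℂ)

/-- `f` is a rational map of degree `d`: `f = P / Q` with `P`, `Q` without common factor and
`max (deg P) (deg Q) = d`. -/
def IsRationalMap (d : ℕ) (f : RiemannSphere → RiemannSphere) : Prop :=
  ∃ P Q : ℂ[X], IsCoprime P Q ∧ max P.natDegree Q.natDegree = d ∧ f = ratMap P Q

/-- A holomorphic family of rational maps of degree `d` parametrized by the complex manifold `M`:
each `f t` is a rational map of degree `d`, and `(t, x) ↦ f t x` is a holomorphic map
`M × ℙ¹ → ℙ¹`. -/
structure IsHolomorphicFamily {E : Type*} [NormedAddCommGroup E] [NormedSpace ℂ E]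
    {M : Type*} [TopologicalSpace M] [ChartedSpace E M]
    (d : ℕ) (f : M → RiemannSphere → RiemannSphere) : Prop where
  isRationalMap : ∀ t, IsRationalMap d (f t)
  holomorphic : MDifferentiable (𝓘(ℂ, E).prod 𝓘(ℂ)) 𝓘(ℂ)
    (fun p : M × RiemannSphere => f p.1 p.2)

/-! ### The Fubini-Study form, the maximal entropy measure, the Lyapunov exponent -/

/-- The Fubini-Study probability measure `ω = π⁻¹ (1 + |z|²)⁻² dLeb(z)` on the sphere. -/
def fubiniStudy : Measure RiemannSphere :=
  ((volume : Measure ℂ).withDensity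
    (fun z => ENNReal.ofReal (1 / (Real.pi * (1 + ‖z‖ ^ 2) ^ 2)))).map ((↑) : ℂ → OnePoint ℂ)

/-- In both charts `ζ = z` and `ζ = 1 / z` the Fubini-Study metric is `|dζ| / (1 + |ζ|²)` (up to
the factor `π ^ (-1/2)`, which plays no role for norms of derivatives). This is `1 + |ζ|²` at the
point `x`, in the preferred chart `ζ` at `x`. -/
def fsWeight (x : RiemannSphere) : ℝ := 1 + ‖chartAt ℂ x x‖ ^ 2

/-- The norm `|f'|` of the differential of `f` at `x` with respect to the Fubini-Study metric
(the spherical derivative); `mfderiv` is the derivative of `f` read in the preferred charts at `x`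
and `f x`, a linear map `ℂ → ℂ` of norm its modulus at `1`. If `x` and `f x` are finite this is `|f'(x)| (1 + |x|²) / (1 + |f(x)|²)`. -/
def sphericalDeriv (f : RiemannSphere → RiemannSphere) (x : RiemannSphere) : ℝ :=
  norm (E := ℂ) (mfderiv 𝓘(ℂ) 𝓘(ℂ) f x (1 : ℂ)) * fsWeight x / fsWeight (f x)

/-- The pullback `f^* ω = |f'|² ω` of the Fubini-Study form by a holomorphic map. -/
def fsPullback (f : RiemannSphere → RiemannSphere) : Measure RiemannSphere :=
  fubiniStudy.withDensity (fun x => ENNReal.ofReal (sphericalDeriv f x ^ 2))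

/-- `μ` is the canonical measure (measure of maximal entropy) of the rational map `f` of degree
`d`: the probability measure that is the weak limit of `d⁻ⁿ (fⁿ)^* ω`. -/
structure IsMaxEntropyMeasure (d : ℕ) (f : RiemannSphere → RiemannSphere)
    (μ : Measure RiemannSphere) : Prop where
  isProbabilityMeasure : IsProbabilityMeasure μ
  tendsto : ∀ φ : C(RiemannSphere, ℝ),
    Tendsto (fun n : ℕ => ((d : ℝ) ^ n)⁻¹ * ∫ x, φ x ∂(fsPullback f^[n])) atTop
      (𝓝 (∫ x, φ x ∂μ))

open Classical in
/-- The canonical measure of a rational map of degree `d` (and `0` if there is none). -/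
def maxEntropyMeasure (d : ℕ) (f : RiemannSphere → RiemannSphere) : Measure RiemannSphere :=
  if h : ∃ μ, IsMaxEntropyMeasure d f μ then h.choose else 0

/-- The Lyapunov exponent `∫ log |f'| dμ_f` of a rational map of degree `d`. -/
def lyapunovExponent (d : ℕ) (f : RiemannSphere → RiemannSphere) : ℝ :=
  ∫ x, Real.log (sphericalDeriv f x) ∂(maxEntropyMeasure d f)

/-! ### Plurisubharmonic and Hölder functions on a complex manifold -/

/-- A real-valued function `u` is subharmonic on the open set `U ⊆ ℂ`: it is upper semicontinuous
and satisfies the sub-mean value inequality on every closed disc contained in `U`. (The mean is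
asked to be that of an integrable function, since `u` takes no value `-∞`.) -/
structure IsSubharmonicOn (u : ℂ → ℝ) (U : Set ℂ) : Prop where
  upperSemicontinuousOn : UpperSemicontinuousOn u U
  circleIntegrable : ∀ (a : ℂ) (r : ℝ), 0 < r → Metric.closedBall a r ⊆ U → CircleIntegrable u a r
  le_circleAverage : ∀ (a : ℂ) (r : ℝ), 0 < r → Metric.closedBall a r ⊆ U →
    u a ≤ Real.circleAverage u a r

/-- A real-valued function on a complex manifold is plurisubharmonic if it is upper semicontinuous
and its composition with every holomorphic map from an open subset of `ℂ` is subharmonic. -/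
structure IsPlurisubharmonic (E : Type*) [NormedAddCommGroup E] [NormedSpace ℂ E]
    {M : Type*} [TopologicalSpace M] [ChartedSpace E M] (u : M → ℝ) : Prop where
  upperSemicontinuous : UpperSemicontinuous u
  subharmonic : ∀ (U : Set ℂ) (γ : ℂ → M), IsOpen U → MDifferentiableOn 𝓘(ℂ) 𝓘(ℂ, E) γ U →
    IsSubharmonicOn (u ∘ γ) U

/-- A real-valued function on a complex manifold is (locally) Hölder continuous: near every point
`t₀` it satisfies, in the local coordinates at `t₀`, a Hölder condition with some exponent
`α ∈ (0, 1]`. Equivalently, it is Hölder continuous on the compact subsets of coordinate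
domains. -/
def IsLocallyHolder (E : Type*) [NormedAddCommGroup E]
    {M : Type*} [TopologicalSpace M] [ChartedSpace E M] (u : M → ℝ) : Prop :=
  ∀ t₀ : M, ∃ α C : ℝ≥0, 0 < α ∧ α ≤ 1 ∧
    ∃ V ∈ 𝓝 (chartAt E t₀ t₀), V ⊆ (chartAt E t₀).target ∧
      HolderOnWith C α (u ∘ (chartAt E t₀).symm) V

end

open Filter Topology MeasureTheory Polynomial
open scoped Manifold ContDiff ENNReal NNReal

/-! Let `F = (P, Q)` be a homogeneous lift of `f` to `ℂ²` and `G = lim d⁻ⁿ log ‖Fⁿ‖` its Green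
function. The potentials of `d⁻ⁿ (fⁿ)^* ω` are `d⁻ⁿ log ‖Fⁿ(z, 1)‖` with the Euclidean norm, and
they converge to `G(z, 1)` uniformly in `z`. The Green-Jensen formula
(`integral_logTent_mul_curveDensity`) expresses integrals of radial tents by circular means of the
potential, so these integrals converge, and superpositions of tents approximate every test function.
The limit `μ` therefore exists and has logarithmic potential `G(z, 1) - G(1, 0)` on the plane.
Continuity of this potential excludes atoms, its growth excludes mass at infinity, and logarithms of
polynomials become `μ`-integrable.

Everything then rests on the formula `IsReduced.lyapunovExponent_eq`: if the Wronskian of `Q` and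
`P`, as a form of degree `2d - 2`, factors as `κ ∏ (v ∧ cᵢ)`, then `χ = log |κ| + ∑ G(cᵢ) - (2/d)
log |Res(P, Q)|`. With `u_ω = ½ log (1 + |z|²)` one has `log |f'| = log |W| + 2 u_ω - 2 log |Q| - 2
u_ω ∘ f`. The measures `μ` and `f_* μ` have the same potential (`IsPotential.hasLogPotential_map`),
so by Fubini the two terms in `u_ω` have equal integrals and cancel. The integral of `log |Q|` is a
sum of `G` over the fibre of infinity, which `G ∘ F = d G` and the product formula for resultants
evaluate.

Hölder continuity: `G` is Hölder in parameter and point jointly (`IsHomFamily.exists_holder`).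
Individual critical points need not vary well, but `log |κ| + ∑ φ(cᵢ)` is Hölder in the coefficients
of the form, for any logarithmically homogeneous Hölder `φ` (`exists_abs_sum_roots_sub_le`).
Interpolation provides local lifts with holomorphic coefficients (`exists_isHolomorphicLift`).

Plurisubharmonicity: `Res(W, Fⁿ ∧ e)` is holomorphic in the parameter and equals `κ^(dⁿ) ∏ Fⁿ(cᵢ) ∧
e` up to a factor of modulus one. Hence `d⁻ⁿ log |Res(W, Fⁿ ∧ e)|` is at most `log |κ| + ∑ G(cᵢ) +
O(d⁻ⁿ)`, with a matching lower bound for at least one of `2d - 1` fixed directions `e`. Since `log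
|Res(P, Q)|` is harmonic, Jensen's inequality for these functions gives the sub-mean value
inequality for `χ` in the limit; as `χ` is continuous, having it on small circles suffices
(`isSubharmonicOn_of_local`). -/

namespace RationalFamily

/-! ### The Green-Jensen formula for logarithms of norms of entire curves in `ℂ²` -/

open ComplexConjugate

section LogNorm

variable (p q : ℂ → ℂ)

/-- The squared norm of the curve `(p, q)`. -/
noncomputable def curveNormSq (z : ℂ) : ℝ := ‖p z‖ ^ 2 + ‖q z‖ ^ 2

/-- The logarithm of the norm of the curve `(p, q)`. -/
noncomputable def curveLogNorm (z : ℂ) : ℝ := 1 / 2 * Real.log (curveNormSq p q z)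

/-- Twice the `∂`-derivative of the logarithm of the norm of the curve `(p, q)`. -/
noncomputable def curveLogDeriv (z : ℂ) : ℂ :=
  (conj (p z) * deriv p z + conj (q z) * deriv q z) / (curveNormSq p q z : ℂ)

/-- The density of the pullback of the Fubini-Study form by `p / q`, up to the factor `π`. -/
noncomputable def curveDensity (z : ℂ) : ℝ :=
  ‖deriv p z * q z - p z * deriv q z‖ ^ 2 / curveNormSq p q z ^ 2

/-- The `∂`-derivative of `curveLogDeriv`. -/
noncomputable def curveLogDerivTwo (z : ℂ) : ℂ :=
  (conj (p z) * deriv (deriv p) z + conj (q z) * deriv (deriv q) z) / (curveNormSq p q z : ℂ)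
    - ((conj (p z) * deriv p z + conj (q z) * deriv q z) / (curveNormSq p q z : ℂ)) ^ 2

variable {p q}

theorem curveNormSq_pos (h0 : ∀ z, p z ≠ 0 ∨ q z ≠ 0) (z : ℂ) : 0 < curveNormSq p q z := by
  unfold curveNormSq
  rcases h0 z with h | h
  · have := norm_pos_iff.2 h
    positivity
  · have := norm_pos_iff.2 h
    positivity

theorem curveNormSq_eq (z : ℂ) :
    (curveNormSq p q z : ℂ) = conj (p z) * p z + conj (q z) * q z := by
  simp only [curveNormSq, Complex.ofReal_add, Complex.ofReal_pow]
  rw [← Complex.conj_mul', ← Complex.conj_mul']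

theorem curveDensity_eq (z : ℂ) : (curveDensity p q z : ℂ) =
    conj (deriv p z * q z - p z * deriv q z) * (deriv p z * q z - p z * deriv q z) /
      (curveNormSq p q z : ℂ) ^ 2 := by
  simp only [curveDensity, Complex.ofReal_div, Complex.ofReal_pow]
  rw [← Complex.conj_mul']

theorem hasDerivAt_line (ζ c : ℂ) {f : ℂ → ℂ} (hf : Differentiable ℂ f) (t : ℝ) :
    HasDerivAt (fun t : ℝ => f (ζ + t * c)) (deriv f (ζ + t * c) * c) t := by
  have h1 : HasDerivAt (fun t : ℝ => ζ + t * c) c t := by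
    simpa using ((Complex.ofRealCLM.hasDerivAt (x := t)).mul_const c).const_add ζ
  exact (hf _).hasDerivAt.comp t h1

theorem hasDerivAt_conj_line (ζ c : ℂ) {f : ℂ → ℂ} (hf : Differentiable ℂ f) (t : ℝ) :
    HasDerivAt (fun t : ℝ => conj (f (ζ + t * c))) (conj (deriv f (ζ + t * c) * c)) t :=
  (hasDerivAt_line ζ c hf t).star

theorem hasDerivAt_curveNormSq (hp : Differentiable ℂ p) (hq : Differentiable ℂ q)
    (ζ c : ℂ) (t : ℝ) :
    HasDerivAt (fun t : ℝ => (curveNormSq p q (ζ + t * c) : ℂ))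
      (conj (deriv p (ζ + t * c) * c) * p (ζ + t * c) +
        conj (p (ζ + t * c)) * (deriv p (ζ + t * c) * c) +
        (conj (deriv q (ζ + t * c) * c) * q (ζ + t * c) +
        conj (q (ζ + t * c)) * (deriv q (ζ + t * c) * c))) t := by
  simp only [curveNormSq_eq]
  exact ((hasDerivAt_conj_line ζ c hp t).mul (hasDerivAt_line ζ c hp t)).add
    ((hasDerivAt_conj_line ζ c hq t).mul (hasDerivAt_line ζ c hq t))

/-- For `u = log ‖(p, q)‖`, `curveLogDeriv` is `2 ∂u`, and a real function `u` has derivative `Re (c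
· 2 ∂u)` in the direction `c`. -/
theorem hasDerivAt_curveLogNorm (hp : Differentiable ℂ p) (hq : Differentiable ℂ q)
    (h0 : ∀ z, p z ≠ 0 ∨ q z ≠ 0) (ζ c : ℂ) (t : ℝ) :
    HasDerivAt (fun t : ℝ => curveLogNorm p q (ζ + t * c))
      (c * curveLogDeriv p q (ζ + t * c)).re t := by
  have hN := curveNormSq_pos h0 (ζ + t * c)
  have h1 := Complex.reCLM.hasFDerivAt.comp_hasDerivAt t (hasDerivAt_curveNormSq hp hq ζ c t)
  have h2 : HasDerivAt (fun t : ℝ => curveNormSq p q (ζ + t * c)) _ t := h1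
  refine ((h2.log hN.ne').const_mul (1 / 2)).congr_deriv ?_
  have h3 : (c * curveLogDeriv p q (ζ + t * c)).re =
      (c * (conj (p (ζ + t * c)) * deriv p (ζ + t * c) +
        conj (q (ζ + t * c)) * deriv q (ζ + t * c))).re / curveNormSq p q (ζ + t * c) := by
    rw [curveLogDeriv, ← mul_div_assoc, Complex.div_ofReal_re]
  rw [h3]
  simp only [Complex.reCLM_apply, map_mul, Complex.add_re, Complex.mul_re, Complex.mul_im,
    Complex.conj_re, Complex.conj_im, Complex.add_im]
  field_simp
  ring

/-- The `∂̄`-derivative of `2 ∂u` is the density, by the Lagrange identity `(|p|² + |q|²)(|p'|² +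
|q'|²) - |p̄ p' + q̄ q'|² = |p' q - p q'|²`. -/
theorem hasDerivAt_curveLogDeriv (hp : Differentiable ℂ p) (hq : Differentiable ℂ q)
    (h0 : ∀ z, p z ≠ 0 ∨ q z ≠ 0) (ζ c : ℂ) (t : ℝ) :
    HasDerivAt (fun t : ℝ => curveLogDeriv p q (ζ + t * c))
      (c * curveLogDerivTwo p q (ζ + t * c) + conj c * curveDensity p q (ζ + t * c)) t := by
  have hp' : Differentiable ℂ (deriv p) := (hp.contDiff (n := 2)).differentiable_deriv_two
  have hq' : Differentiable ℂ (deriv q) := (hq.contDiff (n := 2)).differentiable_deriv_two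
  have hN : (curveNormSq p q (ζ + t * c) : ℂ) ≠ 0 := by
    exact_mod_cast (curveNormSq_pos h0 _).ne'
  have h := (((hasDerivAt_conj_line ζ c hp t).mul (hasDerivAt_line ζ c hp' t)).add
    ((hasDerivAt_conj_line ζ c hq t).mul (hasDerivAt_line ζ c hq' t))).div
      (hasDerivAt_curveNormSq hp hq ζ c t) hN
  refine h.congr_deriv ?_
  simp only [curveLogDerivTwo, curveDensity_eq, Pi.add_apply, Pi.mul_apply, map_mul, map_sub]
  field_simp
  rw [curveNormSq_eq]
  ring

theorem continuous_curveNormSq (hp : Differentiable ℂ p) (hq : Differentiable ℂ q) :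
    Continuous (curveNormSq p q) := by
  have := hp.continuous
  have := hq.continuous
  unfold curveNormSq
  fun_prop

theorem continuous_curveLogNorm (hp : Differentiable ℂ p) (hq : Differentiable ℂ q)
    (h0 : ∀ z, p z ≠ 0 ∨ q z ≠ 0) : Continuous (curveLogNorm p q) :=
  continuous_const.mul
    ((continuous_curveNormSq hp hq).log fun z => (curveNormSq_pos h0 z).ne')

theorem continuous_curveLogDeriv (hp : Differentiable ℂ p) (hq : Differentiable ℂ q)
    (h0 : ∀ z, p z ≠ 0 ∨ q z ≠ 0) : Continuous (curveLogDeriv p q) := by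
  have h1 := hp.continuous
  have h2 := hq.continuous
  have h3 : Continuous (deriv p) := (hp.contDiff (n := 1)).continuous_deriv_one
  have h4 : Continuous (deriv q) := (hq.contDiff (n := 1)).continuous_deriv_one
  unfold curveLogDeriv
  refine Continuous.div ?_ (Complex.continuous_ofReal.comp (continuous_curveNormSq hp hq))
    fun z => Complex.ofReal_ne_zero.2 (curveNormSq_pos h0 z).ne'
  exact ((Complex.continuous_conj.comp h1).mul h3).add ((Complex.continuous_conj.comp h2).mul h4)

theorem continuous_curveLogDerivTwo (hp : Differentiable ℂ p) (hq : Differentiable ℂ q)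
    (h0 : ∀ z, p z ≠ 0 ∨ q z ≠ 0) : Continuous (curveLogDerivTwo p q) := by
  have h1 := hp.continuous
  have h2 := hq.continuous
  have h3 : Continuous (deriv (deriv p)) :=
    ((hp.contDiff (n := 2)).differentiable_deriv_two.contDiff (n := 1)).continuous_deriv_one
  have h4 : Continuous (deriv (deriv q)) :=
    ((hq.contDiff (n := 2)).differentiable_deriv_two.contDiff (n := 1)).continuous_deriv_one
  refine Continuous.sub ?_ ((continuous_curveLogDeriv hp hq h0).pow 2)
  refine Continuous.div ?_ (Complex.continuous_ofReal.comp (continuous_curveNormSq hp hq))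
    fun z => Complex.ofReal_ne_zero.2 (curveNormSq_pos h0 z).ne'
  exact ((Complex.continuous_conj.comp h1).mul h3).add ((Complex.continuous_conj.comp h2).mul h4)

theorem continuous_curveDensity (hp : Differentiable ℂ p) (hq : Differentiable ℂ q)
    (h0 : ∀ z, p z ≠ 0 ∨ q z ≠ 0) : Continuous (curveDensity p q) := by
  have h1 := hp.continuous
  have h2 := hq.continuous
  have h3 : Continuous (deriv p) := (hp.contDiff (n := 1)).continuous_deriv_one
  have h4 : Continuous (deriv q) := (hq.contDiff (n := 1)).continuous_deriv_one
  unfold curveDensity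
  exact Continuous.div (by fun_prop) ((continuous_curveNormSq hp hq).pow 2)
    fun z => pow_ne_zero 2 (curveNormSq_pos h0 z).ne'

theorem hasDerivAt_integral_of_continuous {f f' : ℝ → ℝ → ℝ} (a b : ℝ)
    (hf : Continuous (Function.uncurry f)) (hf' : Continuous (Function.uncurry f'))
    (h : ∀ s θ, HasDerivAt (fun s => f s θ) (f' s θ) s) (s : ℝ) :
    HasDerivAt (fun s => ∫ θ in a..b, f s θ) (∫ θ in a..b, f' s θ) s := by
  obtain ⟨C, hC⟩ := (((isCompact_Icc (a := s - 1) (b := s + 1)).prod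
    (isCompact_uIcc (a := a) (b := b))).image hf').isBounded.exists_norm_le
  refine (intervalIntegral.hasDerivAt_integral_of_dominated_loc_of_deriv_le (𝕜 := ℝ)
    (bound := fun _ => C) (s := Metric.ball s 1) (Metric.ball_mem_nhds s one_pos) ?_ ?_ ?_ ?_
    ?_ ?_).2
  · exact Eventually.of_forall fun x =>
      (hf.comp (Continuous.prodMk_right x)).aestronglyMeasurable
  · exact (hf.comp (Continuous.prodMk_right s)).intervalIntegrable _ _
  · exact (hf'.comp (Continuous.prodMk_right s)).aestronglyMeasurable
  · refine Eventually.of_forall fun θ hθ x hx => ?_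
    refine hC _ ⟨(x, θ), ⟨?_, Set.uIoc_subset_uIcc hθ⟩, rfl⟩
    rw [Metric.mem_ball, Real.dist_eq, abs_lt] at hx
    constructor <;> linarith
  · exact intervalIntegrable_const
  · exact Eventually.of_forall fun θ _ x _ => h x θ

theorem hasDerivAt_integral_curveLogNorm (hp : Differentiable ℂ p) (hq : Differentiable ℂ q)
    (h0 : ∀ z, p z ≠ 0 ∨ q z ≠ 0) (s : ℝ) :
    HasDerivAt (fun s : ℝ => ∫ θ : ℝ in 0..2 * Real.pi, curveLogNorm p q (s + θ * Complex.I))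
      (∫ θ : ℝ in 0..2 * Real.pi, (curveLogDeriv p q (s + θ * Complex.I)).re) s := by
  refine hasDerivAt_integral_of_continuous
    (f := fun s θ => curveLogNorm p q (s + θ * Complex.I))
    (f' := fun s θ => (curveLogDeriv p q (s + θ * Complex.I)).re) _ _ ?_ ?_ (fun s θ => ?_) s
  · exact (continuous_curveLogNorm hp hq h0).comp (by fun_prop)
  · exact Complex.continuous_re.comp ((continuous_curveLogDeriv hp hq h0).comp (by fun_prop))
  · have := hasDerivAt_curveLogNorm hp hq h0 (θ * Complex.I) 1 s
    simpa [add_comm] using this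

/-- With `A = curveLogDerivTwo` and `B = curveDensity`, the `s`-derivative of the real part is `Re A
+ B` and the `θ`-derivative of the imaginary part is `Re A - B`. By periodicity the latter has
integral zero over a period, so the former has the same integral as `2 B`. -/
theorem hasDerivAt_integral_curveLogDeriv (hp : Differentiable ℂ p) (hq : Differentiable ℂ q)
    (h0 : ∀ z, p z ≠ 0 ∨ q z ≠ 0)
    (hper : ∀ z, curveLogDeriv p q (z + 2 * Real.pi * Complex.I) = curveLogDeriv p q z) (s : ℝ) :
    HasDerivAt (fun s : ℝ => ∫ θ : ℝ in 0..2 * Real.pi,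
        (curveLogDeriv p q (s + θ * Complex.I)).re)
      (∫ θ : ℝ in 0..2 * Real.pi, 2 * curveDensity p q (s + θ * Complex.I)) s := by
  have hc1 : Continuous fun x : ℝ × ℝ => (x.1 + x.2 * Complex.I : ℂ) := by fun_prop
  have hc2 (s : ℝ) : Continuous fun x : ℝ => (s + x * Complex.I : ℂ) := by fun_prop
  have cA := continuous_curveLogDerivTwo hp hq h0
  have cB := continuous_curveDensity hp hq h0
  have h1 : HasDerivAt (fun s : ℝ => ∫ θ : ℝ in 0..2 * Real.pi,
        (curveLogDeriv p q (s + θ * Complex.I)).re)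
      (∫ θ : ℝ in 0..2 * Real.pi, ((curveLogDerivTwo p q (s + θ * Complex.I)).re +
        curveDensity p q (s + θ * Complex.I))) s := by
    refine hasDerivAt_integral_of_continuous (f' := fun s θ =>
      ((curveLogDerivTwo p q (s + θ * Complex.I)).re +
        curveDensity p q (s + θ * Complex.I))) _ _ ?_ ?_ (fun s θ => ?_) s
    · exact Complex.continuous_re.comp ((continuous_curveLogDeriv hp hq h0).comp hc1)
    · exact (Complex.continuous_re.comp (cA.comp hc1)).add (cB.comp hc1)
    · have := Complex.reCLM.hasFDerivAt.comp_hasDerivAt s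
        (hasDerivAt_curveLogDeriv hp hq h0 (θ * Complex.I) 1 s)
      simpa [add_comm, Function.comp_def] using this
  refine h1.congr_deriv ?_
  have h2 : ∫ θ : ℝ in 0..2 * Real.pi, ((curveLogDerivTwo p q (s + θ * Complex.I)).re -
      curveDensity p q (s + θ * Complex.I)) = 0 := by
    have h3 : ∀ θ : ℝ, HasDerivAt (fun θ : ℝ => (curveLogDeriv p q (s + θ * Complex.I)).im)
        ((curveLogDerivTwo p q (s + θ * Complex.I)).re -
          curveDensity p q (s + θ * Complex.I)) θ := by
      intro θ
      have := Complex.imCLM.hasFDerivAt.comp_hasDerivAt θ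
        (hasDerivAt_curveLogDeriv hp hq h0 s Complex.I θ)
      simpa [Function.comp_def, sub_eq_add_neg] using this
    rw [intervalIntegral.integral_eq_sub_of_hasDerivAt (fun θ _ => h3 θ)]
    · have := hper s
      push_cast
      rw [this]
      simp
    · exact ((Complex.continuous_re.comp (cA.comp (hc2 s))).sub
        (cB.comp (hc2 s))).intervalIntegrable _ _
  have h4 : ∀ θ : ℝ, 2 * curveDensity p q (s + θ * Complex.I) =
      ((curveLogDerivTwo p q (s + θ * Complex.I)).re + curveDensity p q (s + θ * Complex.I)) -
      ((curveLogDerivTwo p q (s + θ * Complex.I)).re -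
        curveDensity p q (s + θ * Complex.I)) := by
    intro θ
    ring
  simp_rw [h4]
  rw [intervalIntegral.integral_sub, h2, sub_zero]
  · exact ((Complex.continuous_re.comp (cA.comp (hc2 s))).add
        (cB.comp (hc2 s))).intervalIntegrable _ _
  · exact ((Complex.continuous_re.comp (cA.comp (hc2 s))).sub
        (cB.comp (hc2 s))).intervalIntegrable _ _

end LogNorm
-- Radial test functions and polar coordinates
/-- The radial function `log max(t, R) - log max(t, r)`, which vanishes for `t ≥ R`. -/
noncomputable def logTent (r R t : ℝ) : ℝ := Real.log (max t R) - Real.log (max t r)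

theorem continuous_logTent {r R : ℝ} (hr : 0 < r) (hR : 0 < R) : Continuous (logTent r R) := by
  unfold logTent
  refine Continuous.sub (Continuous.log (by fun_prop) fun t => ?_)
    (Continuous.log (by fun_prop) fun t => ?_)
  · exact (lt_max_of_lt_right hR).ne'
  · exact (lt_max_of_lt_right hr).ne'

theorem logTent_of_ge {r R t : ℝ} (hrR : r ≤ R) (ht : R ≤ t) : logTent r R t = 0 := by
  rw [logTent, max_eq_left ht, max_eq_left (hrR.trans ht), sub_self]

theorem logTent_nonneg {r R : ℝ} (hr : 0 < r) (hrR : r ≤ R) (t : ℝ) : 0 ≤ logTent r R t :=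
  sub_nonneg.2 (Real.log_le_log (lt_max_of_lt_right hr) (max_le_max le_rfl hrR))

theorem logTent_le {r R : ℝ} (hr : 0 < r) (hrR : r ≤ R) (t : ℝ) :
    logTent r R t ≤ Real.log R - Real.log r := by
  have hR := hr.trans_le hrR
  rcases le_total R t with h | h
  · rw [logTent_of_ge hrR h, sub_nonneg]
    exact Real.log_le_log hr hrR
  · rw [logTent, max_eq_right h]
    exact sub_le_sub_left (Real.log_le_log hr (le_max_right _ _)) _

theorem integral_radial_mul {ρ : ℂ → ℝ} (hρ : Continuous ρ) {τ : ℝ → ℝ} (hτ : Continuous τ)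
    {R : ℝ} (hR : 0 ≤ R) (hτR : ∀ t, R ≤ t → τ t = 0) (b : ℂ) :
    ∫ x : ℂ, τ ‖x - b‖ * ρ x =
      ∫ r in 0..R, τ r * (r * ∫ θ in 0..2 * Real.pi, ρ (circleMap b r θ)) := by
  have h1 : ∫ x : ℂ, τ ‖x - b‖ * ρ x = ∫ x : ℂ, τ ‖x‖ * ρ (b + x) := by
    rw [← integral_add_left_eq_self _ b]
    simp
  have hmap : ∀ p : ℝ × ℝ, b + Complex.polarCoord.symm p = circleMap b p.1 p.2 := by
    intro p
    rw [Complex.polarCoord_symm_apply, circleMap, Complex.exp_mul_I, Complex.ofReal_cos,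
      Complex.ofReal_sin]
  rw [h1, ← Complex.integral_comp_polarCoord_symm]
  have hcont : Continuous fun p : ℝ × ℝ => p.1 * (τ |p.1| * ρ (circleMap b p.1 p.2)) := by
    have : Continuous fun p : ℝ × ℝ => circleMap b p.1 p.2 := by
      unfold circleMap
      fun_prop
    fun_prop
  have h2 : ∫ p in polarCoord.target, p.1 • (τ ‖Complex.polarCoord.symm p‖ *
      ρ (b + Complex.polarCoord.symm p)) =
      ∫ p in Set.Ioc 0 R ×ˢ Set.Ioc (-Real.pi) Real.pi,
        p.1 * (τ |p.1| * ρ (circleMap b p.1 p.2)) := by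
    simp only [Complex.norm_polarCoord_symm, hmap, smul_eq_mul]
    have h3 : (Set.Ioc 0 R ×ˢ Set.Ioo (-Real.pi) Real.pi : Set (ℝ × ℝ)) =ᵐ[volume]
        (Set.Ioc 0 R ×ˢ Set.Ioc (-Real.pi) Real.pi : Set (ℝ × ℝ)) :=
      Measure.set_prod_ae_eq (ae_eq_refl _) Ioo_ae_eq_Ioc
    rw [← setIntegral_congr_set h3]
    refine setIntegral_eq_of_subset_of_forall_sdiff_eq_zero polarCoord.open_target.measurableSet
      (Set.prod_mono Set.Ioc_subset_Ioi_self le_rfl) ?_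
    rintro ⟨r, θ⟩ ⟨⟨hr, hθ⟩, h⟩
    simp only [Set.mem_prod, Set.mem_Ioc, not_and] at h
    have : R ≤ r := by
      by_contra hlt
      exact h ⟨hr, (not_le.1 hlt).le⟩ hθ
    simp only [hτR _ (this.trans (le_abs_self r)), zero_mul, mul_zero]
  rw [h2, Measure.volume_eq_prod, setIntegral_prod, intervalIntegral.integral_of_le hR]
  · refine setIntegral_congr_fun measurableSet_Ioc fun r hr => ?_
    simp only [abs_of_pos hr.1]
    have hper : Function.Periodic (fun θ => ρ (circleMap b r θ)) (2 * Real.pi) := fun θ => by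
      simp only [periodic_circleMap b r θ]
    have h4 := hper.intervalIntegral_add_eq 0 (-Real.pi)
    rw [zero_add, show -Real.pi + 2 * Real.pi = Real.pi by ring] at h4
    rw [h4, intervalIntegral.integral_of_le (by linarith [Real.pi_pos]), ← integral_const_mul,
      ← integral_const_mul]
    refine integral_congr_ae (Eventually.of_forall fun θ => ?_)
    ring
  · exact (hcont.continuousOn.integrableOn_compact (isCompact_Icc.prod isCompact_Icc)).mono_set
      (Set.prod_mono Set.Ioc_subset_Icc_self Set.Ioc_subset_Icc_self)

/-! ### The flux through circles and the Green-Jensen formula -/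

section GreenJensen

variable {p q : ℂ → ℂ}

theorem curveLogNorm_comp (φ : ℂ → ℂ) (z : ℂ) :
    curveLogNorm (p ∘ φ) (q ∘ φ) z = curveLogNorm p q (φ z) := rfl

theorem deriv_comp_add_exp (b : ℂ) (hp : Differentiable ℂ p) (z : ℂ) :
    deriv (p ∘ fun z => b + Complex.exp z) z = deriv p (b + Complex.exp z) * Complex.exp z :=
  ((hp _).hasDerivAt.comp z ((Complex.hasDerivAt_exp z).const_add b)).deriv

theorem curveLogDeriv_comp_exp (hp : Differentiable ℂ p) (hq : Differentiable ℂ q) (b z : ℂ) :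
    curveLogDeriv (p ∘ fun z => b + Complex.exp z) (q ∘ fun z => b + Complex.exp z) z =
      Complex.exp z * curveLogDeriv p q (b + Complex.exp z) := by
  simp only [curveLogDeriv, deriv_comp_add_exp b hp, deriv_comp_add_exp b hq, Function.comp_apply,
    curveNormSq]
  ring

theorem curveDensity_comp_exp (hp : Differentiable ℂ p) (hq : Differentiable ℂ q) (b z : ℂ) :
    curveDensity (p ∘ fun z => b + Complex.exp z) (q ∘ fun z => b + Complex.exp z) z =
      ‖Complex.exp z‖ ^ 2 * curveDensity p q (b + Complex.exp z) := by
  simp only [curveDensity, deriv_comp_add_exp b hp, deriv_comp_add_exp b hq, Function.comp_apply,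
    curveNormSq]
  rw [← mul_div_assoc, ← mul_pow, ← norm_mul]
  congr 3
  ring

/-- The substitution `z ↦ b + exp z` turns circles about `b` into vertical segments of length `2π`,
so that the computations on a periodic strip apply. -/
theorem circleMap_exp_log (b : ℂ) {r : ℝ} (hr : 0 < r) (θ : ℝ) :
    b + Complex.exp (Real.log r + θ * Complex.I) = circleMap b r θ := by
  rw [Complex.exp_add, ← Complex.ofReal_exp, Real.exp_log hr, circleMap]

/-- The mean over the circle of centre `b` and radius `r` of `r ∂_r log ‖(p, q)‖`. -/
noncomputable def curveFlux (p q : ℂ → ℂ) (b : ℂ) (r : ℝ) : ℝ :=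
  ∫ θ in 0..2 * Real.pi, ((circleMap 0 r θ) * curveLogDeriv p q (circleMap b r θ)).re

theorem continuous_curveFlux (hp : Differentiable ℂ p) (hq : Differentiable ℂ q)
    (h0 : ∀ z, p z ≠ 0 ∨ q z ≠ 0) (b : ℂ) : Continuous (curveFlux p q b) := by
  unfold curveFlux
  have hc (b : ℂ) : Continuous fun x : ℝ × ℝ => circleMap b x.1 x.2 := by
    unfold circleMap
    fun_prop
  refine intervalIntegral.continuous_parametric_intervalIntegral_of_continuous' ?_ _ _
  exact Complex.continuous_re.comp ((hc 0).mul ((continuous_curveLogDeriv hp hq h0).comp (hc b)))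

theorem curveFlux_zero (b : ℂ) : curveFlux p q b 0 = 0 := by
  simp [curveFlux]

variable (hp : Differentiable ℂ p) (hq : Differentiable ℂ q) (h0 : ∀ z, p z ≠ 0 ∨ q z ≠ 0)
include hp hq h0

theorem hasDerivAt_integral_circle_curveLogNorm (b : ℂ) {r : ℝ} (hr : 0 < r) :
    HasDerivAt (fun r => ∫ θ in 0..2 * Real.pi, curveLogNorm p q (circleMap b r θ))
      (curveFlux p q b r / r) r := by
  have hφ : Differentiable ℂ fun z => b + Complex.exp z := by fun_prop
  have h1 := (hasDerivAt_integral_curveLogNorm (hp.comp hφ) (hq.comp hφ) (fun z => h0 _)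
    (Real.log r)).comp r (Real.hasDerivAt_log hr.ne')
  refine (h1.congr_deriv ?_).congr_of_eventuallyEq ?_
  · rw [div_eq_mul_inv]
    congr 1
    refine intervalIntegral.integral_congr fun θ _ => ?_
    simp only [curveLogDeriv_comp_exp hp hq, circleMap_exp_log b hr]
    rw [← circleMap_exp_log 0 hr, zero_add]
  · filter_upwards [lt_mem_nhds hr] with s hs
    refine intervalIntegral.integral_congr fun θ _ => ?_
    simp only [curveLogNorm_comp, circleMap_exp_log b hs]

theorem hasDerivAt_curveFlux (b : ℂ) {r : ℝ} (hr : 0 < r) :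
    HasDerivAt (curveFlux p q b)
      (2 * (r * ∫ θ in 0..2 * Real.pi, curveDensity p q (circleMap b r θ))) r := by
  have hφ : Differentiable ℂ fun z => b + Complex.exp z := by fun_prop
  have h1 := (hasDerivAt_integral_curveLogDeriv (hp.comp hφ) (hq.comp hφ) (fun z => h0 _)
    (fun z => ?_) (Real.log r)).comp r (Real.hasDerivAt_log hr.ne')
  · refine (h1.congr_deriv ?_).congr_of_eventuallyEq ?_
    · have h2 : ∀ θ : ℝ, 2 * curveDensity (p ∘ fun z => b + Complex.exp z)
          (q ∘ fun z => b + Complex.exp z) (Real.log r + θ * Complex.I) =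
          2 * r ^ 2 * curveDensity p q (circleMap b r θ) := by
        intro θ
        rw [curveDensity_comp_exp hp hq, circleMap_exp_log b hr, Complex.norm_exp]
        simp [Real.exp_log hr]
        ring
      simp_rw [h2]
      rw [intervalIntegral.integral_const_mul]
      field_simp
    · filter_upwards [lt_mem_nhds hr] with s hs
      refine intervalIntegral.integral_congr fun θ _ => ?_
      simp only [curveLogDeriv_comp_exp hp hq, circleMap_exp_log b hs]
      rw [← circleMap_exp_log 0 hs, zero_add]
  · simp only [curveLogDeriv_comp_exp hp hq]
    rw [Complex.exp_periodic z]

/-- The Green-Jensen formula for the logarithm of the norm of an entire curve in `ℂ² ∖ 0`. -/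
theorem integral_logTent_mul_curveDensity (b : ℂ) {r R : ℝ} (hr : 0 < r) (hrR : r ≤ R) :
    ∫ x : ℂ, logTent r R ‖x - b‖ * (curveDensity p q x / Real.pi) =
      Real.circleAverage (curveLogNorm p q) b R - Real.circleAverage (curveLogNorm p q) b r := by
  have hR := hr.trans_le hrR
  have hπ := Real.pi_pos
  have cρ := continuous_curveDensity hp hq h0
  have cmap : Continuous fun x : ℝ × ℝ => circleMap b x.1 x.2 := by
    unfold circleMap
    fun_prop
  have cΛ : Continuous fun s : ℝ =>
      2 * (s * ∫ θ in 0..2 * Real.pi, curveDensity p q (circleMap b s θ)) := by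
    have := intervalIntegral.continuous_parametric_intervalIntegral_of_continuous'
      (μ := volume) (f := fun s θ => curveDensity p q (circleMap b s θ))
      (cρ.comp cmap) 0 (2 * Real.pi)
    fun_prop
  rw [integral_radial_mul (cρ.div_const _) (continuous_logTent hr hR) hR.le
    fun t ht => logTent_of_ge hrR ht]
  set Λ : ℝ → ℝ := fun s =>
    2 * (s * ∫ θ in 0..2 * Real.pi, curveDensity p q (circleMap b s θ)) with hΛ
  have h1 : ∀ s, logTent r R s *
      (s * ∫ θ in 0..2 * Real.pi, curveDensity p q (circleMap b s θ) / Real.pi) =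
      (2 * Real.pi)⁻¹ * (logTent r R s * Λ s) := by
    intro s
    rw [intervalIntegral.integral_div, hΛ]
    field_simp
  simp_rw [h1]
  have cint : Continuous fun s => logTent r R s * Λ s := (continuous_logTent hr hR).mul cΛ
  rw [intervalIntegral.integral_const_mul,
    ← intervalIntegral.integral_add_adjacent_intervals (cint.intervalIntegrable 0 r)
      (cint.intervalIntegrable r R)]
  -- Below `r` the tent has the constant value `log R - log r`, and the flux vanishes at radius `0`.
  have e1 : ∫ s in 0..r, logTent r R s * Λ s =
      (Real.log R - Real.log r) * curveFlux p q b r := by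
    have : ∫ s in 0..r, Λ s = curveFlux p q b r - curveFlux p q b 0 :=
      intervalIntegral.integral_eq_sub_of_hasDerivAt_of_le hr.le
        (continuous_curveFlux hp hq h0 b).continuousOn
        (fun s hs => hasDerivAt_curveFlux hp hq h0 b hs.1) (cΛ.intervalIntegrable _ _)
    rw [curveFlux_zero, sub_zero] at this
    rw [← this, ← intervalIntegral.integral_const_mul]
    refine intervalIntegral.integral_congr fun s hs => ?_
    rw [Set.uIcc_of_le hr.le] at hs
    simp only [logTent, max_eq_right hs.2, max_eq_right (hs.2.trans hrR)]
  have e2 : ∫ s in r..R, logTent r R s * Λ s =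
      (∫ θ in 0..2 * Real.pi, curveLogNorm p q (circleMap b R θ)) -
      ((Real.log R - Real.log r) * curveFlux p q b r +
        ∫ θ in 0..2 * Real.pi, curveLogNorm p q (circleMap b r θ)) := by
    -- Integration by parts: the derivative `flux / s` of the circle integral cancels the term from
    -- differentiating `log R - log s`.
    have h2 : ∀ s ∈ Set.uIcc r R, HasDerivAt (fun s => (Real.log R - Real.log s) *
        curveFlux p q b s + ∫ θ in 0..2 * Real.pi, curveLogNorm p q (circleMap b s θ))
        (logTent r R s * Λ s) s := by
      intro s hs
      rw [Set.uIcc_of_le hrR] at hs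
      have hs0 := hr.trans_le hs.1
      refine ((((Real.hasDerivAt_log hs0.ne').const_sub _).mul
        (hasDerivAt_curveFlux hp hq h0 b hs0)).add
        (hasDerivAt_integral_circle_curveLogNorm hp hq h0 b hs0)).congr_deriv ?_
      simp only [logTent, max_eq_right hs.2, max_eq_left hs.1, hΛ]
      ring
    rw [intervalIntegral.integral_eq_sub_of_hasDerivAt h2 (cint.intervalIntegrable _ _)]
    simp
  rw [e1, e2, Real.circleAverage_def, Real.circleAverage_def]
  simp only [smul_eq_mul]
  ring

end GreenJensen

/-! ### Logarithmic potentials of probability measures on the plane -/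

open Bornology Real in
-- Since `log |x + b| - log |x|` tends to `0` at infinity, the centre of a large circle does not
-- matter, and `g - log` is uniformly close to `L` on it.
theorem tendsto_circleAverage_sub_log {g : ℂ → ℝ} {L : ℝ} (hg : Continuous g)
    (hL : Tendsto (fun x => g x - Real.log ‖x‖) (cobounded ℂ) (𝓝 L)) (b : ℂ) :
    Tendsto (fun R => circleAverage g b R - Real.log R) atTop (𝓝 L) := by
  have h1 : Tendsto (fun x : ℂ => Real.log ‖x + b‖ - Real.log ‖x‖) (cobounded ℂ) (𝓝 0) := by
    have h2 : Tendsto (fun x : ℂ => Real.log ‖1 + b * x⁻¹‖) (cobounded ℂ) (𝓝 0) := by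
      have h3 : Tendsto (fun x : ℂ => 1 + b * x⁻¹) (cobounded ℂ) (𝓝 (1 + b * 0)) :=
        (tendsto_inv₀_cobounded.const_mul b).const_add 1
      have h4 := ((Real.continuousAt_log (x := ‖(1 : ℂ) + b * 0‖) (by simp)).tendsto.comp
        h3.norm)
      simpa [Function.comp_def] using h4
    refine h2.congr' ?_
    filter_upwards [eventually_ne_cobounded (0 : ℂ), eventually_ne_cobounded (-b)] with x hx hxb
    have hxb' : x + b ≠ 0 := fun h => hxb (eq_neg_of_add_eq_zero_left h)
    rw [← Real.log_div (norm_ne_zero_iff.2 hxb') (norm_ne_zero_iff.2 hx), ← norm_div, add_div,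
      div_self hx, div_eq_mul_inv]
  have h5 : Tendsto (fun x : ℂ => x + b) (cobounded ℂ) (cobounded ℂ) :=
    tendsto_add_const_cobounded b
  have h6 : Tendsto (fun x => g (x + b) - Real.log ‖x‖) (cobounded ℂ) (𝓝 L) := by
    have := (hL.comp h5).add h1
    simpa [Function.comp_def] using this
  rw [Metric.tendsto_nhds] at h6 ⊢
  intro ε hε
  obtain ⟨K, -, hK⟩ := ((hasBasis_cobounded_norm (E := ℂ)).eventually_iff.1
    (h6 (ε / 2) (half_pos hε)))
  filter_upwards [eventually_ge_atTop K, eventually_gt_atTop 0] with R hRK hR0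
  have h7 : ∀ z ∈ Metric.sphere b |R|, |g z - (Real.log R + L)| < ε / 2 := by
    intro z hz
    rw [abs_of_pos hR0, mem_sphere_iff_norm] at hz
    have := @hK (z - b) (by simpa [hz] using hRK)
    rw [sub_add_cancel, hz, Real.dist_eq, sub_sub] at this
    exact this
  have hgi : CircleIntegrable g b R := hg.continuousOn.circleIntegrable'
  have h8 : circleAverage g b R ≤ Real.log R + L + ε / 2 :=
    circleAverage_mono_on_of_le_circle hgi fun z hz => by linarith [(abs_lt.1 (h7 z hz)).2]
  have h9 : Real.log R + L - ε / 2 ≤ circleAverage g b R := by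
    rw [← circleAverage_const (Real.log R + L - ε / 2) b R]
    exact circleAverage_mono continuous_const.continuousOn.circleIntegrable' hgi
      fun z hz => by linarith [(abs_lt.1 (h7 z hz)).1]
  rw [Real.dist_eq, abs_lt]
  constructor <;> linarith

/-- `m` is a finite measure on `ℂ` whose logarithmic potential is `g - L`, where `L` is the
limit of `g x - log |x|` at infinity. The potential is described by its circular means. -/
structure IsPotential (m : Measure ℂ) (g : ℂ → ℝ) (L : ℝ) : Prop where
  continuous : Continuous g
  tendsto : Tendsto (fun x => g x - Real.log ‖x‖) (Bornology.cobounded ℂ) (𝓝 L)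
  integrable : ∀ (b : ℂ) (r R : ℝ), 0 < r → r ≤ R → Integrable (fun x => logTent r R ‖x - b‖) m
  integral_logTent : ∀ (b : ℂ) (r R : ℝ), 0 < r → r ≤ R →
    ∫ x, logTent r R ‖x - b‖ ∂m = Real.circleAverage g b R - Real.circleAverage g b r

/-- Monotone convergence in the form in which integrability of the limit is a conclusion; the
functions `f n` will be truncated logarithms. -/
theorem integrable_of_integral_tendsto_of_monotone {α : Type*} [MeasurableSpace α]
    {m : Measure α} {f : ℕ → α → ℝ} {F : α → ℝ} {c : ℝ} (hf : ∀ n, Integrable (f n) m)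
    (hpos : ∀ n, ∀ᵐ x ∂m, 0 ≤ f n x) (hmono : ∀ᵐ x ∂m, Monotone fun n => f n x)
    (hlim : ∀ᵐ x ∂m, Tendsto (fun n => f n x) atTop (𝓝 (F x)))
    (hc : Tendsto (fun n => ∫ x, f n x ∂m) atTop (𝓝 c)) :
    Integrable F m ∧ ∫ x, F x ∂m = c := by
  have hF : 0 ≤ᵐ[m] F := by
    filter_upwards [hlim, ae_all_iff.2 hpos] with x h1 h2
    exact ge_of_tendsto' h1 h2
  have hFm : AEStronglyMeasurable F m :=
    aestronglyMeasurable_of_tendsto_ae atTop (fun n => (hf n).aestronglyMeasurable) hlim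
  have h1 : Tendsto (fun n => ∫⁻ x, ENNReal.ofReal (f n x) ∂m) atTop
      (𝓝 (∫⁻ x, ENNReal.ofReal (F x) ∂m)) := by
    refine lintegral_tendsto_of_tendsto_of_monotone
      (fun n => (hf n).aestronglyMeasurable.aemeasurable.ennreal_ofReal) ?_ ?_
    · filter_upwards [hmono] with x hx i j hij
      exact ENNReal.ofReal_le_ofReal (hx hij)
    · filter_upwards [hlim] with x hx
      exact (ENNReal.continuous_ofReal.tendsto _).comp hx
  have h2 : Tendsto (fun n => ∫⁻ x, ENNReal.ofReal (f n x) ∂m) atTop (𝓝 (ENNReal.ofReal c)) := by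
    have := (ENNReal.continuous_ofReal.tendsto _).comp hc
    refine this.congr fun n => ?_
    exact ofReal_integral_eq_lintegral_ofReal (hf n) (hpos n)
  have h3 := tendsto_nhds_unique h1 h2
  have hc0 : 0 ≤ c := ge_of_tendsto' hc fun n => integral_nonneg_of_ae (hpos n)
  refine ⟨⟨hFm, ?_⟩, ?_⟩
  · rw [hasFiniteIntegral_iff_ofReal hF, h3]
    exact ENNReal.ofReal_lt_top
  · rw [integral_eq_lintegral_of_nonneg_ae hF hFm, h3, ENNReal.toReal_ofReal hc0]

namespace IsPotential

variable {m : Measure ℂ} {g : ℂ → ℝ} {L : ℝ}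

theorem logTent_one_exp (n : ℕ) {t : ℝ} (ht : 0 ≤ t) :
    logTent 1 (Real.exp n) t = n - min (Real.posLog t) n := by
  have h1 : (1 : ℝ) ≤ Real.exp n := Real.one_le_exp (Nat.cast_nonneg n)
  rw [Real.posLog_eq_log_max_one ht, logTent, max_comm 1 t]
  rcases le_total t (Real.exp n) with h | h
  · rw [max_eq_right h, Real.log_exp, min_eq_left]
    rw [Real.log_le_iff_le_exp (lt_max_of_lt_right one_pos)]
    exact max_le h h1
  · rw [max_eq_left h, min_eq_right, max_eq_left (h1.trans h)]
    · ring
    · rw [max_eq_left (h1.trans h), Real.le_log_iff_exp_le ((Real.exp_pos _).trans_le h)]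
      exact h

theorem tendsto_circleAverage_exp (h : IsPotential m g L) (b : ℂ) :
    Tendsto (fun n : ℕ => Real.circleAverage g b (Real.exp n) - n) atTop (𝓝 L) := by
  have h1 : Tendsto (fun n : ℕ => Real.exp n) atTop atTop :=
    Real.tendsto_exp_atTop.comp tendsto_natCast_atTop_atTop
  simpa [Function.comp_def] using (tendsto_circleAverage_sub_log h.continuous h.tendsto b).comp h1

/-- The tents with radii `1` and `eⁿ`, divided by `n`, increase to `1`, while their integrals tend
to `1` because the mean of `g` on the circle of radius `eⁿ` is `n + O(1)`. -/
theorem isProbabilityMeasure (h : IsPotential m g L) : IsProbabilityMeasure m := by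
  have hexp (n : ℕ) : (1 : ℝ) ≤ Real.exp (n + 1 : ℕ) := Real.one_le_exp (Nat.cast_nonneg _)
  have hpos (n : ℕ) : (0 : ℝ) < (n + 1 : ℕ) := by positivity
  have hform (n : ℕ) (x : ℂ) : logTent 1 (Real.exp (n + 1 : ℕ)) ‖x - 0‖ / (n + 1 : ℕ) =
      1 - min (Real.posLog ‖x‖ / (n + 1 : ℕ)) 1 := by
    rw [logTent_one_exp _ (norm_nonneg _), sub_zero, sub_div, div_self (hpos n).ne',
      ← min_div_div_right (hpos n).le, div_self (hpos n).ne']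
  have key := integrable_of_integral_tendsto_of_monotone (m := m) (F := fun _ => 1) (c := 1)
    (f := fun n x => logTent 1 (Real.exp (n + 1 : ℕ)) ‖x - 0‖ / (n + 1 : ℕ))
    (fun n => (h.integrable 0 1 _ one_pos (hexp n)).div_const _)
    (fun n => Eventually.of_forall fun x =>
      div_nonneg (logTent_nonneg one_pos (hexp n) _) (hpos n).le)
    (Eventually.of_forall fun x i j hij => ?_) (Eventually.of_forall fun x => ?_) ?_
  · have h1 := key.2
    simp only [integral_const, smul_eq_mul, mul_one] at h1
    exact ⟨by rwa [measureReal_def, ENNReal.toReal_eq_one_iff] at h1⟩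
  · simp only [hform]
    have : Real.posLog ‖x‖ / (j + 1 : ℕ) ≤ Real.posLog ‖x‖ / (i + 1 : ℕ) :=
      div_le_div_of_nonneg_left Real.posLog_nonneg (hpos i) (by exact_mod_cast Nat.succ_le_succ hij)
    linarith [min_le_min_right 1 this]
  · simp only [hform]
    have h1 : Tendsto (fun n : ℕ => Real.posLog ‖x‖ / (n + 1 : ℕ)) atTop (𝓝 0) :=
      (tendsto_const_div_atTop_nhds_zero_nat _).comp (tendsto_add_atTop_nat 1)
    have h2 := (h1.min (tendsto_const_nhds (x := (1 : ℝ)))).const_sub 1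
    simpa using h2
  · simp only [integral_div]
    have h1 : Tendsto (fun n : ℕ => 1 + (Real.circleAverage g 0 (Real.exp n) - n -
        Real.circleAverage g 0 1) / n) atTop (𝓝 (1 + 0)) := by
      refine Tendsto.const_add 1 ?_
      exact ((h.tendsto_circleAverage_exp 0).sub_const _).div_atTop tendsto_natCast_atTop_atTop
    rw [add_zero] at h1
    refine (h1.comp (tendsto_add_atTop_nat 1)).congr fun n => ?_
    rw [h.integral_logTent 0 1 _ one_pos (hexp n)]
    have := (hpos n).ne'
    simp only [Function.comp_apply]
    field_simp
    ring

/-- The differences `n - logTent 1 eⁿ` are truncations of `log⁺` at height `n`. The total mass being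
one, the constant `n` integrates to `n`. -/
theorem integrable_posLog (h : IsPotential m g L) (b : ℂ) :
    Integrable (fun x => Real.posLog ‖x - b‖) m ∧
      ∫ x, Real.posLog ‖x - b‖ ∂m = Real.circleAverage g b 1 - L := by
  have := h.isProbabilityMeasure
  have hexp (n : ℕ) : (1 : ℝ) ≤ Real.exp n := Real.one_le_exp (Nat.cast_nonneg _)
  have hform (n : ℕ) (x : ℂ) : (n : ℝ) - logTent 1 (Real.exp n) ‖x - b‖ =
      min (Real.posLog ‖x - b‖) n := by
    rw [logTent_one_exp _ (norm_nonneg _)]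
    ring
  refine integrable_of_integral_tendsto_of_monotone
    (f := fun n x => (n : ℝ) - logTent 1 (Real.exp n) ‖x - b‖)
    (fun n => (integrable_const _).sub (h.integrable b 1 _ one_pos (hexp n)))
    (fun n => Eventually.of_forall fun x => ?_)
    (Eventually.of_forall fun x i j hij => ?_) (Eventually.of_forall fun x => ?_) ?_
  · simp only [hform]
    exact le_min Real.posLog_nonneg (Nat.cast_nonneg n)
  · simp only [hform]
    exact min_le_min_left _ (Nat.cast_le.2 hij)
  · simp only [hform]
    refine tendsto_const_nhds.congr' ?_
    filter_upwards [tendsto_natCast_atTop_atTop.eventually_ge_atTop (Real.posLog ‖x - b‖)]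
      with n hn
    rw [min_eq_left hn]
  · refine ((h.tendsto_circleAverage_exp b).const_sub (Real.circleAverage g b 1)).congr
      fun n => ?_
    rw [integral_sub (integrable_const _) (h.integrable b 1 _ one_pos (hexp n)),
      h.integral_logTent b 1 _ one_pos (hexp n)]
    simp
    ring

theorem logTent_exp_neg_one (n : ℕ) {t : ℝ} (ht : 0 < t) :
    logTent (Real.exp (-n)) 1 t = min (Real.posLog t⁻¹) n := by
  have h1 : Real.exp (-n) ≤ (1 : ℝ) := Real.exp_le_one_iff.2 (by simp)
  have h2 : Real.posLog t⁻¹ = Real.log (max t 1) - Real.log t := by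
    have := Real.posLog_sub_posLog_inv (x := t)
    rw [Real.posLog_eq_log_max_one ht.le, max_comm] at this
    linarith
  rw [logTent, h2]
  rcases le_total t (Real.exp (-n)) with h | h
  · rw [max_eq_right h, Real.log_exp, min_eq_right, max_eq_right (h.trans h1)]
    · simp
    · rw [max_eq_right (h.trans h1), Real.log_one]
      have := Real.log_le_log ht h
      rw [Real.log_exp] at this
      linarith
  · rw [max_eq_left h, min_eq_left]
    have h3 := Real.log_le_log (Real.exp_pos _) h
    rw [Real.log_exp] at h3
    rcases le_total t 1 with h4 | h4
    · rw [max_eq_right h4, Real.log_one]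
      linarith
    · rw [max_eq_left h4, sub_self]
      exact Nat.cast_nonneg n

theorem tendsto_circleAverage_exp_neg (h : IsPotential m g L) (b : ℂ) :
    Tendsto (fun n : ℕ => Real.circleAverage g b (Real.exp (-n))) atTop (𝓝 (g b)) := by
  have h1 : Tendsto (fun n : ℕ => Real.exp (-n)) atTop (𝓝 0) :=
    Real.tendsto_exp_neg_atTop_nhds_zero.comp tendsto_natCast_atTop_atTop
  have h2 := (Real.Continuous.circleAverage (c := b) h.continuous).tendsto 0
  rw [Real.circleAverage_zero] at h2
  exact h2.comp h1

/-- The tent with radii `e⁻ⁿ` and `1` takes the value `n` at `b`, but its integral stays bounded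
since `g` is continuous at `b`. -/
theorem measure_singleton (h : IsPotential m g L) (b : ℂ) : m {b} = 0 := by
  have := h.isProbabilityMeasure
  have hexp (n : ℕ) : Real.exp (-n) ≤ (1 : ℝ) := Real.exp_le_one_iff.2 (by simp)
  have h1 (n : ℕ) : n * m.real {b} ≤
      Real.circleAverage g b 1 - Real.circleAverage g b (Real.exp (-n)) := by
    rw [← h.integral_logTent b _ _ (Real.exp_pos _) (hexp n)]
    have h2 : ∫ x in {b}, logTent (Real.exp (-n)) 1 ‖x - b‖ ∂m = m.real {b} * n := by
      rw [integral_singleton, sub_self, norm_zero, logTent, max_eq_right zero_le_one,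
        max_eq_right (Real.exp_pos _).le, Real.log_one, Real.log_exp]
      simp
    rw [mul_comm, ← h2]
    exact setIntegral_le_integral (h.integrable b _ _ (Real.exp_pos _) (hexp n))
      (Eventually.of_forall fun x => logTent_nonneg (Real.exp_pos _) (hexp n) _)
  have h3 : Tendsto (fun n : ℕ => (Real.circleAverage g b 1 -
      Real.circleAverage g b (Real.exp (-n))) / n) atTop (𝓝 0) :=
    ((h.tendsto_circleAverage_exp_neg b).const_sub _).div_atTop tendsto_natCast_atTop_atTop
  have h4 : m.real {b} ≤ 0 := by
    refine ge_of_tendsto h3 ?_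
    filter_upwards [eventually_gt_atTop 0] with n hn
    rw [le_div_iff₀ (Nat.cast_pos.2 hn), mul_comm]
    exact h1 n
  exact (measureReal_eq_zero_iff).1 (le_antisymm h4 measureReal_nonneg)

/-- The tents with radii `e⁻ⁿ` and `1` increase to `log⁺ (1 / |x - b|)` off the point `b`, which is
negligible. -/
theorem integrable_posLog_inv (h : IsPotential m g L) (b : ℂ) :
    Integrable (fun x => Real.posLog ‖x - b‖⁻¹) m ∧
      ∫ x, Real.posLog ‖x - b‖⁻¹ ∂m = Real.circleAverage g b 1 - g b := by
  have hexp (n : ℕ) : Real.exp (-n) ≤ (1 : ℝ) := Real.exp_le_one_iff.2 (by simp)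
  have hne : ∀ᵐ x ∂m, 0 < ‖x - b‖ := by
    have : ∀ᵐ x ∂m, x ≠ b := measure_eq_zero_iff_ae_notMem.1 (h.measure_singleton b)
    filter_upwards [this] with x hx
    exact norm_pos_iff.2 (sub_ne_zero.2 hx)
  refine integrable_of_integral_tendsto_of_monotone
    (f := fun n x => logTent (Real.exp (-n)) 1 ‖x - b‖)
    (fun n => h.integrable b _ 1 (Real.exp_pos _) (hexp n))
    (fun n => Eventually.of_forall fun x => logTent_nonneg (Real.exp_pos _) (hexp n) _)
    ?_ ?_ ?_
  · filter_upwards [hne] with x hx i j hij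
    simp only [logTent_exp_neg_one _ hx]
    exact min_le_min_left _ (Nat.cast_le.2 hij)
  · filter_upwards [hne] with x hx
    simp only [logTent_exp_neg_one _ hx]
    refine tendsto_const_nhds.congr' ?_
    filter_upwards [tendsto_natCast_atTop_atTop.eventually_ge_atTop (Real.posLog ‖x - b‖⁻¹)]
      with n hn
    rw [min_eq_left hn]
  · refine ((h.tendsto_circleAverage_exp_neg b).const_sub (Real.circleAverage g b 1)).congr
      fun n => ?_
    rw [h.integral_logTent b _ 1 (Real.exp_pos _) (hexp n)]

end IsPotential

/-- `m` is a probability measure on `ℂ` with logarithmic potential `u`. -/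
structure HasLogPotential (m : Measure ℂ) (u : ℂ → ℝ) : Prop where
  isProbabilityMeasure : IsProbabilityMeasure m
  integrable_posLog : ∀ b : ℂ, Integrable (fun x => Real.posLog ‖x - b‖) m
  integrable_log : ∀ b : ℂ, Integrable (fun x => Real.log ‖x - b‖) m
  integral_log : ∀ b : ℂ, ∫ x, Real.log ‖x - b‖ ∂m = u b

theorem IsPotential.hasLogPotential {m : Measure ℂ} {g : ℂ → ℝ} {L : ℝ}
    (h : IsPotential m g L) : HasLogPotential m (fun b => g b - L) where
  isProbabilityMeasure := h.isProbabilityMeasure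
  integrable_posLog b := (h.integrable_posLog b).1
  integrable_log b := by
    simp_rw [← Real.posLog_sub_posLog_inv]
    exact (h.integrable_posLog b).1.sub (h.integrable_posLog_inv b).1
  integral_log b := by
    simp_rw [← Real.posLog_sub_posLog_inv]
    rw [integral_sub (h.integrable_posLog b).1 (h.integrable_posLog_inv b).1,
      (h.integrable_posLog b).2, (h.integrable_posLog_inv b).2]
    ring

namespace HasLogPotential

variable {m ν : Measure ℂ} {u v : ℂ → ℝ}

/-- One has `|log| = 2 log⁺ - log` and `log⁺ |x - y| ≤ log 2 + log⁺ |x| + log⁺ |y|`. The sign of `v`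
bounds the contribution of `-log` by zero, so the inner integral of the absolute value has an
integrable majorant. -/
theorem integrable_prod_log (hm : HasLogPotential m u) (hν : HasLogPotential ν v)
    (hv : ∀ x, 0 ≤ v x) :
    Integrable (fun z : ℂ × ℂ => Real.log ‖z.1 - z.2‖) (m.prod ν) := by
  have := hm.isProbabilityMeasure
  have := hν.isProbabilityMeasure
  have hmeas : Measurable fun z : ℂ × ℂ => Real.log ‖z.1 - z.2‖ :=
    Real.measurable_log.comp (by fun_prop)
  have hint (x : ℂ) : Integrable (fun y => Real.log ‖x - y‖) ν := by
    simpa only [norm_sub_rev x] using hν.integrable_log x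
  rw [integrable_prod_iff hmeas.aestronglyMeasurable]
  refine ⟨Eventually.of_forall hint, ?_⟩
  have hpos := hν.integrable_posLog 0
  have hbound : Integrable (fun x => 2 * (Real.log 2 + Real.posLog ‖x - 0‖ +
      ∫ y, Real.posLog ‖y - 0‖ ∂ν)) m :=
    (((integrable_const (Real.log 2)).add (hm.integrable_posLog 0)).add (integrable_const _)).const_mul 2
  refine hbound.mono' ?_ (Eventually.of_forall fun x => ?_)
  · exact (hmeas.norm.stronglyMeasurable.integral_prod_right (ν := ν)).aestronglyMeasurable
  · have hint' : Integrable (fun y => Real.posLog ‖x - y‖) ν := by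
      simpa only [norm_sub_rev x] using hν.integrable_posLog x
    have h1 : ∫ y, Real.posLog ‖x - y‖ ∂ν ≤ Real.log 2 + Real.posLog ‖x - 0‖ +
        ∫ y, Real.posLog ‖y - 0‖ ∂ν := by
      have h2 : ∫ y, Real.posLog ‖x - y‖ ∂ν ≤
          ∫ y, ((Real.log 2 + Real.posLog ‖x - 0‖) + Real.posLog ‖y - 0‖) ∂ν := by
        refine integral_mono hint' ((integrable_const _).add hpos) fun y => ?_
        have h2 := Real.posLog_norm_add_le x (-y)
        rw [norm_neg, ← sub_eq_add_neg] at h2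
        simp only [sub_zero]
        linarith
      rw [integral_add (integrable_const _) hpos] at h2
      simpa using h2
    have h3 : ∀ y, ‖Real.log ‖x - y‖‖ = 2 * Real.posLog ‖x - y‖ - Real.log ‖x - y‖ := by
      intro y
      rw [← Real.half_mul_log_add_log_abs, Real.norm_eq_abs]
      ring
    have h4 : ∫ y, Real.log ‖x - y‖ ∂ν = v x := by
      simp_rw [norm_sub_rev x, hν.integral_log]
    rw [Real.norm_of_nonneg (integral_nonneg fun y => norm_nonneg _)]
    simp_rw [h3]
    rw [integral_sub (hint'.const_mul 2) (hint x), integral_const_mul, h4]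
    linarith [hv x]

/-- The mutual energy of two measures is symmetric. With `ν` the Fubini-Study measure, `∫ v dm` is
seen to depend on `m` only through its potential. -/
theorem integral_eq_integral (hm : HasLogPotential m u) (hν : HasLogPotential ν v)
    (hv : ∀ x, 0 ≤ v x) :
    Integrable v m ∧ ∫ x, v x ∂m = ∫ y, u y ∂ν := by
  have := hm.isProbabilityMeasure
  have := hν.isProbabilityMeasure
  have h1 := hm.integrable_prod_log hν hv
  have h2 (x : ℂ) : ∫ y, Real.log ‖x - y‖ ∂ν = v x := by
    simp_rw [norm_sub_rev x, hν.integral_log]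
  constructor
  · simpa [h2] using h1.integral_prod_left
  · rw [← integral_congr_ae (Eventually.of_forall h2),
      ← integral_congr_ae (Eventually.of_forall hm.integral_log)]
    exact integral_integral_swap h1

end HasLogPotential

/-! ### Weak convergence of probability measures with convergent potentials -/

theorem exists_tendsto_of_forall_approx {a : ℕ → ℝ}
    (h : ∀ ε > 0, ∃ b : ℕ → ℝ, (∃ l, Tendsto b atTop (𝓝 l)) ∧ ∀ n, |a n - b n| ≤ ε) :
    ∃ l, Tendsto a atTop (𝓝 l) := by
  refine cauchySeq_tendsto_of_complete (Metric.cauchySeq_iff'.2 fun ε hε => ?_)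
  obtain ⟨b, ⟨l, hl⟩, hab⟩ := h (ε / 4) (by positivity)
  obtain ⟨N, hN⟩ := Metric.cauchySeq_iff'.1 hl.cauchySeq (ε / 4) (by positivity)
  refine ⟨N, fun n hn => ?_⟩
  have h1 := hN n hn
  have h2 := abs_le.1 (hab n)
  have h3 := abs_le.1 (hab N)
  rw [Real.dist_eq, abs_lt] at h1 ⊢
  constructor <;> linarith [h1.1, h1.2]

theorem integrable_logTent_volume {r R : ℝ} (hr : 0 < r) (hrR : r ≤ R) (x : ℂ) :
    Integrable fun b : ℂ => logTent r R ‖x - b‖ := by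
  refine Continuous.integrable_of_hasCompactSupport
    ((continuous_logTent hr (hr.trans_le hrR)).comp (by fun_prop)) ?_
  refine HasCompactSupport.intro (isCompact_closedBall x R) fun b hb => logTent_of_ge hrR ?_
  rw [Metric.mem_closedBall, dist_eq_norm, not_le, norm_sub_rev] at hb
  exact hb.le

theorem integral_logTent_pos {r R : ℝ} (hr : 0 < r) (hrR : r < R) :
    0 < ∫ b : ℂ, logTent r R ‖b‖ := by
  have h1 := integrable_logTent_volume hr hrR.le 0
  simp only [zero_sub, norm_neg] at h1
  rw [integral_pos_iff_support_of_nonneg (fun b => logTent_nonneg hr hrR.le _) h1]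
  refine (Metric.measure_ball_pos volume (0 : ℂ) hr).trans_le (measure_mono fun b hb => ?_)
  rw [mem_ball_zero_iff] at hb
  rw [Function.mem_support, logTent, max_eq_right (hb.trans hrR).le, max_eq_right hb.le]
  exact (sub_pos.2 (Real.log_lt_log hr hrR)).ne'

/-- Up to `ε`, `ψ` is its convolution with a normalized tent of small support. For the convolution,
Fubini and dominated convergence reduce the claim to the tents. -/
theorem exists_tendsto_integral_of_hasCompactSupport {ν : ℕ → Measure ℂ}
    [∀ n, IsProbabilityMeasure (ν n)]
    (hν : ∀ (b : ℂ) (r : ℝ), 0 < r →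
      ∃ l, Tendsto (fun n => ∫ x, logTent r (2 * r) ‖x - b‖ ∂ν n) atTop (𝓝 l))
    {ψ : ℂ → ℝ} (hψ : Continuous ψ) (hψc : HasCompactSupport ψ) :
    ∃ l, Tendsto (fun n => ∫ x, ψ x ∂ν n) atTop (𝓝 l) := by
  refine exists_tendsto_of_forall_approx fun ε hε => ?_
  obtain ⟨δ, hδ, hψδ⟩ := Metric.uniformContinuous_iff.1
    (hψc.uniformContinuous_of_continuous hψ) ε hε
  -- The support of the tent has radius `2 r < δ`, within the scale at which `ψ` oscillates by less
  -- than `ε`.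
  set r := δ / 3
  have hr : 0 < r := by positivity
  have hr2 : r < 2 * r := by linarith
  set c := ∫ b : ℂ, logTent r (2 * r) ‖b‖ with hc
  have hc0 : 0 < c := integral_logTent_pos hr hr2
  have hcx (x : ℂ) : ∫ b : ℂ, logTent r (2 * r) ‖x - b‖ = c := by
    rw [hc, ← integral_sub_left_eq_self (fun b => logTent r (2 * r) ‖b‖) volume x]
  have hT := continuous_logTent hr (hr.trans hr2)
  have hψi : Integrable ψ := hψ.integrable_of_hasCompactSupport hψc
  have hTle (t : ℝ) : ‖logTent r (2 * r) t‖ ≤ Real.log (2 * r) - Real.log r := by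
    rw [Real.norm_of_nonneg (logTent_nonneg hr hr2.le t)]
    exact logTent_le hr hr2.le t
  have hprod (n : ℕ) : Integrable (fun z : ℂ × ℂ => ψ z.2 * logTent r (2 * r) ‖z.1 - z.2‖)
      ((ν n).prod volume) := by
    have h1 : Integrable (fun z : ℂ × ℂ => (Real.log (2 * r) - Real.log r) * ψ z.2)
        ((ν n).prod volume) := (integrable_const _).mul_prod hψi
    refine h1.norm.mono' (Continuous.aestronglyMeasurable (by fun_prop))
      (Eventually.of_forall fun z => ?_)
    rw [norm_mul, norm_mul, mul_comm]
    exact mul_le_mul_of_nonneg_right ((hTle _).trans (le_abs_self _)) (norm_nonneg _)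
  refine ⟨fun n => c⁻¹ * ∫ b, ψ b * ∫ x, logTent r (2 * r) ‖x - b‖ ∂ν n, ?_, fun n => ?_⟩
  · choose l hl using fun b => hν b r hr
    refine ⟨c⁻¹ * ∫ b, ψ b * l b, Tendsto.const_mul _ ?_⟩
    refine tendsto_integral_of_dominated_convergence
      (fun b => ‖ψ b‖ * (Real.log (2 * r) - Real.log r)) (fun n => ?_)
      (hψi.norm.mul_const _) (fun n => Eventually.of_forall fun b => ?_)
      (Eventually.of_forall fun b => (hl b).const_mul _)
    · have := (hprod n).integral_prod_right.aestronglyMeasurable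
      simpa only [integral_const_mul] using this
    · rw [norm_mul]
      refine mul_le_mul_of_nonneg_left ?_ (norm_nonneg _)
      simpa using norm_integral_le_of_norm_le_const (μ := ν n)
        (Eventually.of_forall fun x => hTle ‖x - b‖)
  · have h1 : ∫ b, ψ b * ∫ x, logTent r (2 * r) ‖x - b‖ ∂ν n =
        ∫ x, (∫ b, ψ b * logTent r (2 * r) ‖x - b‖) ∂ν n := by
      simp_rw [← integral_const_mul]
      exact (integral_integral_swap (hprod n)).symm
    have hint : Integrable (fun x => ∫ b, ψ b * logTent r (2 * r) ‖x - b‖) (ν n) :=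
      (hprod n).integral_prod_left
    have hψn : Integrable ψ (ν n) := hψ.integrable_of_hasCompactSupport hψc
    beta_reduce
    rw [h1, ← integral_const_mul, ← integral_sub hψn (hint.const_mul _), ← Real.norm_eq_abs]
    refine (norm_integral_le_of_norm_le_const (C := ε) (Eventually.of_forall fun x => ?_)).trans
      (by simp)
    have h2 : Integrable fun b => ψ b * logTent r (2 * r) ‖x - b‖ := by
      refine (hψi.norm.mul_const (Real.log (2 * r) - Real.log r)).mono'
        (Continuous.aestronglyMeasurable (by fun_prop)) (Eventually.of_forall fun b => ?_)
      rw [norm_mul]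
      exact mul_le_mul_of_nonneg_left (hTle _) (norm_nonneg _)
    have h3 := integrable_logTent_volume hr hr2.le x
    have h4 : ψ x - c⁻¹ * ∫ b, ψ b * logTent r (2 * r) ‖x - b‖ =
        c⁻¹ * ∫ b, (ψ x - ψ b) * logTent r (2 * r) ‖x - b‖ := by
      simp_rw [sub_mul]
      rw [integral_sub (h3.const_mul _) h2, integral_const_mul, hcx]
      field_simp
    rw [h4, norm_mul, Real.norm_of_nonneg (inv_pos.2 hc0).le, inv_mul_le_iff₀ hc0]
    have h5 : ‖∫ b, (ψ x - ψ b) * logTent r (2 * r) ‖x - b‖‖ ≤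
        ∫ b, ε * logTent r (2 * r) ‖x - b‖ := by
      refine norm_integral_le_of_norm_le (h3.const_mul ε) (Eventually.of_forall fun b => ?_)
      rw [norm_mul, Real.norm_of_nonneg (logTent_nonneg hr hr2.le ‖x - b‖)]
      rcases lt_or_ge ‖x - b‖ (2 * r) with h | h
      · refine mul_le_mul_of_nonneg_right ?_ (logTent_nonneg hr hr2.le _)
        have h6 : dist x b < δ := by
          rw [dist_eq_norm]
          refine h.trans ?_
          simp only [r]
          linarith
        exact (hψδ h6).le
      · rw [logTent_of_ge hr2.le h, mul_zero, mul_zero]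
    rw [integral_const_mul, hcx] at h5
    linarith

theorem exists_tendsto_integral_sphere {ν : ℕ → Measure ℂ} [∀ n, IsProbabilityMeasure (ν n)]
    (hν : ∀ (b : ℂ) (r : ℝ), 0 < r →
      ∃ l, Tendsto (fun n => ∫ x, logTent r (2 * r) ‖x - b‖ ∂ν n) atTop (𝓝 l))
    (φ : C(RiemannSphere, ℝ)) :
    ∃ l, Tendsto (fun n => ∫ x, φ (x : OnePoint ℂ) ∂ν n) atTop (𝓝 l) := by
  refine exists_tendsto_of_forall_approx fun ε hε => ?_
  set φ₀ : ℂ → ℝ := fun x => φ (x : OnePoint ℂ) - φ OnePoint.infty with hφ₀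
  have cφ : Continuous fun x : ℂ => φ (x : OnePoint ℂ) := φ.continuous.comp OnePoint.continuous_coe
  have cφ₀ : Continuous φ₀ := cφ.sub continuous_const
  have hlim : Tendsto φ₀ (cocompact ℂ) (𝓝 0) := by
    have h1 := (φ.continuous.tendsto OnePoint.infty).comp (OnePoint.tendsto_coe_infty (X := ℂ))
    rw [coclosedCompact_eq_cocompact] at h1
    simpa [hφ₀] using h1.sub_const (φ OnePoint.infty)
  -- Subtracting the part of `φ₀` clipped to `[-ε, ε]` leaves a compactly supported function within
  -- `ε` of `φ₀`, since `φ₀` vanishes at infinity.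
  set ψ : ℂ → ℝ := fun x => φ₀ x - max (-ε) (min ε (φ₀ x)) with hψ
  have cψ : Continuous ψ := by fun_prop
  have hψc : HasCompactSupport ψ := by
    rw [hasCompactSupport_iff_eventuallyEq, coclosedCompact_eq_cocompact]
    filter_upwards [Metric.tendsto_nhds.1 hlim ε hε] with x hx
    rw [Real.dist_eq, sub_zero, abs_lt] at hx
    simp only [hψ, Pi.zero_apply]
    rw [min_eq_right hx.2.le, max_eq_right hx.1.le, sub_self]
  obtain ⟨l, hl⟩ := exists_tendsto_integral_of_hasCompactSupport hν cψ hψc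
  refine ⟨fun n => ∫ x, ψ x ∂ν n + φ OnePoint.infty, ⟨_, hl.add_const _⟩, fun n => ?_⟩
  have hψn : Integrable ψ (ν n) := cψ.integrable_of_hasCompactSupport hψc
  have hφn : Integrable (fun x : ℂ => φ (x : OnePoint ℂ)) (ν n) := by
    obtain ⟨C, hC⟩ := (isCompact_range φ.continuous).isBounded.exists_norm_le
    exact Integrable.of_bound cφ.aestronglyMeasurable C
      (Eventually.of_forall fun x => hC _ ⟨_, rfl⟩)
  have h1 : ∫ x, φ (x : OnePoint ℂ) ∂ν n - (∫ x, ψ x ∂ν n + φ OnePoint.infty) =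
      ∫ x, max (-ε) (min ε (φ₀ x)) ∂ν n := by
    have h2 : ∀ x, max (-ε) (min ε (φ₀ x)) = φ (x : OnePoint ℂ) - (ψ x + φ OnePoint.infty) := by
      intro x
      simp only [hψ, hφ₀]
      ring
    simp_rw [h2]
    have h3 : Integrable (fun x => ψ x + φ OnePoint.infty) (ν n) := hψn.add (integrable_const _)
    rw [integral_sub hφn h3, integral_add hψn (integrable_const _)]
    simp
  rw [h1, ← Real.norm_eq_abs]
  refine (norm_integral_le_of_norm_le_const (C := ε) (Eventually.of_forall fun x => ?_)).trans
    (by simp)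
  rw [Real.norm_eq_abs, abs_le]
  exact ⟨le_max_left _ _, max_le (by linarith) (min_le_left _ _)⟩

/-- Probability measures on the plane whose potentials converge have a weak limit on the
Riemann sphere. -/
theorem exists_weak_limit {ν : ℕ → Measure ℂ} [∀ n, IsProbabilityMeasure (ν n)]
    (hν : ∀ (b : ℂ) (r : ℝ), 0 < r →
      ∃ l, Tendsto (fun n => ∫ x, logTent r (2 * r) ‖x - b‖ ∂ν n) atTop (𝓝 l)) :
    ∃ μ : Measure RiemannSphere, IsProbabilityMeasure μ ∧ ∀ φ : C(RiemannSphere, ℝ),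
      Tendsto (fun n => ∫ x, φ (x : OnePoint ℂ) ∂ν n) atTop (𝓝 (∫ x, φ x ∂μ)) := by
  have hmeas : Measurable ((↑) : ℂ → OnePoint ℂ) := OnePoint.continuous_coe.measurable
  set P : ℕ → ProbabilityMeasure RiemannSphere := fun n =>
    ⟨(ν n).map ((↑) : ℂ → OnePoint ℂ), Measure.isProbabilityMeasure_map hmeas.aemeasurable⟩
  -- A cluster point exists because the probability measures on the compact sphere form a compact
  -- space; it is a limit since every sequence of integrals already converges.
  obtain ⟨μ, -, hμ⟩ := isCompact_univ (X := ProbabilityMeasure RiemannSphere)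
    (f := map P atTop) (by simp)
  refine ⟨μ, inferInstance, fun φ => ?_⟩
  obtain ⟨l, hl⟩ := exists_tendsto_integral_sphere hν φ
  have hP (n : ℕ) : ∫ x, φ x ∂(P n : Measure RiemannSphere) = ∫ x, φ (x : OnePoint ℂ) ∂ν n :=
    integral_map hmeas.aemeasurable φ.continuous.aestronglyMeasurable
  have hcont : Continuous fun μ : ProbabilityMeasure RiemannSphere =>
      ∫ x, φ x ∂(μ : Measure RiemannSphere) :=
    ProbabilityMeasure.continuous_integral_continuousMap φ
  have h1 : ClusterPt (∫ x, φ x ∂(μ : Measure RiemannSphere))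
      (map (fun n => ∫ x, φ (x : OnePoint ℂ) ∂ν n) atTop) := by
    have := hμ.map hcont.continuousAt (tendsto_map (f := fun μ : ProbabilityMeasure RiemannSphere =>
      ∫ x, φ x ∂(μ : Measure RiemannSphere)))
    rw [map_map] at this
    convert this using 2
    ext n
    exact (hP n).symm
  have h2 : ClusterPt (∫ x, φ x ∂(μ : Measure RiemannSphere)) (𝓝 l) := h1.mono hl
  rwa [(eq_of_nhds_neBot h2)] 

/-! ### Binary forms, their factorizations and resultants -/

/-- The determinant of two vectors of `ℂ²`. -/
def wedge (v w : ℂ × ℂ) : ℂ := v.1 * w.2 - v.2 * w.1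

/-- The value at `v` of the homogenization of degree `m` of the polynomial `p`. -/
noncomputable def homEval (m : ℕ) (p : ℂ[X]) (v : ℂ × ℂ) : ℂ :=
  ∑ i ∈ Finset.range (m + 1), p.coeff i * v.1 ^ i * v.2 ^ (m - i)

theorem wedge_smul_left (c : ℂ) (v w : ℂ × ℂ) : wedge (c • v) w = c * wedge v w := by
  simp only [wedge, Prod.smul_fst, Prod.smul_snd, smul_eq_mul]
  ring

theorem wedge_smul_right (c : ℂ) (v w : ℂ × ℂ) : wedge v (c • w) = c * wedge v w := by
  simp only [wedge, Prod.smul_fst, Prod.smul_snd, smul_eq_mul]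
  ring

theorem norm_wedge_le (v w : ℂ × ℂ) : ‖wedge v w‖ ≤ 2 * ‖v‖ * ‖w‖ := by
  have h1 := norm_fst_le v
  have h2 := norm_snd_le v
  have h3 := norm_fst_le w
  have h4 := norm_snd_le w
  calc ‖wedge v w‖ ≤ ‖v.1‖ * ‖w.2‖ + ‖v.2‖ * ‖w.1‖ := by
        rw [← norm_mul, ← norm_mul]
        exact norm_sub_le _ _
    _ ≤ ‖v‖ * ‖w‖ + ‖v‖ * ‖w‖ := by gcongr
    _ = 2 * ‖v‖ * ‖w‖ := by ring

section HomEval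

variable {m n : ℕ} {p q : ℂ[X]}

theorem homEval_smul (m : ℕ) (p : ℂ[X]) (c : ℂ) (v : ℂ × ℂ) :
    homEval m p (c • v) = c ^ m * homEval m p v := by
  simp only [homEval, Finset.mul_sum, Prod.smul_fst, Prod.smul_snd, smul_eq_mul]
  refine Finset.sum_congr rfl fun i hi => ?_
  have : c ^ m = c ^ i * c ^ (m - i) := by
    rw [← pow_add, Nat.add_sub_cancel' (Nat.lt_succ_iff.1 (Finset.mem_range.1 hi))]
  rw [mul_pow, mul_pow, this]
  ring

theorem homEval_one_right (hp : p.natDegree ≤ m) (z : ℂ) : homEval m p (z, 1) = p.eval z := by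
  simp only [homEval, one_pow, mul_one]
  exact (eval_eq_sum_range' (Nat.lt_succ_of_le hp) z).symm

theorem homEval_of_ne_zero (hp : p.natDegree ≤ m) {v : ℂ × ℂ} (hv : v.2 ≠ 0) :
    homEval m p v = v.2 ^ m * p.eval (v.1 / v.2) := by
  have : v = v.2 • (v.1 / v.2, (1 : ℂ)) := by
    ext <;> simp
    field_simp
  conv_lhs => rw [this]
  rw [homEval_smul, homEval_one_right hp]

theorem homEval_zero_right (m : ℕ) (p : ℂ[X]) {v : ℂ × ℂ} (hv : v.2 = 0) :
    homEval m p v = p.coeff m * v.1 ^ m := by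
  rw [homEval, Finset.sum_range_succ, Finset.sum_eq_zero, hv]
  · simp
  · intro i hi
    rw [hv, zero_pow (Nat.sub_ne_zero_of_lt (Finset.mem_range.1 hi)), mul_zero]

theorem homEval_mul (hp : p.natDegree ≤ m) (hq : q.natDegree ≤ n) (v : ℂ × ℂ) :
    homEval (m + n) (p * q) v = homEval m p v * homEval n q v := by
  by_cases hv : v.2 = 0
  · rw [homEval_zero_right _ _ hv, homEval_zero_right _ _ hv, homEval_zero_right _ _ hv,
      coeff_mul_add_eq_of_natDegree_le hp hq, pow_add]
    ring
  · rw [homEval_of_ne_zero hp hv, homEval_of_ne_zero hq hv,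
      homEval_of_ne_zero (natDegree_mul_le_of_le hp hq) hv, eval_mul, pow_add]
    ring

theorem homEval_pow (hp : p.natDegree ≤ m) (k : ℕ) (v : ℂ × ℂ) :
    homEval (k * m) (p ^ k) v = homEval m p v ^ k := by
  induction k with
  | zero => simp [homEval]
  | succ k ih =>
    rw [pow_succ, pow_succ, add_mul, one_mul, homEval_mul (natDegree_pow_le_of_le k hp) hp, ih]

theorem homEval_sum {ι : Type*} (s : Finset ι) (f : ι → ℂ[X]) (v : ℂ × ℂ) :
    homEval m (∑ i ∈ s, f i) v = ∑ i ∈ s, homEval m (f i) v := by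
  simp only [homEval, finsetSum_coeff, Finset.sum_mul]
  exact Finset.sum_comm

theorem homEval_add (v : ℂ × ℂ) : homEval m (p + q) v = homEval m p v + homEval m q v := by
  simp only [homEval, coeff_add, add_mul, Finset.sum_add_distrib]

theorem homEval_C_mul (c : ℂ) (v : ℂ × ℂ) : homEval m (C c * p) v = c * homEval m p v := by
  simp only [homEval, coeff_C_mul, Finset.mul_sum, mul_assoc]

theorem exists_fin_prod_eq {α : Type*} (s : Multiset α) (k : ℕ) (hk : s.card = k) :
    ∃ a : Fin k → α, ∀ f : α → ℂ, ∏ i, f (a i) = (s.map f).prod := by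
  subst hk
  refine Quotient.inductionOn s fun l => ⟨fun i => l.get i, fun f => ?_⟩
  exact Fin.prod_univ_fun_getElem l f

/-- `κ ∏ (v ∧ aᵢ)` is a factorization of the binary form of degree `m` given by `p`. -/
structure IsFactorization (m : ℕ) (p : ℂ[X]) (κ : ℂ) (a : Fin m → ℂ × ℂ) : Prop where
  ne_zero : κ ≠ 0
  norm_eq_one : ∀ i, ‖a i‖ = 1
  homEval_eq : ∀ v, homEval m p v = κ * ∏ i, wedge v (a i)
  norm_resultant : ∀ (n : ℕ) (q : ℂ[X]), q.natDegree ≤ n →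
    ‖resultant p q m n‖ = ‖κ‖ ^ n * ∏ i, ‖homEval n q (a i)‖

/-- A polynomial of degree below `m` is a form with additional roots at infinity. The resultant is,
up to sign, the product of the values of `q` over all roots, those at infinity included. -/
theorem exists_isFactorization (hp0 : p ≠ 0) (hp : p.natDegree ≤ m) :
    ∃ κ a, IsFactorization m p κ a := by
  obtain ⟨j, rfl⟩ := Nat.exists_eq_add_of_le hp
  have hsplit : p.Splits := IsAlgClosed.splits p
  obtain ⟨r, hr⟩ := exists_fin_prod_eq p.roots p.natDegree hsplit.natDegree_eq_card_roots.symm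
  -- An affine root `r` is the vector `(r, 1)`; the missing degree `j` gives `j` copies of `(1, 0)`.
  -- As `v ∧ (1, 0) = -v.2`, the leading constant acquires the sign `(-1)^j`.
  set a : Fin (p.natDegree + j) → ℂ × ℂ :=
    Fin.addCases (fun i => (r i, 1)) (fun _ => (1, 0)) with ha
  have hl : p.leadingCoeff ≠ 0 := leadingCoeff_ne_zero.2 hp0
  have ha0 : ∀ i, a i ≠ 0 := by
    intro i
    refine Fin.addCases (fun i => ?_) (fun i => ?_) i
    · simp [ha]
    · simp [ha]
  set κ : ℂ := p.leadingCoeff * (-1) ^ j with hκ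
  have h1 : ∀ v, homEval (p.natDegree + j) p v = κ * ∏ i, wedge v (a i) := by
    intro v
    have h2 : ∏ i, wedge v (a i) = (∏ i, (v.1 - v.2 * r i)) * (-v.2) ^ j := by
      rw [Fin.prod_univ_add]
      simp [ha, wedge]
    rw [h2, hκ, neg_pow]
    have h3 : ((-1 : ℂ) ^ j) * (-1) ^ j = 1 := by rw [← mul_pow]; simp
    by_cases hv : v.2 = 0
    · rw [homEval_zero_right _ _ hv, hv]
      rcases Nat.eq_zero_or_pos j with rfl | hj
      · simp
      · rw [coeff_eq_zero_of_natDegree_lt (by omega)]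
        simp [zero_pow hj.ne']
    · rw [homEval_of_ne_zero hp hv, hsplit.eval_eq_prod_roots, ← hr fun x => v.1 / v.2 - x]
      have h4 : ∏ i, (v.1 - v.2 * r i) = v.2 ^ p.natDegree * ∏ i, (v.1 / v.2 - r i) := by
        have : v.2 ^ p.natDegree = ∏ i : Fin p.natDegree, v.2 := by simp
        rw [this, ← Finset.prod_mul_distrib]
        refine Finset.prod_congr rfl fun i _ => ?_
        field_simp
      rw [h4, pow_add]
      linear_combination (-v.2 ^ p.natDegree * v.2 ^ j * p.leadingCoeff *
        ∏ i, (v.1 / v.2 - r i)) * h3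
  have h5 : ∀ (n : ℕ) (q : ℂ[X]), q.natDegree ≤ n →
      ‖resultant p q (p.natDegree + j) n‖ = ‖κ‖ ^ n * ∏ i, ‖homEval n q (a i)‖ := by
    intro n q hq
    rw [resultant_add_left_deg _ _ _ _ _ le_rfl, resultant_eq_prod_eval _ _ _ hq hsplit,
      ← hr fun x => q.eval x, Fin.prod_univ_add]
    simp only [ha, Fin.addCases_left, Fin.addCases_right, homEval_one_right hq,
      homEval_zero_right n q (v := (1, 0)) rfl]
    simp [hκ]
    ring
  clear_value κ a
  -- Normalizing the roots moves their norms into `κ`; this respects the resultant formula because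
  -- `homEval n q` is homogeneous of degree `n`.
  refine ⟨κ * ∏ i, (‖a i‖ : ℂ), fun i => (‖a i‖ : ℂ)⁻¹ • a i, ?_, ?_, ?_, ?_⟩
  · refine mul_ne_zero (by simp [hκ, hl]) (Finset.prod_ne_zero_iff.2 fun i _ => ?_)
    simpa using ha0 i
  · intro i
    rw [norm_smul, norm_inv, Complex.norm_real, norm_norm,
      inv_mul_cancel₀ (norm_ne_zero_iff.2 (ha0 i))]
  · intro v
    rw [h1, mul_assoc, ← Finset.prod_mul_distrib]
    congr 1
    refine Finset.prod_congr rfl fun i _ => ?_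
    rw [wedge_smul_right, mul_inv_cancel_left₀]
    simpa using ha0 i
  · intro n q hq
    rw [h5 n q hq, norm_mul, mul_pow, mul_assoc, norm_prod, ← Finset.prod_pow,
      ← Finset.prod_mul_distrib]
    congr 1
    refine Finset.prod_congr rfl fun i _ => ?_
    have := norm_ne_zero_iff.2 (ha0 i)
    rw [homEval_smul, norm_mul, norm_pow, norm_inv, Complex.norm_real, norm_norm, inv_pow,
      mul_inv_cancel_left₀ (pow_ne_zero n this)]

end HomEval

/-! ### Homogeneous lifts of rational maps -/

/-- `P / Q` is a reduced fraction of degree `d`. -/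
structure IsReduced (d : ℕ) (P Q : ℂ[X]) : Prop where
  isCoprime : IsCoprime P Q
  max_natDegree : max P.natDegree Q.natDegree = d

/-- The homogeneous lift to `ℂ²` of the rational map `P / Q` of degree `d`. -/
noncomputable def ratLift (d : ℕ) (P Q : ℂ[X]) (v : ℂ × ℂ) : ℂ × ℂ :=
  (homEval d P v, homEval d Q v)

theorem ratLift_smul (d : ℕ) (P Q : ℂ[X]) (c : ℂ) (v : ℂ × ℂ) :
    ratLift d P Q (c • v) = c ^ d • ratLift d P Q v := by
  simp only [ratLift, homEval_smul, Prod.smul_mk, smul_eq_mul]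

/-- The polynomials representing the iterates of the homogeneous lift of `P / Q`. -/
noncomputable def iterPoly (d : ℕ) (P Q : ℂ[X]) : ℕ → ℂ[X] × ℂ[X]
  | 0 => (X, 1)
  | n + 1 =>
    (∑ i ∈ Finset.range (d + 1), C (P.coeff i) * ((iterPoly d P Q n).1 ^ i *
        (iterPoly d P Q n).2 ^ (d - i)),
      ∑ i ∈ Finset.range (d + 1), C (Q.coeff i) * ((iterPoly d P Q n).1 ^ i *
        (iterPoly d P Q n).2 ^ (d - i)))

namespace IsReduced

variable {d : ℕ} {P Q : ℂ[X]}

theorem natDegree_left (h : IsReduced d P Q) : P.natDegree ≤ d :=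
  (le_max_left _ _).trans h.max_natDegree.le

theorem natDegree_right (h : IsReduced d P Q) : Q.natDegree ≤ d :=
  (le_max_right _ _).trans h.max_natDegree.le

theorem coeff_ne_zero (h : IsReduced d P Q) (hd : 0 < d) : P.coeff d ≠ 0 ∨ Q.coeff d ≠ 0 := by
  rcases max_choice P.natDegree Q.natDegree with h1 | h1
  · left
    rw [← h.max_natDegree, h1]
    refine leadingCoeff_ne_zero.2 fun h2 => hd.ne' ?_
    rw [← h.max_natDegree, h1, h2, natDegree_zero]
  · right
    rw [← h.max_natDegree, h1]
    refine leadingCoeff_ne_zero.2 fun h2 => hd.ne' ?_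
    rw [← h.max_natDegree, h1, h2, natDegree_zero]

theorem eval_ne_zero (h : IsReduced d P Q) (z : ℂ) : P.eval z ≠ 0 ∨ Q.eval z ≠ 0 := by
  by_contra! hz
  obtain ⟨a, b, hab⟩ := h.isCoprime
  have := congrArg (eval z) hab
  simp [hz.1, hz.2] at this

theorem ratLift_ne_zero (h : IsReduced d P Q) (hd : 0 < d) {v : ℂ × ℂ} (hv : v ≠ 0) :
    ratLift d P Q v ≠ 0 := by
  intro h0
  have h1 : homEval d P v = 0 := congrArg Prod.fst h0
  have h2 : homEval d Q v = 0 := congrArg Prod.snd h0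
  by_cases hv2 : v.2 = 0
  · have hv1 : v.1 ≠ 0 := fun h => hv (Prod.ext h hv2)
    rw [homEval_zero_right _ _ hv2] at h1 h2
    rcases h.coeff_ne_zero hd with h3 | h3
    · exact (mul_ne_zero h3 (pow_ne_zero _ hv1)) h1
    · exact (mul_ne_zero h3 (pow_ne_zero _ hv1)) h2
  · rw [homEval_of_ne_zero h.natDegree_left hv2] at h1
    rw [homEval_of_ne_zero h.natDegree_right hv2] at h2
    rcases h.eval_ne_zero (v.1 / v.2) with h3 | h3
    · exact (mul_ne_zero (pow_ne_zero _ hv2) h3) h1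
    · exact (mul_ne_zero (pow_ne_zero _ hv2) h3) h2

end IsReduced

theorem natDegree_sum_form_le {d k : ℕ} (P A B : ℂ[X]) (hA : A.natDegree ≤ k)
    (hB : B.natDegree ≤ k) :
    (∑ i ∈ Finset.range (d + 1), C (P.coeff i) * (A ^ i * B ^ (d - i))).natDegree ≤ d * k := by
  refine natDegree_sum_le_of_forall_le _ _ fun i hi => ?_
  have hi' : i ≤ d := Nat.lt_succ_iff.1 (Finset.mem_range.1 hi)
  refine (natDegree_C_mul_le _ _).trans ?_
  refine (natDegree_mul_le_of_le (natDegree_pow_le_of_le i hA)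
    (natDegree_pow_le_of_le (d - i) hB)).trans ?_
  rw [← add_mul, Nat.add_sub_cancel' hi']

theorem homEval_sum_form {d k : ℕ} (P A B : ℂ[X]) (hA : A.natDegree ≤ k)
    (hB : B.natDegree ≤ k) (v : ℂ × ℂ) :
    homEval (d * k) (∑ i ∈ Finset.range (d + 1), C (P.coeff i) * (A ^ i * B ^ (d - i))) v =
      homEval d P (homEval k A v, homEval k B v) := by
  rw [homEval_sum, homEval]
  refine Finset.sum_congr rfl fun i hi => ?_
  have hi' : i ≤ d := Nat.lt_succ_iff.1 (Finset.mem_range.1 hi)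
  have : d * k = i * k + (d - i) * k := by rw [← add_mul, Nat.add_sub_cancel' hi']
  rw [homEval_C_mul, this, homEval_mul (natDegree_pow_le_of_le i hA)
    (natDegree_pow_le_of_le (d - i) hB), homEval_pow hA, homEval_pow hB, mul_assoc]

theorem natDegree_iterPoly (d : ℕ) (P Q : ℂ[X]) (n : ℕ) :
    (iterPoly d P Q n).1.natDegree ≤ d ^ n ∧ (iterPoly d P Q n).2.natDegree ≤ d ^ n := by
  induction n with
  | zero => simp [iterPoly]
  | succ n ih =>
    rw [pow_succ', iterPoly]
    exact ⟨natDegree_sum_form_le P _ _ ih.1 ih.2, natDegree_sum_form_le Q _ _ ih.1 ih.2⟩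

/-- The iterates are treated as forms of weight `dⁿ`. Only the non-vanishing of `Fⁿ` off the origin
will be needed, never a reduced fraction for `fⁿ`. -/
theorem homEval_iterPoly (d : ℕ) (P Q : ℂ[X]) (n : ℕ) (v : ℂ × ℂ) :
    (homEval (d ^ n) (iterPoly d P Q n).1 v, homEval (d ^ n) (iterPoly d P Q n).2 v) =
      (ratLift d P Q)^[n] v := by
  induction n with
  | zero => ext <;> simp [iterPoly, homEval, Finset.sum_range_succ, coeff_one]
  | succ n ih =>
    have h := natDegree_iterPoly d P Q n
    rw [Function.iterate_succ_apply', ← ih, pow_succ', iterPoly, ratLift]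
    simp only [homEval_sum_form _ _ _ h.1 h.2]

/-! ### The Green function of a homogeneous map of `ℂ²` -/

/-- `F` is a homogeneous map of degree `d` of `ℂ²` with `|log ‖F v‖ - d log ‖v‖| ≤ C`. -/
structure IsHomLift (d : ℕ) (F : ℂ × ℂ → ℂ × ℂ) (C : ℝ) : Prop where
  two_le : 2 ≤ d
  smul : ∀ (c : ℂ) v, F (c • v) = c ^ d • F v
  ne_zero : ∀ v, v ≠ 0 → F v ≠ 0
  abs_le : ∀ v, v ≠ 0 → |Real.log ‖F v‖ - d * Real.log ‖v‖| ≤ C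

/-- The distortion `log ‖F v‖ - d log ‖v‖`. -/
noncomputable def distortion (d : ℕ) (F : ℂ × ℂ → ℂ × ℂ) (v : ℂ × ℂ) : ℝ :=
  Real.log ‖F v‖ - d * Real.log ‖v‖

/-- The Green function `lim d⁻ⁿ log ‖Fⁿ v‖`. -/
noncomputable def green (d : ℕ) (F : ℂ × ℂ → ℂ × ℂ) (v : ℂ × ℂ) : ℝ :=
  Real.log ‖v‖ + ∑' n : ℕ, distortion d F (F^[n] v) / (d : ℝ) ^ (n + 1)

namespace IsHomLift

variable {d : ℕ} {F : ℂ × ℂ → ℂ × ℂ} {C : ℝ}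

theorem iterate_ne_zero (h : IsHomLift d F C) {v : ℂ × ℂ} (hv : v ≠ 0) (n : ℕ) : F^[n] v ≠ 0 := by
  induction n with
  | zero => exact hv
  | succ n ih =>
    rw [Function.iterate_succ_apply']
    exact h.ne_zero _ ih

theorem iterate_smul (h : IsHomLift d F C) (c : ℂ) (v : ℂ × ℂ) (n : ℕ) :
    F^[n] (c • v) = c ^ d ^ n • F^[n] v := by
  induction n with
  | zero => simp
  | succ n ih =>
    rw [Function.iterate_succ_apply', ih, h.smul, Function.iterate_succ_apply', ← pow_mul, pow_succ]

theorem nonneg (h : IsHomLift d F C) : 0 ≤ C :=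
  (abs_nonneg _).trans (h.abs_le (1, 0) (by simp))

theorem distortion_smul (h : IsHomLift d F C) {c : ℂ} (hc : c ≠ 0) {v : ℂ × ℂ} (hv : v ≠ 0) :
    distortion d F (c • v) = distortion d F v := by
  have h1 := norm_ne_zero_iff.2 (h.ne_zero v hv)
  have h2 := norm_ne_zero_iff.2 hv
  have h3 := norm_ne_zero_iff.2 hc
  rw [distortion, distortion, h.smul, norm_smul, norm_smul, norm_pow,
    Real.log_mul (pow_ne_zero _ h3) h1, Real.log_mul h3 h2, Real.log_pow]
  ring

theorem one_lt (h : IsHomLift d F C) : (1 : ℝ) < d := by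
  exact_mod_cast h.two_le

theorem norm_term_le (h : IsHomLift d F C) {v : ℂ × ℂ} (hv : v ≠ 0) (n : ℕ) :
    ‖distortion d F (F^[n] v) / (d : ℝ) ^ (n + 1)‖ ≤ C / d * (d : ℝ)⁻¹ ^ n := by
  have hd := zero_lt_one.trans h.one_lt
  rw [norm_div, Real.norm_eq_abs, Real.norm_of_nonneg (by positivity), div_le_iff₀ (by positivity)]
  refine (h.abs_le _ (h.iterate_ne_zero hv n)).trans_eq ?_
  rw [inv_pow, pow_succ]
  field_simp

theorem hasSum_bound (h : IsHomLift d F C) : HasSum (fun n : ℕ => C / d * (d : ℝ)⁻¹ ^ n)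
    (C / d * (1 - (d : ℝ)⁻¹)⁻¹) :=
  (hasSum_geometric_of_lt_one (by positivity) (inv_lt_one_of_one_lt₀ h.one_lt)).mul_left _

theorem bound_le (h : IsHomLift d F C) : C / d * (1 - (d : ℝ)⁻¹)⁻¹ ≤ C := by
  have hd : (2 : ℝ) ≤ d := by exact_mod_cast h.two_le
  have h1 : C / d * (1 - (d : ℝ)⁻¹)⁻¹ = C / (d - 1) := by
    have : (d : ℝ) - 1 ≠ 0 := by linarith
    field_simp
  rw [h1]
  exact div_le_self h.nonneg (by linarith)

theorem summable (h : IsHomLift d F C) {v : ℂ × ℂ} (hv : v ≠ 0) :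
    Summable fun n : ℕ => distortion d F (F^[n] v) / (d : ℝ) ^ (n + 1) :=
  Summable.of_norm_bounded h.hasSum_bound.summable (h.norm_term_le hv)

theorem abs_green_sub_log_le (h : IsHomLift d F C) {v : ℂ × ℂ} (hv : v ≠ 0) :
    |green d F v - Real.log ‖v‖| ≤ C := by
  rw [green, add_sub_cancel_left, ← Real.norm_eq_abs]
  exact (tsum_of_norm_bounded h.hasSum_bound (h.norm_term_le hv)).trans h.bound_le

/-- Multiplication by `d` shifts the defining series, and its first term is `log ‖F v‖ - d log ‖v‖`.
-/
theorem green_map (h : IsHomLift d F C) {v : ℂ × ℂ} (hv : v ≠ 0) :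
    green d F (F v) = d * green d F v := by
  have hd := (zero_lt_one.trans h.one_lt).ne'
  have h1 := (h.summable hv).tsum_eq_zero_add
  rw [green, green, h1, mul_add, mul_add, ← tsum_mul_left]
  have h2 : ∀ n : ℕ, (d : ℝ) * (distortion d F (F^[n + 1] v) / (d : ℝ) ^ (n + 1 + 1)) =
      distortion d F (F^[n] (F v)) / (d : ℝ) ^ (n + 1) := by
    intro n
    rw [Function.iterate_succ_apply]
    field_simp
    ring
  simp_rw [h2]
  simp only [Function.iterate_zero, id, distortion, zero_add, pow_one]
  field_simp
  ring

theorem green_iterate (h : IsHomLift d F C) {v : ℂ × ℂ} (hv : v ≠ 0) (n : ℕ) :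
    green d F (F^[n] v) = d ^ n * green d F v := by
  induction n with
  | zero => simp
  | succ n ih =>
    rw [Function.iterate_succ_apply', h.green_map (h.iterate_ne_zero hv n), ih, pow_succ]
    ring

theorem green_smul (h : IsHomLift d F C) {c : ℂ} (hc : c ≠ 0) {v : ℂ × ℂ} (hv : v ≠ 0) :
    green d F (c • v) = Real.log ‖c‖ + green d F v := by
  rw [green, green, norm_smul, Real.log_mul (norm_ne_zero_iff.2 hc) (norm_ne_zero_iff.2 hv),
    add_assoc]
  congr 2
  refine tsum_congr fun n => ?_
  rw [h.iterate_smul, h.distortion_smul (pow_ne_zero _ hc) (h.iterate_ne_zero hv n)]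

/-- The rate is free: apply `|G - log ‖·‖| ≤ C` at `Fⁿ v` and divide by `dⁿ`, using `G(Fⁿ v) = dⁿ
G(v)`. -/
theorem abs_green_sub_le (h : IsHomLift d F C) {v : ℂ × ℂ} (hv : v ≠ 0) (n : ℕ) :
    |green d F v - Real.log ‖F^[n] v‖ / (d : ℝ) ^ n| ≤ C / (d : ℝ) ^ n := by
  have hd := zero_lt_one.trans h.one_lt
  have h1 := h.abs_green_sub_log_le (h.iterate_ne_zero hv n)
  rw [h.green_iterate hv] at h1
  have h2 : green d F v - Real.log ‖F^[n] v‖ / (d : ℝ) ^ n =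
      (d ^ n * green d F v - Real.log ‖F^[n] v‖) / (d : ℝ) ^ n := by
    field_simp
  rw [h2, abs_div, abs_of_pos (pow_pos hd n)]
  gcongr

end IsHomLift

/-! ### Hölder continuity of the Green function -/

/-- The normalization of `F` to a self-map of the unit sphere. -/
noncomputable def sphereMap (F : ℂ × ℂ → ℂ × ℂ) (v : ℂ × ℂ) : ℂ × ℂ := ((‖F v‖⁻¹ : ℝ) : ℂ) • F v

namespace IsHomLift

variable {d : ℕ} {F : ℂ × ℂ → ℂ × ℂ} {C : ℝ}

theorem norm_sphereMap (h : IsHomLift d F C) {v : ℂ × ℂ} (hv : v ≠ 0) : ‖sphereMap F v‖ = 1 := by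
  rw [sphereMap, norm_smul, Complex.norm_real, norm_inv, norm_norm,
    inv_mul_cancel₀ (norm_ne_zero_iff.2 (h.ne_zero v hv))]

theorem norm_iterate_sphereMap (h : IsHomLift d F C) {v : ℂ × ℂ} (hv : ‖v‖ = 1) (n : ℕ) :
    ‖(sphereMap F)^[n] v‖ = 1 := by
  induction n with
  | zero => exact hv
  | succ n ih =>
    rw [Function.iterate_succ_apply']
    exact h.norm_sphereMap (norm_ne_zero_iff.1 (by rw [ih]; exact one_ne_zero))

theorem iterate_eq_smul_sphereMap (h : IsHomLift d F C) {v : ℂ × ℂ} (hv : ‖v‖ = 1) (n : ℕ) :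
    ∃ c : ℂ, c ≠ 0 ∧ F^[n] v = c • (sphereMap F)^[n] v := by
  induction n with
  | zero => exact ⟨1, one_ne_zero, by simp⟩
  | succ n ih =>
    obtain ⟨c, hc, hcv⟩ := ih
    set w := (sphereMap F)^[n] v with hw
    have hw0 : w ≠ 0 := norm_ne_zero_iff.1 (by rw [h.norm_iterate_sphereMap hv n]; exact one_ne_zero)
    have h1 : (‖F w‖ : ℂ) ≠ 0 := by simpa using h.ne_zero w hw0
    refine ⟨c ^ d * ‖F w‖, mul_ne_zero (pow_ne_zero _ hc) h1, ?_⟩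
    rw [Function.iterate_succ_apply', Function.iterate_succ_apply', hcv, ← hw, h.smul, sphereMap,
      smul_smul, mul_assoc, Complex.ofReal_inv, mul_inv_cancel₀ h1, mul_one]

/-- The distortion is homogeneous of degree zero, so the orbit may be renormalized to the unit
sphere at every step; there `F` is Lipschitz and bounded away from `0`. -/
theorem distortion_iterate (h : IsHomLift d F C) {v : ℂ × ℂ} (hv : ‖v‖ = 1) (n : ℕ) :
    distortion d F (F^[n] v) = Real.log ‖F ((sphereMap F)^[n] v)‖ := by
  obtain ⟨c, hc, hcv⟩ := h.iterate_eq_smul_sphereMap hv n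
  have h1 := h.norm_iterate_sphereMap hv n
  rw [hcv, h.distortion_smul hc (norm_ne_zero_iff.1 (by rw [h1]; exact one_ne_zero)), distortion,
    h1, Real.log_one, mul_zero, sub_zero]

theorem exp_neg_le_norm (h : IsHomLift d F C) {v : ℂ × ℂ} (hv : ‖v‖ = 1) :
    Real.exp (-C) ≤ ‖F v‖ := by
  have hv0 : v ≠ 0 := norm_ne_zero_iff.1 (by rw [hv]; exact one_ne_zero)
  have h1 := h.abs_le v hv0
  rw [hv, Real.log_one, mul_zero, sub_zero] at h1
  rw [← Real.le_log_iff_exp_le (norm_pos_iff.2 (h.ne_zero v hv0))]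
  exact (_root_.abs_le.1 h1).1

end IsHomLift

theorem norm_normalize_sub_le {E : Type*} [NormedAddCommGroup E] [NormedSpace ℂ E] {x y : E}
    (hx : x ≠ 0) (hy : y ≠ 0) :
    ‖((‖x‖⁻¹ : ℝ) : ℂ) • x - ((‖y‖⁻¹ : ℝ) : ℂ) • y‖ ≤ 2 * ‖x‖⁻¹ * ‖x - y‖ := by
  have hx' := norm_pos_iff.2 hx
  have hy' := norm_pos_iff.2 hy
  have h1 : ((‖x‖⁻¹ : ℝ) : ℂ) • x - ((‖y‖⁻¹ : ℝ) : ℂ) • y =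
      ((‖x‖⁻¹ : ℝ) : ℂ) • (x - y) + ((‖x‖⁻¹ - ‖y‖⁻¹ : ℝ) : ℂ) • y := by
    rw [smul_sub, Complex.ofReal_sub, sub_smul]
    abel
  have h2 : ‖((‖x‖⁻¹ - ‖y‖⁻¹ : ℝ) : ℂ) • y‖ ≤ ‖x‖⁻¹ * ‖x - y‖ := by
    rw [norm_smul, Complex.norm_real, Real.norm_eq_abs]
    have : ‖x‖⁻¹ - ‖y‖⁻¹ = ‖x‖⁻¹ * ‖y‖⁻¹ * (‖y‖ - ‖x‖) := by field_simp
    rw [this, abs_mul, abs_of_pos (by positivity), mul_right_comm, mul_assoc, mul_assoc,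
      inv_mul_cancel_left₀ hy'.ne']
    gcongr
    rw [norm_sub_rev]
    exact abs_norm_sub_norm_le y x
  rw [h1]
  refine (norm_add_le _ _).trans ?_
  rw [norm_smul, Complex.norm_real, norm_inv, norm_norm]
  linarith

theorem abs_log_sub_log_le {a b c : ℝ} (hc : 0 < c) (ha : c ≤ a) (hb : c ≤ b) :
    |Real.log a - Real.log b| ≤ c⁻¹ * |a - b| := by
  have key : ∀ a b : ℝ, c ≤ a → c ≤ b → Real.log a - Real.log b ≤ c⁻¹ * |a - b| := by
    intro a b ha hb
    have ha' := hc.trans_le ha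
    have hb' := hc.trans_le hb
    rw [← Real.log_div ha'.ne' hb'.ne']
    calc Real.log (a / b) ≤ a / b - 1 := Real.log_le_sub_one_of_pos (div_pos ha' hb')
      _ = b⁻¹ * (a - b) := by field_simp
      _ ≤ b⁻¹ * |a - b| := by gcongr; exact le_abs_self _
      _ ≤ c⁻¹ * |a - b| := by gcongr
  rw [abs_le]
  constructor
  · have := key b a hb ha
    rw [abs_sub_comm] at this
    linarith
  · exact key a b ha hb

/-- A family of homogeneous maps of `ℂ²`, uniformly bounded and Lipschitz on the unit sphere. -/
structure IsHomFamily {T : Type*} [PseudoMetricSpace T] (d : ℕ) (F : T → ℂ × ℂ → ℂ × ℂ)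
    (V : Set T) (C Λ : ℝ) : Prop where
  isHomLift : ∀ t ∈ V, IsHomLift d (F t) C
  lipschitz : ∀ t ∈ V, ∀ s ∈ V, ∀ v w, ‖v‖ = 1 → ‖w‖ = 1 →
    ‖F t v - F s w‖ ≤ Λ * (dist t s + ‖v - w‖)

namespace IsHomFamily

variable {T : Type*} [PseudoMetricSpace T] {d : ℕ} {F : T → ℂ × ℂ → ℂ × ℂ} {V : Set T} {C Λ : ℝ}

/-- The parameter distance is carried in the same quantity as the point distance, so that one
expansion factor per step controls both. -/
theorem dist_iterate_le (h : IsHomFamily d F V C Λ) (hΛ : 0 ≤ Λ) {t s : T} (ht : t ∈ V)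
    (hs : s ∈ V) {v w : ℂ × ℂ} (hv : ‖v‖ = 1) (hw : ‖w‖ = 1) (n : ℕ) :
    dist t s + ‖(sphereMap (F t))^[n] v - (sphereMap (F s))^[n] w‖ ≤
      (1 + 2 * Real.exp C * Λ) ^ n * (dist t s + ‖v - w‖) := by
  induction n with
  | zero => simp
  | succ n ih =>
    have h1 := (h.isHomLift t ht).norm_iterate_sphereMap hv n
    have h2 := (h.isHomLift s hs).norm_iterate_sphereMap hw n
    rw [Function.iterate_succ_apply', Function.iterate_succ_apply']
    set v' := (sphereMap (F t))^[n] v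
    set w' := (sphereMap (F s))^[n] w
    have hv0 : v' ≠ 0 := norm_ne_zero_iff.1 (by rw [h1]; exact one_ne_zero)
    have hw0 : w' ≠ 0 := norm_ne_zero_iff.1 (by rw [h2]; exact one_ne_zero)
    have h3 := norm_normalize_sub_le ((h.isHomLift t ht).ne_zero v' hv0)
      ((h.isHomLift s hs).ne_zero w' hw0)
    have h4 : ‖F t v'‖⁻¹ ≤ Real.exp C := by
      rw [← _root_.inv_inv (Real.exp C), ← Real.exp_neg]
      exact inv_anti₀ (Real.exp_pos _) ((h.isHomLift t ht).exp_neg_le_norm h1)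
    have h5 := h.lipschitz t ht s hs v' w' h1 h2
    calc dist t s + ‖sphereMap (F t) v' - sphereMap (F s) w'‖
        ≤ (dist t s + ‖v' - w'‖) + 2 * Real.exp C * (Λ * (dist t s + ‖v' - w'‖)) := by
          refine add_le_add (le_add_of_nonneg_right (norm_nonneg _)) (h3.trans ?_)
          gcongr
      _ = (1 + 2 * Real.exp C * Λ) * (dist t s + ‖v' - w'‖) := by ring
      _ ≤ (1 + 2 * Real.exp C * Λ) * ((1 + 2 * Real.exp C * Λ) ^ n *
            (dist t s + ‖v - w‖)) := by gcongr
      _ = _ := by ring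

theorem abs_distortion_sub_le (h : IsHomFamily d F V C Λ) (hΛ : 0 ≤ Λ) {t s : T} (ht : t ∈ V)
    (hs : s ∈ V) {v w : ℂ × ℂ} (hv : ‖v‖ = 1) (hw : ‖w‖ = 1) (n : ℕ) :
    |distortion d (F t) ((F t)^[n] v) - distortion d (F s) ((F s)^[n] w)| ≤
      Real.exp C * Λ * ((1 + 2 * Real.exp C * Λ) ^ n * (dist t s + ‖v - w‖)) := by
  have Ht := h.isHomLift t ht
  have Hs := h.isHomLift s hs
  have h1 := Ht.norm_iterate_sphereMap hv n
  have h2 := Hs.norm_iterate_sphereMap hw n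
  rw [Ht.distortion_iterate hv, Hs.distortion_iterate hw]
  refine (abs_log_sub_log_le (Real.exp_pos (-C)) (Ht.exp_neg_le_norm h1)
    (Hs.exp_neg_le_norm h2)).trans ?_
  rw [Real.exp_neg, _root_.inv_inv, mul_assoc]
  gcongr
  refine (abs_norm_sub_norm_le _ _).trans ((h.lipschitz t ht s hs _ _ h1 h2).trans ?_)
  gcongr
  exact h.dist_iterate_le hΛ ht hs hv hw n

/-- With `M` the expansion factor and `δ` the initial distance, the difference of the `n`-th
distortions is at most `2C` and at most `B Mⁿ δ`. Interpolating, it is at most `(2C)^(1-α) (B Mⁿ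
δ)^α`, and after division by `d^(n+1)` the series converges as soon as `M^α < d`. -/
theorem exists_holder (h : IsHomFamily d F V C Λ) (hΛ : 0 ≤ Λ) (hd : 2 ≤ d) :
    ∃ α A : ℝ, 0 < α ∧ α ≤ 1 ∧ 0 ≤ A ∧ ∀ t ∈ V, ∀ s ∈ V, ∀ v w, ‖v‖ = 1 → ‖w‖ = 1 →
      |green d (F t) v - green d (F s) w| ≤ A * (dist t s + ‖v - w‖) ^ α := by
  rcases V.eq_empty_or_nonempty with rfl | ⟨t₀, ht₀⟩
  · exact ⟨1, 0, one_pos, le_rfl, le_rfl, by simp⟩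
  have hC := (h.isHomLift t₀ ht₀).nonneg
  have hd1 : (1 : ℝ) < d := (h.isHomLift t₀ ht₀).one_lt
  set M := 1 + 2 * Real.exp C * Λ with hM
  have hM1 : 1 ≤ M := by
    have : 0 ≤ 2 * Real.exp C * Λ := by positivity
    linarith
  -- From `M < d^k` the exponent `α = 1 / (k + 1)` satisfies `M^α < d`; the shift by one keeps `α ≤
  -- 1` even for `k = 0`.
  obtain ⟨k, hk⟩ := pow_unbounded_of_one_lt M hd1
  set α : ℝ := ((k : ℝ) + 1)⁻¹ with hα
  have hα0 : 0 < α := by positivity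
  have hα1 : α ≤ 1 := inv_le_one_of_one_le₀ (by linarith [k.cast_nonneg (α := ℝ)])
  have hMd : M ^ α < d := by
    have h1 : M < (d : ℝ) ^ ((k : ℝ) + 1) := by
      rw [← Nat.cast_add_one, Real.rpow_natCast]
      exact hk.trans_le (pow_le_pow_right₀ hd1.le (Nat.le_succ k))
    have h2 := Real.rpow_lt_rpow (by linarith) h1 hα0
    rwa [← Real.rpow_mul (by linarith), hα, mul_inv_cancel₀ (by positivity), Real.rpow_one] at h2
  set B := Real.exp C * Λ with hB
  have hB0 : 0 ≤ B := by positivity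
  set q : ℝ := M ^ α / d with hq
  have hq1 : q < 1 := by
    rw [hq, div_lt_one (by linarith)]
    exact hMd
  have hq0 : 0 ≤ q := by positivity
  set A := (2 * C) ^ (1 - α) * B ^ α with hA
  have hA0 : 0 ≤ A := by positivity
  refine ⟨α, A * (1 - q)⁻¹, hα0, hα1, mul_nonneg hA0 (inv_nonneg.2 (by linarith)), ?_⟩
  intro t ht s hs v w hv hw
  have Ht := h.isHomLift t ht
  have Hs := h.isHomLift s hs
  have hv0 : v ≠ 0 := norm_ne_zero_iff.1 (by rw [hv]; exact one_ne_zero)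
  have hw0 : w ≠ 0 := norm_ne_zero_iff.1 (by rw [hw]; exact one_ne_zero)
  set δ := dist t s + ‖v - w‖ with hδ
  have hδ0 : 0 ≤ δ := by positivity
  rw [green, green, hv, hw, Real.log_one, zero_add, zero_add,
    ← (Ht.summable hv0).tsum_sub (Hs.summable hw0), ← Real.norm_eq_abs]
  have hsum : HasSum (fun n : ℕ => A * δ ^ α * q ^ n) (A * δ ^ α * (1 - q)⁻¹) :=
    (hasSum_geometric_of_lt_one hq0 hq1).mul_left _
  refine (tsum_of_norm_bounded hsum fun n => ?_).trans_eq (by ring)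
  rw [← sub_div, norm_div, Real.norm_eq_abs, Real.norm_of_nonneg (by positivity)]
  set x := |distortion d (F t) ((F t)^[n] v) - distortion d (F s) ((F s)^[n] w)| with hx
  have hx0 : 0 ≤ x := abs_nonneg _
  have hx1 : x ≤ 2 * C := by
    have h1 := Ht.abs_le _ (Ht.iterate_ne_zero hv0 n)
    have h2 := Hs.abs_le _ (Hs.iterate_ne_zero hw0 n)
    refine (abs_sub _ _).trans ?_
    rw [two_mul]
    exact add_le_add h1 h2
  have hx2 : x ≤ B * (M ^ n * δ) := h.abs_distortion_sub_le hΛ ht hs hv hw n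
  have hx3 : x ≤ A * (M ^ α) ^ n * δ ^ α := by
    calc x = x ^ (1 - α) * x ^ α := by
          rcases hx0.eq_or_lt with h0 | h0
          · rw [← h0, Real.zero_rpow hα0.ne', mul_zero]
          · rw [← Real.rpow_add h0, sub_add_cancel, Real.rpow_one]
      _ ≤ (2 * C) ^ (1 - α) * (B * (M ^ n * δ)) ^ α := by
          gcongr
      _ = A * (M ^ α) ^ n * δ ^ α := by
          rw [Real.mul_rpow hB0 (by positivity), Real.mul_rpow (by positivity) hδ0,
            ← Real.rpow_natCast, ← Real.rpow_natCast, ← Real.rpow_mul (by linarith),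
            ← Real.rpow_mul (by linarith), mul_comm α]
          ring
  rw [div_le_iff₀ (by positivity)]
  refine hx3.trans ?_
  rw [hq, div_pow, pow_succ]
  have hdn : (0 : ℝ) < d ^ n := by positivity
  calc A * (M ^ α) ^ n * δ ^ α ≤ A * (M ^ α) ^ n * δ ^ α * d :=
        le_mul_of_one_le_right (by positivity) hd1.le
    _ = A * δ ^ α * ((M ^ α) ^ n / d ^ n) * (d ^ n * d) := by
        field_simp

end IsHomFamily

/-! ### Families of homogeneous lifts -/

theorem norm_pow_sub_pow_le {a b : ℂ} (ha : ‖a‖ ≤ 1) (hb : ‖b‖ ≤ 1) (n : ℕ) :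
    ‖a ^ n - b ^ n‖ ≤ n * ‖a - b‖ := by
  induction n with
  | zero => simp
  | succ n ih =>
    have h1 : a ^ (n + 1) - b ^ (n + 1) = a ^ n * (a - b) + (a ^ n - b ^ n) * b := by ring
    rw [h1]
    refine (norm_add_le _ _).trans ?_
    rw [norm_mul, norm_mul, norm_pow]
    have h2 : ‖a‖ ^ n * ‖a - b‖ ≤ 1 * ‖a - b‖ := by
      gcongr
      exact pow_le_one₀ (norm_nonneg _) ha
    have h3 : ‖a ^ n - b ^ n‖ * ‖b‖ ≤ n * ‖a - b‖ * 1 := by gcongr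
    push_cast
    linarith

theorem norm_homEval_sub_le (m : ℕ) (p q : ℂ[X]) {M ε : ℝ}
    (hq : ∀ i ≤ m, ‖q.coeff i‖ ≤ M) (hpq : ∀ i ≤ m, ‖p.coeff i - q.coeff i‖ ≤ ε)
    {v w : ℂ × ℂ} (hv : ‖v‖ ≤ 1) (hw : ‖w‖ ≤ 1) :
    ‖homEval m p v - homEval m q w‖ ≤ (m + 1) * (ε + M * (m * ‖v - w‖)) := by
  have hM : 0 ≤ M := (norm_nonneg _).trans (hq 0 (Nat.zero_le _))
  have hε : 0 ≤ ε := (norm_nonneg _).trans (hpq 0 (Nat.zero_le _))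
  rw [homEval, homEval, ← Finset.sum_sub_distrib]
  have key : ∀ i ∈ Finset.range (m + 1), ‖p.coeff i * v.1 ^ i * v.2 ^ (m - i) -
      q.coeff i * w.1 ^ i * w.2 ^ (m - i)‖ ≤ ε + M * (m * ‖v - w‖) := by
    intro i hi
    have hi' : i ≤ m := Nat.lt_succ_iff.1 (Finset.mem_range.1 hi)
    have hv1 := (norm_fst_le v).trans hv
    have hv2 := (norm_snd_le v).trans hv
    have hw1 := (norm_fst_le w).trans hw
    have hw2 := (norm_snd_le w).trans hw
    have h1 : p.coeff i * v.1 ^ i * v.2 ^ (m - i) - q.coeff i * w.1 ^ i * w.2 ^ (m - i) =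
        (p.coeff i - q.coeff i) * (v.1 ^ i * v.2 ^ (m - i)) +
        q.coeff i * (v.1 ^ i * (v.2 ^ (m - i) - w.2 ^ (m - i)) +
          (v.1 ^ i - w.1 ^ i) * w.2 ^ (m - i)) := by ring
    rw [h1]
    refine (norm_add_le _ _).trans (add_le_add ?_ ?_)
    · rw [norm_mul, norm_mul, norm_pow, norm_pow]
      calc ‖p.coeff i - q.coeff i‖ * (‖v.1‖ ^ i * ‖v.2‖ ^ (m - i)) ≤ ε * (1 * 1) := by
            gcongr
            · exact hpq i hi'
            · exact pow_le_one₀ (norm_nonneg _) hv1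
            · exact pow_le_one₀ (norm_nonneg _) hv2
        _ = ε := by ring
    · rw [norm_mul]
      refine mul_le_mul (hq i hi') ?_ (norm_nonneg _) hM
      refine (norm_add_le _ _).trans ?_
      rw [norm_mul, norm_mul, norm_pow, norm_pow]
      have h2 : ‖v.1‖ ^ i * ‖v.2 ^ (m - i) - w.2 ^ (m - i)‖ ≤ 1 * ((m - i : ℕ) * ‖v - w‖) := by
        gcongr
        · exact pow_le_one₀ (norm_nonneg _) hv1
        · refine (norm_pow_sub_pow_le hv2 hw2 _).trans ?_
          gcongr
          exact norm_snd_le (v - w)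
      have h3 : ‖v.1 ^ i - w.1 ^ i‖ * ‖w.2‖ ^ (m - i) ≤ (i * ‖v - w‖) * 1 := by
        gcongr
        · refine (norm_pow_sub_pow_le hv1 hw1 _).trans ?_
          gcongr
          exact norm_fst_le (v - w)
        · exact pow_le_one₀ (norm_nonneg _) hw2
      have h4 : ((m - i : ℕ) : ℝ) + i = m := by exact_mod_cast Nat.sub_add_cancel hi'
      calc _ ≤ 1 * ((m - i : ℕ) * ‖v - w‖) + (i * ‖v - w‖) * 1 := add_le_add h2 h3
        _ = (((m - i : ℕ) : ℝ) + i) * ‖v - w‖ := by ring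
        _ = m * ‖v - w‖ := by rw [h4]
  refine (norm_sum_le_of_le _ key).trans_eq ?_
  simp
  ring

theorem holderOnWith_of_dist_le {X Y : Type*} [PseudoMetricSpace X] [PseudoMetricSpace Y]
    {f : X → Y} {S : Set X} {C α : ℝ} (hC : 0 ≤ C) (hα : 0 ≤ α)
    (h : ∀ x ∈ S, ∀ y ∈ S, dist (f x) (f y) ≤ C * dist x y ^ α) :
    HolderOnWith C.toNNReal α.toNNReal f S := by
  intro x hx y hy
  rw [edist_dist, edist_dist, Real.coe_toNNReal _ hα,
    ENNReal.ofReal_rpow_of_nonneg dist_nonneg hα, ← ENNReal.ofReal.eq_1,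
    ← ENNReal.ofReal_mul hC]
  exact ENNReal.ofReal_le_ofReal (h x hx y hy)

/-- A family of reduced fractions of degree `d` with Lipschitz coefficients. -/
structure IsLipschitzFamily {T : Type*} [PseudoMetricSpace T] (d : ℕ) (P Q : T → ℂ[X])
    (V : Set T) (Λ : ℝ) : Prop where
  nonneg : 0 ≤ Λ
  isReduced : ∀ t ∈ V, IsReduced d (P t) (Q t)
  norm_left : ∀ t ∈ V, ∀ i ≤ d, ‖(P t).coeff i‖ ≤ Λ
  norm_right : ∀ t ∈ V, ∀ i ≤ d, ‖(Q t).coeff i‖ ≤ Λ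
  left : ∀ t ∈ V, ∀ s ∈ V, ∀ i ≤ d, ‖(P t).coeff i - (P s).coeff i‖ ≤ Λ * dist t s
  right : ∀ t ∈ V, ∀ s ∈ V, ∀ i ≤ d, ‖(Q t).coeff i - (Q s).coeff i‖ ≤ Λ * dist t s

namespace IsLipschitzFamily

variable {T : Type*} [PseudoMetricSpace T] {d : ℕ} {P Q : T → ℂ[X]} {V : Set T} {Λ : ℝ}

theorem norm_ratLift_sub_le (h : IsLipschitzFamily d P Q V Λ) {t s : T} (ht : t ∈ V) (hs : s ∈ V)
    {v w : ℂ × ℂ} (hv : ‖v‖ = 1) (hw : ‖w‖ = 1) :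
    ‖ratLift d (P t) (Q t) v - ratLift d (P s) (Q s) w‖ ≤
      ((d + 1) * (Λ * (d + 1))) * (dist t s + ‖v - w‖) := by
  have hΛ := h.nonneg
  have key : ((d : ℝ) + 1) * (Λ * dist t s + Λ * (d * ‖v - w‖)) ≤
      ((d + 1) * (Λ * (d + 1))) * (dist t s + ‖v - w‖) := by
    rw [mul_assoc, mul_assoc, ← mul_add]
    gcongr
    rw [add_mul, one_mul, mul_add]
    have h1 : 0 ≤ (d : ℝ) * dist t s := by positivity
    have h2 := norm_nonneg (v - w)
    linarith
  refine max_le ?_ ?_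
  · exact (norm_homEval_sub_le d _ _ (h.norm_left s hs) (h.left t ht s hs) hv.le hw.le).trans key
  · exact (norm_homEval_sub_le d _ _ (h.norm_right s hs) (h.right t ht s hs) hv.le hw.le).trans key

/-- The lift is continuous and non-zero on the compact set `V × S`, so `log ‖F‖` is bounded there;
homogeneity extends the bound to all non-zero vectors. -/
theorem exists_isHomFamily (h : IsLipschitzFamily d P Q V Λ) (hV : IsCompact V) (hd : 2 ≤ d) :
    ∃ C Λ', 0 ≤ Λ' ∧ IsHomFamily d (fun t => ratLift d (P t) (Q t)) V C Λ' := by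
  have hΛ := h.nonneg
  set Λ' : ℝ := (d + 1) * (Λ * (d + 1)) with hΛ'
  have hΛ'0 : 0 ≤ Λ' := by positivity
  set S : Set (ℂ × ℂ) := Metric.sphere 0 1 with hS
  have hK : IsCompact (V ×ˢ S) := hV.prod (isCompact_sphere 0 1)
  have hcont : ContinuousOn (fun x : T × (ℂ × ℂ) => ratLift d (P x.1) (Q x.1) x.2) (V ×ˢ S) := by
    refine LipschitzOnWith.continuousOn (K := Real.toNNReal (2 * Λ'))
      (LipschitzOnWith.of_dist_le_mul fun x hx y hy => ?_)
    rw [Real.coe_toNNReal _ (by positivity), dist_eq_norm]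
    refine (h.norm_ratLift_sub_le hx.1 hy.1 (mem_sphere_zero_iff_norm.1 hx.2)
      (mem_sphere_zero_iff_norm.1 hy.2)).trans ?_
    have h1 : dist x.1 y.1 ≤ dist x y := le_max_left _ _
    have h2 : ‖x.2 - y.2‖ ≤ dist x y := by
      rw [← dist_eq_norm]
      exact le_max_right _ _
    calc Λ' * (dist x.1 y.1 + ‖x.2 - y.2‖) ≤ Λ' * (dist x y + dist x y) := by gcongr
      _ = 2 * Λ' * dist x y := by ring
  have hne : ∀ x ∈ V ×ˢ S, ratLift d (P x.1) (Q x.1) x.2 ≠ 0 := fun x hx =>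
    (h.isReduced x.1 hx.1).ratLift_ne_zero (by omega)
      (norm_ne_zero_iff.1 (by rw [mem_sphere_zero_iff_norm.1 hx.2]; exact one_ne_zero))
  have hlog : ContinuousOn (fun x : T × (ℂ × ℂ) => Real.log ‖ratLift d (P x.1) (Q x.1) x.2‖)
      (V ×ˢ S) := hcont.norm.log fun x hx => norm_ne_zero_iff.2 (hne x hx)
  obtain ⟨C, hC⟩ := (hK.image_of_continuousOn hlog).isBounded.exists_norm_le
  refine ⟨C, Λ', hΛ'0, ⟨fun t ht => ⟨hd, ratLift_smul d _ _,
    fun v hv => (h.isReduced t ht).ratLift_ne_zero (by omega) hv, fun v hv => ?_⟩,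
    fun t ht s hs v w hv hw => h.norm_ratLift_sub_le ht hs hv hw⟩⟩
  have hv0 : (‖v‖ : ℂ) ≠ 0 := by simpa using hv
  have hv1 : ‖((‖v‖ : ℂ)⁻¹) • v‖ = 1 := by
    rw [norm_smul, norm_inv, Complex.norm_real, norm_norm,
      inv_mul_cancel₀ (norm_ne_zero_iff.2 hv)]
  have h1 := hC _ ⟨(t, ((‖v‖ : ℂ)⁻¹) • v), ⟨ht, mem_sphere_zero_iff_norm.2 hv1⟩, rfl⟩
  have h2 : Real.log ‖ratLift d (P t) (Q t) v‖ - d * Real.log ‖v‖ =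
      Real.log ‖ratLift d (P t) (Q t) (((‖v‖ : ℂ)⁻¹) • v)‖ := by
    have h3 := norm_ne_zero_iff.2 ((h.isReduced t ht).ratLift_ne_zero (by omega) hv)
    rw [ratLift_smul, norm_smul, norm_pow, norm_inv, Complex.norm_real, norm_norm, inv_pow,
      Real.log_mul (inv_ne_zero (pow_ne_zero _ (norm_ne_zero_iff.2 hv))) h3, Real.log_inv,
      Real.log_pow]
    ring
  rw [h2]
  exact h1

end IsLipschitzFamily

/-- A single map is a constant family over a point, so the statements about families also serve one
map. -/
theorem IsReduced.isLipschitzFamily {d : ℕ} {P Q : ℂ[X]} (h : IsReduced d P Q) :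
    ∃ Λ, IsLipschitzFamily d (fun _ : Unit => P) (fun _ => Q) Set.univ Λ := by
  set Λ : ℝ := ∑ i ∈ Finset.range (d + 1), (‖P.coeff i‖ + ‖Q.coeff i‖) with hΛ
  have key : ∀ i ≤ d, ‖P.coeff i‖ + ‖Q.coeff i‖ ≤ Λ := fun i hi =>
    Finset.single_le_sum (f := fun i => ‖P.coeff i‖ + ‖Q.coeff i‖) (fun i _ => by positivity)
      (Finset.mem_range.2 (Nat.lt_succ_of_le hi))
  exact ⟨Λ, by positivity, fun _ _ => h,
    fun _ _ i hi => (le_add_of_nonneg_right (norm_nonneg _)).trans (key i hi),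
    fun _ _ i hi => (le_add_of_nonneg_left (norm_nonneg _)).trans (key i hi),
    fun _ _ _ _ i hi => by simp, fun _ _ _ _ i hi => by simp⟩

theorem IsReduced.exists_isHomLift {d : ℕ} {P Q : ℂ[X]} (h : IsReduced d P Q) (hd : 2 ≤ d) :
    ∃ C, IsHomLift d (ratLift d P Q) C := by
  obtain ⟨Λ, hΛ⟩ := h.isLipschitzFamily
  obtain ⟨C, _, _, hF⟩ := hΛ.exists_isHomFamily isCompact_univ hd
  exact ⟨C, hF.isHomLift () trivial⟩

/-- On the unit sphere this is the Hölder estimate; elsewhere `G(v) = log ‖v‖ + G(v / ‖v‖)`. -/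
theorem IsReduced.continuousOn_green {d : ℕ} {P Q : ℂ[X]} (h : IsReduced d P Q) (hd : 2 ≤ d) :
    ContinuousOn (green d (ratLift d P Q)) {0}ᶜ := by
  obtain ⟨Λ, hΛ⟩ := h.isLipschitzFamily
  obtain ⟨C, Λ', hΛ', hF⟩ := hΛ.exists_isHomFamily isCompact_univ hd
  have H := hF.isHomLift () trivial
  obtain ⟨α, A, hα, hα1, hA, hG⟩ := hF.exists_holder hΛ' hd
  have h1 : ContinuousOn (green d (ratLift d P Q)) (Metric.sphere 0 1) := by
    refine HolderOnWith.continuousOn (holderOnWith_of_dist_le (C := A) (α := α) hA hα.le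
      fun v hv w hw => ?_) (Real.toNNReal_pos.2 hα)
    have := hG () trivial () trivial v w (mem_sphere_zero_iff_norm.1 hv)
      (mem_sphere_zero_iff_norm.1 hw)
    rwa [dist_self, zero_add, ← dist_eq_norm v w] at this
  have h2 : ContinuousOn (fun v : ℂ × ℂ => ((‖v‖⁻¹ : ℝ) : ℂ) • v) {0}ᶜ := by
    refine ContinuousOn.smul (Complex.continuous_ofReal.comp_continuousOn
      (continuous_norm.continuousOn.inv₀ fun v hv => norm_ne_zero_iff.2 hv)) continuousOn_id
  have h3 : Set.MapsTo (fun v : ℂ × ℂ => ((‖v‖⁻¹ : ℝ) : ℂ) • v) {0}ᶜ (Metric.sphere 0 1) := by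
    intro v hv
    rw [mem_sphere_zero_iff_norm, norm_smul, Complex.norm_real, norm_inv, norm_norm,
      inv_mul_cancel₀ (norm_ne_zero_iff.2 hv)]
  have h4 : ContinuousOn (fun v : ℂ × ℂ => Real.log ‖v‖) {0}ᶜ :=
    continuous_norm.continuousOn.log fun v hv => norm_ne_zero_iff.2 hv
  refine (h4.add (h1.comp h2 h3)).congr fun v hv => ?_
  have hv0 : ((‖v‖⁻¹ : ℝ) : ℂ) ≠ 0 := by
    simpa using hv
  change _ = Real.log ‖v‖ + green d (ratLift d P Q) (((‖v‖⁻¹ : ℝ) : ℂ) • v)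
  rw [H.green_smul hv0 hv, Complex.norm_real, norm_inv, norm_norm, Real.log_inv]
  ring

/-! ### The potentials of the pullbacks of the Fubini-Study form -/

theorem integrable_mul_of_hasCompactSupport_radial {τ : ℝ → ℝ} (hτ : Continuous τ) {R : ℝ}
    (hτR : ∀ t, R ≤ t → τ t = 0) {ρ : ℂ → ℝ} (hρ : Continuous ρ) (b : ℂ) :
    Integrable fun x : ℂ => τ ‖x - b‖ * ρ x := by
  refine Continuous.integrable_of_hasCompactSupport (by fun_prop) ?_
  refine HasCompactSupport.intro (isCompact_closedBall b R) fun x hx => ?_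
  rw [Metric.mem_closedBall, dist_eq_norm, not_le] at hx
  rw [hτR _ hx.le, zero_mul]

/-- The pullback of the Fubini-Study form by `p / q`, as a measure on the plane. -/
noncomputable def curveMeasure (p q : ℂ → ℂ) : Measure ℂ :=
  volume.withDensity fun z => ENNReal.ofReal (curveDensity p q z / Real.pi)

theorem integral_curveMeasure {p q : ℂ → ℂ} (hp : Differentiable ℂ p) (hq : Differentiable ℂ q)
    (h0 : ∀ z, p z ≠ 0 ∨ q z ≠ 0) (φ : ℂ → ℝ) :
    ∫ x, φ x ∂curveMeasure p q = ∫ x, φ x * (curveDensity p q x / Real.pi) := by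
  have hc := (continuous_curveDensity hp hq h0).div_const Real.pi
  rw [curveMeasure, integral_withDensity_eq_integral_toReal_smul
    hc.measurable.ennreal_ofReal (Eventually.of_forall fun _ => ENNReal.ofReal_lt_top)]
  refine integral_congr_ae (Eventually.of_forall fun x => ?_)
  have : 0 ≤ curveDensity p q x / Real.pi :=
    div_nonneg (div_nonneg (sq_nonneg _) (sq_nonneg _)) Real.pi_pos.le
  simp only [ENNReal.toReal_ofReal this, smul_eq_mul, mul_comm]

theorem integrable_logTent_curveMeasure {p q : ℂ → ℂ} (hp : Differentiable ℂ p)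
    (hq : Differentiable ℂ q) (h0 : ∀ z, p z ≠ 0 ∨ q z ≠ 0) (b : ℂ) {r R : ℝ} (hr : 0 < r)
    (hrR : r ≤ R) : Integrable (fun x => logTent r R ‖x - b‖) (curveMeasure p q) := by
  have hc := (continuous_curveDensity hp hq h0).div_const Real.pi
  rw [curveMeasure, integrable_withDensity_iff hc.measurable.ennreal_ofReal
    (Eventually.of_forall fun _ => ENNReal.ofReal_lt_top)]
  refine (integrable_mul_of_hasCompactSupport_radial (continuous_logTent hr (hr.trans_le hrR))
    (fun t ht => logTent_of_ge hrR ht) hc b).congr (Eventually.of_forall fun x => ?_)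
  have : 0 ≤ curveDensity p q x / Real.pi :=
    div_nonneg (div_nonneg (sq_nonneg _) (sq_nonneg _)) Real.pi_pos.le
  simp only [ENNReal.toReal_ofReal this]

theorem continuous_homEval (m : ℕ) (p : ℂ[X]) : Continuous (homEval m p) := by
  unfold homEval
  fun_prop

/-- The coordinate `1 / z` exhibits a continuous extension to infinity, whence the constant `L` of
the potential. -/
theorem curveLogNorm_sub_log {D : ℕ} {p q : ℂ[X]} (hp : p.natDegree ≤ D) (hq : q.natDegree ≤ D)
    (h0 : ∀ z, p.eval z ≠ 0 ∨ q.eval z ≠ 0) {z : ℂ} (hz : z ≠ 0) :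
    curveLogNorm (fun z => p.eval z) (fun z => q.eval z) z - D * Real.log ‖z‖ =
      1 / 2 * Real.log (‖homEval D p (1, z⁻¹)‖ ^ 2 + ‖homEval D q (1, z⁻¹)‖ ^ 2) := by
  have h1 : ∀ p : ℂ[X], p.natDegree ≤ D → p.eval z = z ^ D * homEval D p (1, z⁻¹) := by
    intro p hp
    rw [← homEval_smul, ← homEval_one_right hp]
    congr 1
    ext <;> simp [hz]
  have hpos : 0 < ‖homEval D p (1, z⁻¹)‖ ^ 2 + ‖homEval D q (1, z⁻¹)‖ ^ 2 := by
    rcases h0 z with h | h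
    · rw [h1 p hp] at h
      have := norm_pos_iff.2 (right_ne_zero_of_mul h)
      positivity
    · rw [h1 q hq] at h
      have := norm_pos_iff.2 (right_ne_zero_of_mul h)
      positivity
  have hz' := norm_pos_iff.2 hz
  rw [curveLogNorm, curveNormSq, h1 p hp, h1 q hq, norm_mul, norm_mul, norm_pow, mul_pow, mul_pow,
    ← mul_add, Real.log_mul (by positivity) hpos.ne', Real.log_pow, Real.log_pow]
  push_cast
  ring

/-- This is the Green-Jensen formula divided by `D`. The growth is exactly `D log |z|` because the
pair of forms does not vanish at `(1, 0)`. -/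
theorem isPotential_curveMeasure {D : ℕ} (hD : 0 < D) {p q : ℂ[X]} (hp : p.natDegree ≤ D)
    (hq : q.natDegree ≤ D) (h0 : ∀ z, p.eval z ≠ 0 ∨ q.eval z ≠ 0)
    (hinf : p.coeff D ≠ 0 ∨ q.coeff D ≠ 0) :
    IsPotential (ENNReal.ofReal (D : ℝ)⁻¹ • curveMeasure (fun z => p.eval z) (fun z => q.eval z))
      (fun z => (D : ℝ)⁻¹ * curveLogNorm (fun z => p.eval z) (fun z => q.eval z) z)
      ((D : ℝ)⁻¹ * (1 / 2 * Real.log (‖p.coeff D‖ ^ 2 + ‖q.coeff D‖ ^ 2))) := by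
  have hD' : (0 : ℝ) < D := Nat.cast_pos.2 hD
  have dp : Differentiable ℂ fun z => p.eval z := p.differentiable
  have dq : Differentiable ℂ fun z => q.eval z := q.differentiable
  have hc := continuous_curveLogNorm dp dq h0
  refine ⟨continuous_const.mul hc, ?_, fun b r R hr hrR => ?_, fun b r R hr hrR => ?_⟩
  · have h1 : Tendsto (fun z : ℂ => ((1 : ℂ), z⁻¹)) (Bornology.cobounded ℂ) (𝓝 (1, 0)) :=
      tendsto_const_nhds.prodMk_nhds tendsto_inv₀_cobounded
    have h2 : ∀ p : ℂ[X], Tendsto (fun z : ℂ => ‖homEval D p (1, z⁻¹)‖ ^ 2)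
        (Bornology.cobounded ℂ) (𝓝 (‖p.coeff D‖ ^ 2)) := by
      intro p
      have h3 := ((continuous_homEval D p).tendsto (1, 0)).comp h1
      rw [homEval_zero_right _ _ rfl, one_pow, mul_one] at h3
      exact h3.norm.pow 2
    have hpos : ‖p.coeff D‖ ^ 2 + ‖q.coeff D‖ ^ 2 ≠ 0 := by
      rcases hinf with h | h
      · have := norm_pos_iff.2 h
        positivity
      · have := norm_pos_iff.2 h
        positivity
    have h4 := ((((h2 p).add (h2 q)).log hpos).const_mul (1 / 2)).const_mul ((D : ℝ)⁻¹)
    refine h4.congr' ?_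
    filter_upwards [Bornology.eventually_ne_cobounded (0 : ℂ)] with z hz
    rw [← curveLogNorm_sub_log hp hq h0 hz]
    field_simp
  · exact (integrable_logTent_curveMeasure dp dq h0 b hr hrR).smul_measure ENNReal.ofReal_ne_top
  · rw [integral_smul_measure, integral_curveMeasure dp dq h0,
      integral_logTent_mul_curveDensity dp dq h0 b hr hrR,
      ENNReal.toReal_ofReal (inv_nonneg.2 hD'.le), smul_sub]
    rw [← Real.circleAverage_fun_smul, ← Real.circleAverage_fun_smul]
    simp only [smul_eq_mul]

/-- The potential of the Fubini-Study measure. -/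
theorem hasLogPotential_fubiniStudy :
    HasLogPotential (curveMeasure (fun z => z) (fun _ => 1))
      (fun z => 1 / 2 * Real.log (1 + ‖z‖ ^ 2)) := by
  -- The form `ω` is its own pullback by `z / 1`; the constant at infinity is `½ log 1 = 0`.
  have h := isPotential_curveMeasure (D := 1) one_pos (p := X) (q := 1) (by simp) (by simp)
    (fun z => by simp) (by simp)
  have h1 := h.hasLogPotential
  simpa [curveLogNorm, curveNormSq, add_comm, coeff_one] using h1

/-! ### Convergence of the potentials of the iterated pullbacks -/

section Iterates

variable {d : ℕ} {P Q : ℂ[X]}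

theorem eval_iterPoly (d : ℕ) (P Q : ℂ[X]) (n : ℕ) (z : ℂ) :
    ((iterPoly d P Q n).1.eval z, (iterPoly d P Q n).2.eval z) = (ratLift d P Q)^[n] (z, 1) := by
  have h := natDegree_iterPoly d P Q n
  rw [← homEval_iterPoly, homEval_one_right h.1, homEval_one_right h.2]

theorem ne_zero_or_ne_zero_of_ne {v : ℂ × ℂ} (hv : v ≠ 0) : v.1 ≠ 0 ∨ v.2 ≠ 0 := by
  by_contra! h
  exact hv (Prod.ext h.1 h.2)

theorem IsReduced.iterate_ratLift_ne_zero (h : IsReduced d P Q) (hd : 0 < d) {v : ℂ × ℂ}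
    (hv : v ≠ 0) (n : ℕ) : (ratLift d P Q)^[n] v ≠ 0 := by
  induction n with
  | zero => exact hv
  | succ n ih =>
    rw [Function.iterate_succ_apply']
    exact h.ratLift_ne_zero hd ih

theorem IsReduced.eval_iterPoly_ne_zero (h : IsReduced d P Q) (hd : 0 < d) (n : ℕ) (z : ℂ) :
    (iterPoly d P Q n).1.eval z ≠ 0 ∨ (iterPoly d P Q n).2.eval z ≠ 0 := by
  have h1 := h.iterate_ratLift_ne_zero hd (v := (z, 1)) (by simp) n
  rw [← eval_iterPoly] at h1
  exact ne_zero_or_ne_zero_of_ne h1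

theorem IsReduced.coeff_iterPoly_ne_zero (h : IsReduced d P Q) (hd : 0 < d) (n : ℕ) :
    (iterPoly d P Q n).1.coeff (d ^ n) ≠ 0 ∨ (iterPoly d P Q n).2.coeff (d ^ n) ≠ 0 := by
  have h1 := h.iterate_ratLift_ne_zero hd (v := (1, 0)) (by simp) n
  rw [← homEval_iterPoly, homEval_zero_right _ _ rfl, homEval_zero_right _ _ rfl] at h1
  simpa using ne_zero_or_ne_zero_of_ne h1

/-- The potential of `d⁻ⁿ (fⁿ)^* ω`. -/
noncomputable def iterPotential (d : ℕ) (P Q : ℂ[X]) (n : ℕ) (z : ℂ) : ℝ :=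
  ((d : ℝ) ^ n)⁻¹ * curveLogNorm (fun z => (iterPoly d P Q n).1.eval z)
    (fun z => (iterPoly d P Q n).2.eval z) z

/-- The measure `d⁻ⁿ (fⁿ)^* ω` on the plane. -/
noncomputable def iterMeasure (d : ℕ) (P Q : ℂ[X]) (n : ℕ) : Measure ℂ :=
  ENNReal.ofReal ((d : ℝ) ^ n)⁻¹ • curveMeasure (fun z => (iterPoly d P Q n).1.eval z)
    (fun z => (iterPoly d P Q n).2.eval z)

theorem IsReduced.isPotential_iterMeasure (h : IsReduced d P Q) (hd : 0 < d) (n : ℕ) :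
    ∃ L, IsPotential (iterMeasure d P Q n) (iterPotential d P Q n) L := by
  have h1 := natDegree_iterPoly d P Q n
  have h2 := isPotential_curveMeasure (pow_pos hd n) h1.1 h1.2 (h.eval_iterPoly_ne_zero hd n)
    (h.coeff_iterPoly_ne_zero hd n)
  simp only [Nat.cast_pow] at h2
  exact ⟨_, h2⟩

/-- The Fubini-Study potential uses the Euclidean norm and `green` the supremum norm of `ℂ × ℂ`;
their logarithms differ by at most `½ log 2`. -/
theorem abs_curveLogNorm_sub_le {p q : ℂ} (h : (p, q) ≠ 0) :
    |1 / 2 * Real.log (‖p‖ ^ 2 + ‖q‖ ^ 2) - Real.log ‖(p, q)‖| ≤ 1 := by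
  have h0 : 0 < ‖(p, q)‖ := norm_pos_iff.2 h
  have h1 : ‖(p, q)‖ ^ 2 ≤ ‖p‖ ^ 2 + ‖q‖ ^ 2 := by
    rw [Prod.norm_mk]
    rcases max_choice ‖p‖ ‖q‖ with h | h <;> rw [h] <;> nlinarith [sq_nonneg ‖p‖, sq_nonneg ‖q‖]
  have h2 : ‖p‖ ^ 2 + ‖q‖ ^ 2 ≤ 2 * ‖(p, q)‖ ^ 2 := by
    have h3 : ‖p‖ ≤ ‖(p, q)‖ := norm_fst_le (p, q)
    have h4 : ‖q‖ ≤ ‖(p, q)‖ := norm_snd_le (p, q)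
    have := pow_le_pow_left₀ (norm_nonneg p) h3 2
    have := pow_le_pow_left₀ (norm_nonneg q) h4 2
    linarith
  have h5 := Real.log_le_log (by positivity) h1
  have h6 := Real.log_le_log (by nlinarith [sq_nonneg ‖(p, q)‖, pow_pos h0 2]) h2
  rw [Real.log_mul two_ne_zero (by positivity), Real.log_pow] at h6
  rw [Real.log_pow] at h5
  have h7 : Real.log 2 ≤ 1 := by linarith [Real.log_two_lt_d9]
  push_cast at h5 h6
  rw [abs_le]
  constructor <;> linarith

theorem abs_iterPotential_sub_le {C : ℝ}
    (hC : IsHomLift d (ratLift d P Q) C) (n : ℕ) (z : ℂ) :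
    |iterPotential d P Q n z - green d (ratLift d P Q) (z, 1)| ≤ (1 + C) / (d : ℝ) ^ n := by
  have hd : (0 : ℝ) < d := zero_lt_one.trans hC.one_lt
  have hdn : (0 : ℝ) < (d : ℝ) ^ n := pow_pos hd n
  have hv : ((z, 1) : ℂ × ℂ) ≠ 0 := by simp
  have h1 := hC.abs_green_sub_le hv n
  have h2 := hC.iterate_ne_zero hv n
  rw [← eval_iterPoly] at h1 h2
  have h3 := abs_curveLogNorm_sub_le h2
  have h4 : iterPotential d P Q n z - green d (ratLift d P Q) (z, 1) =
      (1 / 2 * Real.log (‖(iterPoly d P Q n).1.eval z‖ ^ 2 + ‖(iterPoly d P Q n).2.eval z‖ ^ 2) -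
        Real.log ‖((iterPoly d P Q n).1.eval z, (iterPoly d P Q n).2.eval z)‖) / (d : ℝ) ^ n -
      (green d (ratLift d P Q) (z, 1) -
        Real.log ‖((iterPoly d P Q n).1.eval z, (iterPoly d P Q n).2.eval z)‖ / (d : ℝ) ^ n) := by
    simp only [iterPotential, curveLogNorm, curveNormSq]
    field_simp
    ring
  rw [h4, add_div]
  refine (abs_sub _ _).trans (add_le_add ?_ h1)
  rw [abs_div, abs_of_pos hdn]
  gcongr

theorem IsReduced.continuous_green (h : IsReduced d P Q) (hd : 2 ≤ d) :
    Continuous fun z : ℂ => green d (ratLift d P Q) (z, 1) :=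
  (h.continuousOn_green hd).comp_continuous (by fun_prop) fun z => by simp

/-- By logarithmic homogeneity `G(z, 1) - log |z| = G(1, 1/z)`, and `G` is continuous at `(1, 0)`.
-/
theorem IsReduced.tendsto_green_sub_log (h : IsReduced d P Q) (hd : 2 ≤ d) :
    Tendsto (fun z : ℂ => green d (ratLift d P Q) (z, 1) - Real.log ‖z‖) (Bornology.cobounded ℂ)
      (𝓝 (green d (ratLift d P Q) (1, 0))) := by
  obtain ⟨C, hC⟩ := h.exists_isHomLift hd
  have h1 : Tendsto (fun z : ℂ => ((1 : ℂ), z⁻¹)) (Bornology.cobounded ℂ) (𝓝 (1, 0)) :=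
    tendsto_const_nhds.prodMk_nhds tendsto_inv₀_cobounded
  have h2 := ((h.continuousOn_green hd).continuousAt
    (isOpen_compl_singleton.mem_nhds (x := ((1 : ℂ), (0 : ℂ))) (by simp))).tendsto.comp h1
  refine h2.congr' ?_
  filter_upwards [Bornology.eventually_ne_cobounded (0 : ℂ)] with z hz
  have h3 : ((z, 1) : ℂ × ℂ) = z • (1, z⁻¹) := by
    ext <;> simp [hz]
  rw [h3, hC.green_smul hz (by simp)]
  simp

theorem IsReduced.tendsto_circleAverage_iterPotential (h : IsReduced d P Q) (hd : 2 ≤ d) (b : ℂ)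
    (r : ℝ) : Tendsto (fun n => Real.circleAverage (iterPotential d P Q n) b r) atTop
      (𝓝 (Real.circleAverage (fun z => green d (ratLift d P Q) (z, 1)) b r)) := by
  obtain ⟨C, hC⟩ := h.exists_isHomLift hd
  have h1 : Tendsto (fun n : ℕ => (1 + C) / (d : ℝ) ^ n) atTop (𝓝 0) :=
    Tendsto.const_div_atTop (tendsto_pow_atTop_atTop_of_one_lt hC.one_lt) _
  rw [tendsto_iff_dist_tendsto_zero]
  refine squeeze_zero (fun _ => dist_nonneg) (fun n => ?_) h1
  obtain ⟨L, hL⟩ := h.isPotential_iterMeasure (by omega) n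
  have i1 : CircleIntegrable (iterPotential d P Q n) b r :=
    hL.continuous.continuousOn.circleIntegrable'
  have i2 : CircleIntegrable (fun z => green d (ratLift d P Q) (z, 1)) b r :=
    (h.continuous_green hd).continuousOn.circleIntegrable'
  rw [Real.dist_eq, ← Real.circleAverage_fun_sub i1 i2, abs_le]
  have i3 : CircleIntegrable (fun z => iterPotential d P Q n z -
      green d (ratLift d P Q) (z, 1)) b r := i1.sub i2
  constructor
  · rw [← Real.circleAverage_const (-((1 + C) / (d : ℝ) ^ n)) b r]
    exact Real.circleAverage_mono continuous_const.continuousOn.circleIntegrable' i3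
      fun z _ => (abs_le.1 (abs_iterPotential_sub_le hC n z)).1
  · exact Real.circleAverage_mono_on_of_le_circle i3
      fun z _ => (abs_le.1 (abs_iterPotential_sub_le hC n z)).2

end Iterates

/-! ### Rational maps on the Riemann sphere and their canonical measures -/

open Classical in
/-- The projection of `ℂ² ∖ 0` to the Riemann sphere. -/
noncomputable def toSphere (v : ℂ × ℂ) : RiemannSphere :=
  if v.2 = 0 then OnePoint.infty else ((v.1 / v.2 : ℂ) : OnePoint ℂ)

theorem toSphere_of_eq_zero {v : ℂ × ℂ} (hv : v.2 = 0) : toSphere v = OnePoint.infty := if_pos hv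

theorem toSphere_of_ne_zero {v : ℂ × ℂ} (hv : v.2 ≠ 0) :
    toSphere v = ((v.1 / v.2 : ℂ) : OnePoint ℂ) := if_neg hv

theorem toSphere_one (z : ℂ) : toSphere (z, 1) = (z : OnePoint ℂ) := by
  rw [toSphere_of_ne_zero one_ne_zero, div_one]

theorem inv_toSphere {p q : ℂ} (h : p ≠ 0 ∨ q ≠ 0) :
    RiemannSphere.inv (toSphere (p, q)) = toSphere (q, p) := by
  by_cases hq : q = 0
  · have hp : p ≠ 0 := h.resolve_right (not_not.2 hq)
    rw [toSphere_of_eq_zero hq, toSphere_of_ne_zero hp, RiemannSphere.inv_infty]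
    simp [hq]
  · by_cases hp : p = 0
    · rw [toSphere_of_ne_zero hq, toSphere_of_eq_zero hp]
      simp [hp, RiemannSphere.inv_zero]
    · rw [toSphere_of_ne_zero hq, toSphere_of_ne_zero hp,
        RiemannSphere.inv_coe (div_ne_zero hp hq), inv_div]

open Classical in
theorem ratMap_coe (P Q : ℂ[X]) (z : ℂ) : ratMap P Q (z : OnePoint ℂ) =
    if Q.eval z = 0 then OnePoint.infty else ((P.eval z / Q.eval z : ℂ) : OnePoint ℂ) := rfl

open Classical in
theorem ratMap_infty (P Q : ℂ[X]) : ratMap P Q OnePoint.infty =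
    if Q.coeff (max P.natDegree Q.natDegree) = 0 then OnePoint.infty
    else ((P.coeff (max P.natDegree Q.natDegree) / Q.coeff (max P.natDegree Q.natDegree) : ℂ) :
      OnePoint ℂ) := rfl

theorem ratMap_toSphere {d : ℕ} {P Q : ℂ[X]} (h : IsReduced d P Q) {v : ℂ × ℂ}
    (hv : v ≠ 0) : ratMap P Q (toSphere v) = toSphere (ratLift d P Q v) := by
  by_cases hv2 : v.2 = 0
  · have hv1 : v.1 ≠ 0 := fun h => hv (Prod.ext h hv2)
    have h1 : ratLift d P Q v = (P.coeff d * v.1 ^ d, Q.coeff d * v.1 ^ d) := by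
      rw [ratLift, homEval_zero_right _ _ hv2, homEval_zero_right _ _ hv2]
    have hv1d : v.1 ^ d ≠ 0 := pow_ne_zero _ hv1
    rw [toSphere_of_eq_zero hv2, ratMap_infty, h.max_natDegree, h1]
    by_cases hQ : Q.coeff d = 0
    · rw [if_pos hQ, toSphere_of_eq_zero]
      simp [hQ]
    · rw [if_neg hQ, toSphere_of_ne_zero (mul_ne_zero hQ hv1d), mul_div_mul_right _ _ hv1d]
  · have hv2d : v.2 ^ d ≠ 0 := pow_ne_zero _ hv2
    have h1 : ratLift d P Q v =
        (v.2 ^ d * P.eval (v.1 / v.2), v.2 ^ d * Q.eval (v.1 / v.2)) := by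
      rw [ratLift, homEval_of_ne_zero h.natDegree_left hv2,
        homEval_of_ne_zero h.natDegree_right hv2]
    rw [toSphere_of_ne_zero hv2, ratMap_coe, h1]
    by_cases hQ : Q.eval (v.1 / v.2) = 0
    · rw [if_pos hQ, toSphere_of_eq_zero]
      simp [hQ]
    · rw [if_neg hQ, toSphere_of_ne_zero (mul_ne_zero hv2d hQ), mul_div_mul_left _ _ hv2d]

theorem iterate_ratMap_coe {d : ℕ} {P Q : ℂ[X]} (h : IsReduced d P Q) (hd : 0 < d) (n : ℕ)
    (z : ℂ) : (ratMap P Q)^[n] (z : OnePoint ℂ) =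
      toSphere ((iterPoly d P Q n).1.eval z, (iterPoly d P Q n).2.eval z) := by
  rw [eval_iterPoly, ← toSphere_one]
  induction n with
  | zero => rfl
  | succ n ih =>
    rw [Function.iterate_succ_apply', Function.iterate_succ_apply', ih,
      ratMap_toSphere h (h.iterate_ratLift_ne_zero hd (by simp) n)]

/-! ### The spherical derivative in homogeneous coordinates -/

section SphericalDeriv

open RiemannSphere

variable {p q : ℂ → ℂ} {f : RiemannSphere → RiemannSphere}

theorem fsWeight_coe (z : ℂ) : fsWeight (z : OnePoint ℂ) = 1 + ‖z‖ ^ 2 := by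
  rw [fsWeight, chartAt_coe, chartZero_coe]

theorem fsWeight_infty : fsWeight OnePoint.infty = 1 := by
  rw [fsWeight, chartAt_infty, chartInfty_infty]
  simp

theorem norm_mfderiv_eq {z D : ℂ} (hc : ContinuousAt f (z : OnePoint ℂ))
    (hD : HasDerivAt (fun w : ℂ => chartAt ℂ (f (z : OnePoint ℂ)) (f (w : OnePoint ℂ))) D z) :
    norm (E := ℂ) (mfderiv 𝓘(ℂ) 𝓘(ℂ) f (z : OnePoint ℂ) (1 : ℂ)) = ‖D‖ := by
  have h1 : HasMFDerivAt 𝓘(ℂ) 𝓘(ℂ) f (z : OnePoint ℂ)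
      (ContinuousLinearMap.toSpanSingleton ℂ D) := by
    refine ⟨hc, ?_⟩
    have h2 := hD.hasFDerivAt.hasFDerivWithinAt (s := Set.range 𝓘(ℂ))
    have h3 : extChartAt 𝓘(ℂ) ((z : OnePoint ℂ) : RiemannSphere) (z : OnePoint ℂ) = z := by
      simp [chartAt_coe, chartZero_coe]
    rw [h3]
    refine h2.congr_of_eventuallyEq (Eventually.of_forall fun w => ?_) ?_
    · simp [writtenInExtChartAt, chartAt_coe, chartZero_symm_apply]
    · simp [writtenInExtChartAt, chartAt_coe, chartZero_symm_apply]
  rw [h1.mfderiv]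
  change ‖(1 : ℂ) • D‖ = ‖D‖
  rw [one_smul]

/-- Over infinity the inversion exchanges the two coordinates and reduces to the affine case. -/
theorem continuousAt_toSphere {v : ℂ × ℂ} (hv : v ≠ 0) : ContinuousAt toSphere v := by
  have key : ∀ v : ℂ × ℂ, v.2 ≠ 0 → ContinuousAt toSphere v := by
    intro v hv2
    have h1 : ContinuousAt (fun v : ℂ × ℂ => ((v.1 / v.2 : ℂ) : OnePoint ℂ)) v :=
      OnePoint.continuous_coe.continuousAt.comp
        (continuousAt_fst.div continuousAt_snd hv2)
    refine h1.congr ?_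
    filter_upwards [continuousAt_snd.eventually_ne hv2] with w hw
    exact (toSphere_of_ne_zero hw).symm
  by_cases hv2 : v.2 = 0
  · have hv1 : v.1 ≠ 0 := fun h => hv (Prod.ext h hv2)
    have h1 : ContinuousAt (fun w : ℂ × ℂ => RiemannSphere.inv (toSphere w.swap)) v :=
      continuous_inv.continuousAt.comp
        (ContinuousAt.comp (f := Prod.swap) (key v.swap hv1) continuous_swap.continuousAt)
    refine h1.congr ?_
    filter_upwards [continuousAt_fst.eventually_ne hv1] with w hw
    exact inv_toSphere (Or.inr hw)
  · exact key v hv2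

/-- The spherical derivative of `p / q`. -/
theorem sphericalDeriv_coe (hp : Differentiable ℂ p) (hq : Differentiable ℂ q)
    (h0 : ∀ z, p z ≠ 0 ∨ q z ≠ 0) (hf : ∀ z : ℂ, f (z : OnePoint ℂ) = toSphere (p z, q z)) (z : ℂ) :
    sphericalDeriv f (z : OnePoint ℂ) =
      ‖deriv p z * q z - p z * deriv q z‖ * (1 + ‖z‖ ^ 2) / curveNormSq p q z := by
  have hc : ContinuousAt f (z : OnePoint ℂ) := by
    rw [OnePoint.continuousAt_coe]
    have h1 : ContinuousAt (fun w => toSphere (p w, q w)) z :=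
      ContinuousAt.comp (f := fun w => (p w, q w))
        (continuousAt_toSphere fun h => by
          rcases h0 z with h1 | h1
          · exact h1 (congrArg Prod.fst h)
          · exact h1 (congrArg Prod.snd h))
        (hp.continuous.prodMk hq.continuous).continuousAt
    exact h1.congr (Eventually.of_forall fun w => (hf w).symm)
  have dp := (hp z).hasDerivAt
  have dq := (hq z).hasDerivAt
  by_cases hqz : q z = 0
  -- At a pole the preferred chart of the target is `1 / z`, so the function to differentiate is `q
  -- / p`, and the weight of the target is `1`.
  · have hpz : p z ≠ 0 := (h0 z).resolve_right (not_not.2 hqz)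
    have hfz : f (z : OnePoint ℂ) = OnePoint.infty := by
      rw [hf, toSphere_of_eq_zero hqz]
    have hD : HasDerivAt (fun w : ℂ => chartAt ℂ (f (z : OnePoint ℂ)) (f (w : OnePoint ℂ)))
        ((deriv q z * p z - q z * deriv p z) / p z ^ 2) z := by
      refine (dq.div dp hpz).congr_of_eventuallyEq ?_
      filter_upwards [hp.continuous.continuousAt.eventually_ne hpz] with w hw
      rw [hfz, chartAt_infty, chartInfty_apply, hf, inv_toSphere (h0 w),
        toSphere_of_ne_zero hw, chartZero_coe]
      rfl
    rw [sphericalDeriv, norm_mfderiv_eq hc hD, fsWeight_coe, hfz, fsWeight_infty, curveNormSq, hqz,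
      norm_div, norm_pow, ← norm_neg]
    simp
    ring
  · have hfz : f (z : OnePoint ℂ) = ((p z / q z : ℂ) : OnePoint ℂ) := by
      rw [hf, toSphere_of_ne_zero hqz]
    have hD : HasDerivAt (fun w : ℂ => chartAt ℂ (f (z : OnePoint ℂ)) (f (w : OnePoint ℂ)))
        ((deriv p z * q z - p z * deriv q z) / q z ^ 2) z := by
      refine (dp.div dq hqz).congr_of_eventuallyEq ?_
      filter_upwards [hq.continuous.continuousAt.eventually_ne hqz] with w hw
      rw [hfz, chartAt_coe, hf, toSphere_of_ne_zero hw, chartZero_coe]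
      rfl
    have hq' := norm_pos_iff.2 hqz
    rw [sphericalDeriv, norm_mfderiv_eq hc hD, fsWeight_coe, hfz, fsWeight_coe, curveNormSq,
      norm_div, norm_div, norm_pow]
    have h2 : 1 + (‖p z‖ / ‖q z‖) ^ 2 = (‖p z‖ ^ 2 + ‖q z‖ ^ 2) / ‖q z‖ ^ 2 := by
      field_simp
      ring
    rw [h2]
    field_simp

/-- The factor `(1 + |z|²)²` in the squared spherical derivative cancels the density of `ω`. The
value of `f` at infinity is irrelevant, since `ω` is carried by the plane. -/
theorem fsPullback_eq_map (hp : Differentiable ℂ p) (hq : Differentiable ℂ q)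
    (h0 : ∀ z, p z ≠ 0 ∨ q z ≠ 0) (hf : ∀ z : ℂ, f (z : OnePoint ℂ) = toSphere (p z, q z)) :
    fsPullback f = (curveMeasure p q).map ((↑) : ℂ → OnePoint ℂ) := by
  have he : MeasurableEmbedding ((↑) : ℂ → RiemannSphere) :=
    OnePoint.isOpenEmbedding_coe.measurableEmbedding
  have hw : Measurable fun z : ℂ => ENNReal.ofReal (1 / (Real.pi * (1 + ‖z‖ ^ 2) ^ 2)) := by
    fun_prop
  ext S hS
  rw [fsPullback, withDensity_apply _ hS, fubiniStudy, he.restrict_map, he.lintegral_map,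
    he.map_apply, curveMeasure, withDensity_apply _ (he.measurable hS),
    restrict_withDensity (he.measurable hS),
    lintegral_withDensity_eq_lintegral_mul_non_measurable _ hw
      (Eventually.of_forall fun _ => ENNReal.ofReal_lt_top)]
  refine lintegral_congr fun z => ?_
  have hN := curveNormSq_pos h0 z
  have hπ := Real.pi_pos
  rw [Pi.mul_apply, sphericalDeriv_coe hp hq h0 hf, ← ENNReal.ofReal_mul (by positivity)]
  congr 1
  rw [curveDensity]
  field_simp

end SphericalDeriv

/-! ### Existence and potential of the canonical measure -/

section CanonicalMeasure

variable {d : ℕ} {P Q : ℂ[X]}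

theorem measurableEmbedding_coe : MeasurableEmbedding ((↑) : ℂ → RiemannSphere) :=
  OnePoint.isOpenEmbedding_coe.measurableEmbedding

theorem integral_fsPullback_iterate (h : IsReduced d P Q) (hd : 0 < d) (n : ℕ)
    (φ : RiemannSphere → ℝ) :
    ((d : ℝ) ^ n)⁻¹ * ∫ x, φ x ∂(fsPullback (ratMap P Q)^[n]) =
      ∫ x : ℂ, φ (x : OnePoint ℂ) ∂iterMeasure d P Q n := by
  rw [fsPullback_eq_map (Polynomial.differentiable _) (Polynomial.differentiable _)
    (h.eval_iterPoly_ne_zero hd n) (iterate_ratMap_coe h hd n),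
    measurableEmbedding_coe.integral_map, iterMeasure, integral_smul_measure,
    ENNReal.toReal_ofReal (by positivity), smul_eq_mul]

theorem IsReduced.tendsto_integral_logTent (h : IsReduced d P Q) (hd : 2 ≤ d) (b : ℂ) {r R : ℝ}
    (hr : 0 < r) (hrR : r ≤ R) :
    Tendsto (fun n => ∫ x, logTent r R ‖x - b‖ ∂iterMeasure d P Q n) atTop
      (𝓝 (Real.circleAverage (fun z => green d (ratLift d P Q) (z, 1)) b R -
        Real.circleAverage (fun z => green d (ratLift d P Q) (z, 1)) b r)) := by
  refine ((h.tendsto_circleAverage_iterPotential hd b R).sub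
    (h.tendsto_circleAverage_iterPotential hd b r)).congr fun n => ?_
  obtain ⟨L, hL⟩ := h.isPotential_iterMeasure (by omega) n
  exact (hL.integral_logTent b r R hr hrR).symm

theorem IsReduced.exists_isMaxEntropyMeasure (h : IsReduced d P Q) (hd : 2 ≤ d) :
    ∃ μ, IsMaxEntropyMeasure d (ratMap P Q) μ := by
  have (n : ℕ) : IsProbabilityMeasure (iterMeasure d P Q n) := by
    obtain ⟨L, hL⟩ := h.isPotential_iterMeasure (by omega) n
    exact hL.isProbabilityMeasure
  obtain ⟨μ, hμ, hlim⟩ := exists_weak_limit (ν := iterMeasure d P Q) fun b r hr =>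
    ⟨_, h.tendsto_integral_logTent hd b hr (by linarith)⟩
  refine ⟨μ, hμ, fun φ => (hlim φ).congr fun n => ?_⟩
  rw [integral_fsPullback_iterate h (by omega)]

open Classical in
/-- A continuous compactly supported radial function on `ℂ`, extended by `0` to the sphere. -/
noncomputable def logTentSphere {r R : ℝ} (hr : 0 < r) (hrR : r ≤ R) (b : ℂ) :
    C(RiemannSphere, ℝ) where
  toFun x := OnePoint.elim x 0 (fun z => logTent r R ‖z - b‖)
  continuous_toFun := by
    rw [OnePoint.continuous_iff]
    constructor
    · refine tendsto_const_nhds.congr' ?_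
      rw [coclosedCompact_eq_cocompact]
      filter_upwards [(isCompact_closedBall b R).compl_mem_cocompact] with z hz
      rw [Set.mem_compl_iff, Metric.mem_closedBall, dist_eq_norm, not_le] at hz
      exact (logTent_of_ge hrR hz.le).symm
    · exact (continuous_logTent hr (hr.trans_le hrR)).comp (by fun_prop)

theorem logTentSphere_coe {r R : ℝ} (hr : 0 < r) (hrR : r ≤ R) (b z : ℂ) :
    logTentSphere hr hrR b (z : OnePoint ℂ) = logTent r R ‖z - b‖ := rfl

theorem logTentSphere_infty {r R : ℝ} (hr : 0 < r) (hrR : r ≤ R) (b : ℂ) :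
    logTentSphere hr hrR b OnePoint.infty = 0 := rfl

/-- The restriction of the canonical measure to the plane has the Green function as potential. -/
theorem _root_.IsMaxEntropyMeasure.isPotential {μ : Measure RiemannSphere}
    (hμ : IsMaxEntropyMeasure d (ratMap P Q) μ) (h : IsReduced d P Q) (hd : 2 ≤ d) :
    IsPotential (μ.comap ((↑) : ℂ → OnePoint ℂ)) (fun z => green d (ratLift d P Q) (z, 1))
      (green d (ratLift d P Q) (1, 0)) := by
  have := hμ.isProbabilityMeasure
  have he := measurableEmbedding_coe
  have hfin : IsFiniteMeasure (μ.comap ((↑) : ℂ → OnePoint ℂ)) := by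
    constructor
    rw [he.comap_apply]
    exact measure_lt_top μ _
  refine ⟨h.continuous_green hd, h.tendsto_green_sub_log hd, fun b r R hr hrR => ?_,
    fun b r R hr hrR => ?_⟩
  · have hc := continuous_logTent hr (hr.trans_le hrR)
    refine Integrable.of_bound (C := Real.log R - Real.log r)
      (Continuous.aestronglyMeasurable (by fun_prop)) (Eventually.of_forall fun x => ?_)
    rw [Real.norm_of_nonneg (logTent_nonneg hr hrR _)]
    exact logTent_le hr hrR _
  · have h1 := hμ.tendsto (logTentSphere hr hrR b)
    simp only [integral_fsPullback_iterate h (by omega : 0 < d), logTentSphere_coe] at h1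
    have h2 := tendsto_nhds_unique h1 (h.tendsto_integral_logTent hd b hr hrR)
    rw [← h2]
    have h3 : ∫ x, logTent r R ‖x - b‖ ∂(μ.comap ((↑) : ℂ → OnePoint ℂ)) =
        ∫ x in Set.range ((↑) : ℂ → OnePoint ℂ), logTentSphere hr hrR b x ∂μ := by
      rw [← he.map_comap, he.integral_map]
      rfl
    rw [h3]
    -- The tent vanishes at infinity, so a possible mass there, not yet excluded, does not
    -- contribute.
    refine setIntegral_eq_integral_of_forall_compl_eq_zero fun x hx => ?_
    rw [OnePoint.notMem_range_coe_iff] at hx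
    rw [hx, logTentSphere_infty]

/-- The growth of its potential forces the restriction of `μ` to the plane to have mass one already,
which leaves none at infinity. -/
theorem _root_.IsMaxEntropyMeasure.map_comap {μ : Measure RiemannSphere}
    (hμ : IsMaxEntropyMeasure d (ratMap P Q) μ) (h : IsReduced d P Q) (hd : 2 ≤ d) :
    (μ.comap ((↑) : ℂ → OnePoint ℂ)).map ((↑) : ℂ → OnePoint ℂ) = μ := by
  have := hμ.isProbabilityMeasure
  have he := measurableEmbedding_coe
  have h1 := (hμ.isPotential h hd).isProbabilityMeasure.measure_univ
  rw [he.comap_apply, Set.image_univ] at h1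
  rw [he.map_comap]
  refine Measure.restrict_eq_self_of_ae_mem ?_
  rwa [← prob_compl_eq_zero_iff he.measurableSet_range] at h1

end CanonicalMeasure

/-! ### A formula for the Lyapunov exponent -/

theorem exists_ne_zero_homEval_eq_zero {m : ℕ} {p : ℂ[X]} (hm : 0 < m) (hp : p.natDegree ≤ m) :
    ∃ v ≠ 0, homEval m p v = 0 := by
  by_cases hp0 : p = 0
  · exact ⟨(1, 0), by simp, by simp [hp0, homEval]⟩
  · obtain ⟨κ, a, ha⟩ := exists_isFactorization hp0 hp
    refine ⟨a ⟨0, hm⟩, fun h => ?_, ?_⟩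
    · have := ha.norm_eq_one ⟨0, hm⟩
      simp [h] at this
    · rw [ha.homEval_eq, Finset.prod_eq_zero (Finset.mem_univ ⟨0, hm⟩), mul_zero]
      simp [wedge, mul_comm]

theorem IsFactorization.ne_zero' {m : ℕ} {p : ℂ[X]} {κ : ℂ} {a : Fin m → ℂ × ℂ}
    (h : IsFactorization m p κ a) (i : Fin m) : a i ≠ 0 := fun h0 => by
  have := h.norm_eq_one i
  simp [h0] at this

theorem IsFactorization.homEval_self {m : ℕ} {p : ℂ[X]} {κ : ℂ} {a : Fin m → ℂ × ℂ}
    (h : IsFactorization m p κ a) (i : Fin m) : homEval m p (a i) = 0 := by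
  rw [h.homEval_eq, Finset.prod_eq_zero (Finset.mem_univ i), mul_zero]
  simp [wedge, mul_comm]

/-! ### Sums of the Green function over fibres, and resultants -/

section Resultant

variable {d : ℕ} {P Q : ℂ[X]}

theorem IsReduced.add_mul_ne_zero (h : IsReduced d P Q) (hd : 0 < d) (b : ℂ) :
    P + Q * C b ≠ 0 := by
  intro h0
  obtain ⟨v, hv, hv0⟩ := exists_ne_zero_homEval_eq_zero hd h.natDegree_right
  refine h.ratLift_ne_zero hd hv (Prod.ext ?_ hv0)
  have h1 : homEval d (P + Q * C b) v = 0 := by simp [h0, homEval]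
  rwa [mul_comm Q, homEval_add, homEval_C_mul, hv0, mul_zero, add_zero] at h1

theorem IsReduced.right_ne_zero (h : IsReduced d P Q) (hd : 0 < d) : Q ≠ 0 := by
  intro h0
  obtain ⟨v, hv, hv0⟩ := exists_ne_zero_homEval_eq_zero hd h.natDegree_left
  refine h.ratLift_ne_zero hd hv (Prod.ext hv0 ?_)
  simp [ratLift, h0, homEval]

/-- The sum of the values of the Green function at the roots of a form vanishing on the preimage
of `w`. -/
theorem IsFactorization.sum_green_eq {A B : ℂ[X]} {κ : ℂ} {a : Fin d → ℂ × ℂ}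
    (ha : IsFactorization d A κ a) (hB : B.natDegree ≤ d) (h : IsReduced d P Q) (hd : 2 ≤ d)
    {w : ℂ × ℂ} (hw : w ≠ 0) (hF : ∀ i, ratLift d P Q (a i) = homEval d B (a i) • w) :
    (∀ i, homEval d B (a i) ≠ 0) ∧
    d * (Real.log ‖κ‖ + ∑ i, green d (ratLift d P Q) (a i)) =
      Real.log ‖resultant A B d d‖ + d * green d (ratLift d P Q) w := by
  obtain ⟨C, hC⟩ := h.exists_isHomLift hd
  have h0 : ∀ i, homEval d B (a i) ≠ 0 := by
    intro i hi
    have := hF i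
    rw [hi, zero_smul] at this
    exact h.ratLift_ne_zero (by omega) (ha.ne_zero' i) this
  refine ⟨h0, ?_⟩
  -- Both sides are `G(F(aᵢ))`: once by `G ∘ F = d G`, once because `F(aᵢ)` is the multiple `B(aᵢ)`
  -- of `w`.
  have h1 : ∀ i, d * green d (ratLift d P Q) (a i) =
      Real.log ‖homEval d B (a i)‖ + green d (ratLift d P Q) w := by
    intro i
    rw [← hC.green_map (ha.ne_zero' i), hF, hC.green_smul (h0 i) hw]
  rw [ha.norm_resultant d B hB, Real.log_mul (pow_ne_zero _ (norm_ne_zero_iff.2 ha.ne_zero))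
    (Finset.prod_ne_zero_iff.2 fun i _ => norm_ne_zero_iff.2 (h0 i)), Real.log_pow,
    Real.log_prod (fun i _ => norm_ne_zero_iff.2 (h0 i)), mul_add, Finset.mul_sum,
    Finset.sum_congr rfl fun i _ => h1 i, Finset.sum_add_distrib]
  simp
  ring

/-- The roots of `P - b Q` are the preimages of `(b, 1)`, with `F(aᵢ) = Q(aᵢ) (b, 1)`, and `Res(P -
b Q, Q) = Res(P, Q)`. Thus `b` enters the result only through `G(b, 1)`. -/
theorem IsFactorization.sum_green_add_mul {b κ : ℂ} {a : Fin d → ℂ × ℂ}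
    (ha : IsFactorization d (P + Q * C (-b)) κ a) (h : IsReduced d P Q) (hd : 2 ≤ d) :
    Real.log ‖κ‖ + ∑ i, green d (ratLift d P Q) (a i) =
      (d : ℝ)⁻¹ * Real.log ‖resultant P Q d d‖ + green d (ratLift d P Q) (b, 1) := by
  have h1 := (ha.sum_green_eq h.natDegree_right h hd (w := (b, 1)) (by simp) fun i => by
    have := ha.homEval_self i
    rw [homEval_add, mul_comm Q, homEval_C_mul] at this
    ext
    · simp [ratLift]
      linear_combination this
    · simp [ratLift]).2
  rw [resultant_add_mul_left _ _ _ _ _ (by simp) h.natDegree_right] at h1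
  have : (d : ℝ) ≠ 0 := by positivity
  field_simp
  linarith

/-- The same for the fibre of infinity: `F(aᵢ) = P(aᵢ) (1, 0)`, and exchanging the arguments of the
resultant only changes its sign. -/
theorem IsFactorization.sum_green_right {κ : ℂ} {a : Fin d → ℂ × ℂ}
    (ha : IsFactorization d Q κ a) (h : IsReduced d P Q) (hd : 2 ≤ d) :
    Real.log ‖κ‖ + ∑ i, green d (ratLift d P Q) (a i) =
      (d : ℝ)⁻¹ * Real.log ‖resultant P Q d d‖ + green d (ratLift d P Q) (1, 0) := by
  have h1 := (ha.sum_green_eq h.natDegree_left h hd (w := (1, 0)) (by simp) fun i => by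
    have := ha.homEval_self i
    ext <;> simp [ratLift, this]).2
  rw [resultant_comm] at h1
  simp only [norm_mul, norm_pow, norm_neg, norm_one, one_pow, one_mul] at h1
  have : (d : ℝ) ≠ 0 := by positivity
  field_simp
  linarith

theorem IsReduced.resultant_ne_zero (h : IsReduced d P Q) (hd : 2 ≤ d) :
    resultant P Q d d ≠ 0 := by
  obtain ⟨κ, a, ha⟩ := exists_isFactorization (h.right_ne_zero (by omega)) h.natDegree_right
  have h1 := (ha.sum_green_eq h.natDegree_left h hd (w := (1, 0)) (by simp) fun i => by
    have := ha.homEval_self i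
    ext <;> simp [ratLift, this]).1
  have h2 := ha.norm_resultant d P h.natDegree_left
  rw [resultant_comm, ← norm_ne_zero_iff, norm_mul, h2]
  refine mul_ne_zero (by simp) (mul_ne_zero (pow_ne_zero _ (norm_ne_zero_iff.2 ha.ne_zero))
    (Finset.prod_ne_zero_iff.2 fun i _ => norm_ne_zero_iff.2 (h1 i)))

end Resultant

/-! ### Integrals of logarithms of forms against the canonical measure -/

section LogIntegrals

variable {d : ℕ} {P Q : ℂ[X]} {m : Measure ℂ} {F : ℂ × ℂ → ℂ × ℂ} {C : ℝ}

theorem IsPotential.ae_wedge_ne_zero {g : ℂ → ℝ} {L : ℝ} (hm : IsPotential m g L)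
    {v : ℂ × ℂ} (hv : v ≠ 0) : ∀ᵐ x ∂m, wedge (x, 1) v ≠ 0 := by
  by_cases h2 : v.2 = 0
  · refine Eventually.of_forall fun x => ?_
    have h1 : v.1 ≠ 0 := fun h => hv (Prod.ext h h2)
    simpa [wedge, h2] using h1
  · have : ∀ᵐ x ∂m, x ≠ v.1 / v.2 :=
      measure_eq_zero_iff_ae_notMem.1 (hm.measure_singleton (v.1 / v.2))
    filter_upwards [this] with x hx h0
    apply hx
    rw [eq_div_iff h2]
    simpa [wedge, sub_eq_zero] using h0

/-- This is the homogeneous version of the potential, covering roots at infinity: for `v.2 ≠ 0` the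
form is `v.2 (x - v.1 / v.2)`, and otherwise it is constant. -/
theorem IsPotential.integral_log_wedge (hF : IsHomLift d F C)
    (hm : IsPotential m (fun z => green d F (z, 1)) (green d F (1, 0))) {v : ℂ × ℂ} (hv : v ≠ 0) :
    Integrable (fun x => Real.log ‖wedge (x, 1) v‖) m ∧
      ∫ x, Real.log ‖wedge (x, 1) v‖ ∂m = green d F v - green d F (1, 0) := by
  have := hm.isProbabilityMeasure
  by_cases h2 : v.2 = 0
  · have h1 : v.1 ≠ 0 := fun h => hv (Prod.ext h h2)
    have h3 : v = v.1 • ((1 : ℂ), (0 : ℂ)) := by ext <;> simp [h2]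
    have h4 := hF.green_smul h1 (v := (1, 0)) (by simp)
    rw [← h3] at h4
    simp only [wedge, h2, mul_zero, zero_sub, norm_neg, one_mul, h4]
    exact ⟨integrable_const _, by simp⟩
  · have h3 : v = v.2 • (v.1 / v.2, (1 : ℂ)) := by
      ext <;> simp
      field_simp
    have h4 := hF.green_smul h2 (v := (v.1 / v.2, 1)) (by simp)
    rw [← h3] at h4
    have hl := hm.hasLogPotential
    have h5 : (fun x => Real.log ‖wedge (x, 1) v‖) =ᵐ[m]
        fun x => Real.log ‖v.2‖ + Real.log ‖x - v.1 / v.2‖ := by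
      filter_upwards [hm.ae_wedge_ne_zero hv] with x hx
      have h6 : wedge (x, 1) v = v.2 * (x - v.1 / v.2) := by
        simp [wedge]
        field_simp
      rw [h6] at hx ⊢
      rw [norm_mul, Real.log_mul (norm_ne_zero_iff.2 h2)
        (norm_ne_zero_iff.2 (right_ne_zero_of_mul hx))]
    refine ⟨(((integrable_const _).add (hl.integrable_log _)).congr h5.symm), ?_⟩
    rw [integral_congr_ae h5, integral_add (integrable_const _) (hl.integrable_log _),
      hl.integral_log, h4]
    simp
    ring

theorem IsPotential.ae_eval_ne_zero {g : ℂ → ℝ} {L : ℝ} (hm : IsPotential m g L)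
    {p : ℂ[X]} (hp : p ≠ 0) : ∀ᵐ x ∂m, p.eval x ≠ 0 := by
  obtain ⟨κ, a, ha⟩ := exists_isFactorization hp le_rfl
  filter_upwards [ae_all_iff.2 fun i => hm.ae_wedge_ne_zero (ha.ne_zero' i)] with x hx
  rw [← homEval_one_right le_rfl, ha.homEval_eq]
  exact mul_ne_zero ha.ne_zero (Finset.prod_ne_zero_iff.2 fun i _ => hx i)

theorem IsPotential.integral_log_eval (hF : IsHomLift d F C)
    (hm : IsPotential m (fun z => green d F (z, 1)) (green d F (1, 0))) {k : ℕ} {p : ℂ[X]}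
    (hp : p.natDegree ≤ k) {κ : ℂ} {a : Fin k → ℂ × ℂ} (ha : IsFactorization k p κ a) :
    Integrable (fun x => Real.log ‖p.eval x‖) m ∧
      ∫ x, Real.log ‖p.eval x‖ ∂m =
        Real.log ‖κ‖ + ∑ i, green d F (a i) - k * green d F (1, 0) := by
  have := hm.isProbabilityMeasure
  have h1 : (fun x => Real.log ‖p.eval x‖) =ᵐ[m]
      fun x => Real.log ‖κ‖ + ∑ i, Real.log ‖wedge (x, 1) (a i)‖ := by
    filter_upwards [ae_all_iff.2 fun i => hm.ae_wedge_ne_zero (ha.ne_zero' i)] with x hx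
    rw [← homEval_one_right hp, ha.homEval_eq, norm_mul, norm_prod,
      Real.log_mul (norm_ne_zero_iff.2 ha.ne_zero)
        (Finset.prod_ne_zero_iff.2 fun i _ => norm_ne_zero_iff.2 (hx i)),
      Real.log_prod (fun i _ => norm_ne_zero_iff.2 (hx i))]
  have h2 := fun i => (hm.integral_log_wedge hF (ha.ne_zero' i))
  have h3 := integrable_finsetSum Finset.univ fun i _ => (h2 i).1
  refine ⟨((integrable_const _).add h3).congr h1.symm, ?_⟩
  rw [integral_congr_ae h1, integral_add (integrable_const _) h3,
    integral_finsetSum _ fun i _ => (h2 i).1, Finset.sum_congr rfl fun i _ => (h2 i).2]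
  simp
  ring

end LogIntegrals
-- Integration of the logarithm of the spherical derivative
section Lyapunov

variable {d : ℕ} {P Q : ℂ[X]} {m : Measure ℂ}

theorem wronskian_ne_zero (h : IsReduced d P Q) (hd : 0 < d) : wronskian Q P ≠ 0 := by
  intro h0
  obtain ⟨h1, h2⟩ := h.isCoprime.symm.wronskian_eq_zero_iff.1 h0
  have h3 := h.max_natDegree
  rw [Polynomial.derivative_eq_zero.1 h1, Polynomial.derivative_eq_zero.1 h2] at h3
  simp at h3
  omega

theorem natDegree_wronskian_le (hP : P.natDegree ≤ d) (hQ : Q.natDegree ≤ d) (hd : 0 < d) :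
    (wronskian Q P).natDegree ≤ 2 * d - 2 := by
  have hQ' : (derivative Q).natDegree ≤ d - 1 := (natDegree_derivative_le Q).trans (by omega)
  have hP' : (derivative P).natDegree ≤ d - 1 := (natDegree_derivative_le P).trans (by omega)
  rw [natDegree_le_iff_coeff_eq_zero]
  intro n hn
  rcases Nat.lt_or_ge (d + (d - 1)) n with h1 | h1
  · rw [wronskian, coeff_sub, coeff_eq_zero_of_natDegree_lt, coeff_eq_zero_of_natDegree_lt, sub_zero]
    · exact (natDegree_mul_le_of_le hQ' hP).trans_lt (by omega)
    · exact (natDegree_mul_le_of_le hQ hP').trans_lt (by omega)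
  -- In degree `2d - 1` the two products contribute `d · P_d · Q_d` with opposite signs.
  · obtain rfl : n = d + (d - 1) := by omega
    rw [wronskian, coeff_sub, coeff_mul_add_eq_of_natDegree_le hQ hP', add_comm d,
      coeff_mul_add_eq_of_natDegree_le hQ' hP, coeff_derivative, coeff_derivative,
      Nat.sub_add_cancel hd]
    ring

/-- The terms `½ log (1 + |·|²)` are kept intact because they are the Fubini-Study potential at `z`
and at `f(z)`. -/
theorem log_sphericalDeriv_coe {z : ℂ} (h : IsReduced d P Q) (hW : (wronskian Q P).eval z ≠ 0)
    (hQ : Q.eval z ≠ 0) :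
    Real.log (sphericalDeriv (ratMap P Q) (z : OnePoint ℂ)) =
      Real.log ‖(wronskian Q P).eval z‖ + 2 * (1 / 2 * Real.log (1 + ‖z‖ ^ 2)) -
        2 * Real.log ‖Q.eval z‖ - 2 * (1 / 2 * Real.log (1 + ‖P.eval z / Q.eval z‖ ^ 2)) := by
  have h0 : ∀ z : ℂ, ratMap P Q (z : OnePoint ℂ) = toSphere (P.eval z, Q.eval z) := ratMap_coe P Q
  have hQ' := norm_ne_zero_iff.2 hQ
  have h1 : curveNormSq (fun z => P.eval z) (fun z => Q.eval z) z =
      ‖Q.eval z‖ ^ 2 * (1 + ‖P.eval z / Q.eval z‖ ^ 2) := by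
    rw [curveNormSq, norm_div]
    field_simp
    ring
  have h2 : deriv (fun z => P.eval z) z * Q.eval z - P.eval z * deriv (fun z => Q.eval z) z =
      (wronskian Q P).eval z := by
    rw [Polynomial.deriv, Polynomial.deriv, wronskian]
    simp
    ring
  have h3 : (1 + ‖z‖ ^ 2) ≠ 0 := by positivity
  have h4 : (1 + ‖P.eval z / Q.eval z‖ ^ 2) ≠ 0 := by positivity
  rw [sphericalDeriv_coe (Polynomial.differentiable _) (Polynomial.differentiable _)
    h.eval_ne_zero h0, h1, h2, Real.log_div (mul_ne_zero (norm_ne_zero_iff.2 hW) h3)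
      (mul_ne_zero (pow_ne_zero _ hQ') h4), Real.log_mul (norm_ne_zero_iff.2 hW) h3,
    Real.log_mul (pow_ne_zero _ hQ') h4, Real.log_pow]
  push_cast
  ring

/-- This is the invariance of `μ` at the level of potentials. Almost everywhere `log |f - b| = log
|P - b Q| - log |Q|`, and in the difference of the sums of `G` over the fibres of `b` and of
infinity the resultants cancel. -/
theorem IsPotential.hasLogPotential_map (h : IsReduced d P Q) (hd : 2 ≤ d)
    (hm : IsPotential m (fun z => green d (ratLift d P Q) (z, 1)) (green d (ratLift d P Q) (1, 0))) :
    HasLogPotential (m.map fun x => P.eval x / Q.eval x)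
      (fun b => green d (ratLift d P Q) (b, 1) - green d (ratLift d P Q) (1, 0)) := by
  have := hm.isProbabilityMeasure
  have hmeas : Measurable fun x : ℂ => P.eval x / Q.eval x :=
    P.continuous.measurable.div Q.continuous.measurable
  obtain ⟨C, hF⟩ := h.exists_isHomLift hd
  have hQ := h.right_ne_zero (by omega : 0 < d)
  obtain ⟨κ, a, ha⟩ := exists_isFactorization hQ h.natDegree_right
  have key (b : ℂ) : Integrable (fun x => Real.log ‖P.eval x / Q.eval x - b‖) m ∧
      ∫ x, Real.log ‖P.eval x / Q.eval x - b‖ ∂m =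
        green d (ratLift d P Q) (b, 1) - green d (ratLift d P Q) (1, 0) := by
    have hb := h.add_mul_ne_zero (by omega : 0 < d) (-b)
    have hdeg : (P + Q * Polynomial.C (-b)).natDegree ≤ d :=
      natDegree_add_le_of_degree_le h.natDegree_left
        ((natDegree_mul_C_le _ _).trans h.natDegree_right)
    obtain ⟨κ', a', ha'⟩ := exists_isFactorization hb hdeg
    have h1 : (fun x => Real.log ‖P.eval x / Q.eval x - b‖) =ᵐ[m] fun x =>
        Real.log ‖(P + Q * Polynomial.C (-b)).eval x‖ - Real.log ‖Q.eval x‖ := by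
      filter_upwards [hm.ae_eval_ne_zero hb, hm.ae_eval_ne_zero hQ] with x hx1 hx2
      rw [← Real.log_div (norm_ne_zero_iff.2 hx1) (norm_ne_zero_iff.2 hx2), ← norm_div]
      congr 2
      simp
      field_simp
      ring
    have h2 := hm.integral_log_eval hF hdeg ha'
    have h3 := hm.integral_log_eval hF h.natDegree_right ha
    refine ⟨(h2.1.sub h3.1).congr h1.symm, ?_⟩
    rw [integral_congr_ae h1, integral_sub h2.1 h3.1, h2.2, h3.2, ha'.sum_green_add_mul h hd,
      ha.sum_green_right h hd]
    ring
  have hlog (b : ℂ) : Measurable fun y : ℂ => Real.log ‖y - b‖ :=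
    Real.measurable_log.comp (by fun_prop)
  have hint (b : ℂ) : Integrable (fun y => Real.log ‖y - b‖) (m.map fun x => P.eval x / Q.eval x) :=
    (integrable_map_measure (hlog b).aestronglyMeasurable hmeas.aemeasurable).2 (key b).1
  refine ⟨Measure.isProbabilityMeasure_map hmeas.aemeasurable, fun b => ?_, hint, fun b => ?_⟩
  · have := Measure.isProbabilityMeasure_map (μ := m) hmeas.aemeasurable
    exact (integrable_const (0 : ℝ)).sup (hint b)
  · rw [integral_map hmeas.aemeasurable (hlog b).aestronglyMeasurable, (key b).2]

theorem IsPotential.integral_log_sphericalDeriv (h : IsReduced d P Q) (hd : 2 ≤ d)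
    (hm : IsPotential m (fun z => green d (ratLift d P Q) (z, 1)) (green d (ratLift d P Q) (1, 0)))
    {κ : ℂ} {c : Fin (2 * d - 2) → ℂ × ℂ} (hc : IsFactorization (2 * d - 2) (wronskian Q P) κ c) :
    Integrable (fun x : ℂ => Real.log (sphericalDeriv (ratMap P Q) (x : OnePoint ℂ))) m ∧
      ∫ x : ℂ, Real.log (sphericalDeriv (ratMap P Q) (x : OnePoint ℂ)) ∂m =
        Real.log ‖κ‖ + ∑ i, green d (ratLift d P Q) (c i) -
          2 / d * Real.log ‖resultant P Q d d‖ := by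
  have := hm.isProbabilityMeasure
  have hmeas : Measurable fun x : ℂ => P.eval x / Q.eval x :=
    P.continuous.measurable.div Q.continuous.measurable
  obtain ⟨C, hF⟩ := h.exists_isHomLift hd
  have hQ := h.right_ne_zero (by omega : 0 < d)
  obtain ⟨κ', a, ha⟩ := exists_isFactorization hQ h.natDegree_right
  have hpos (x : ℂ) : 0 ≤ 1 / 2 * Real.log (1 + ‖x‖ ^ 2) :=
    mul_nonneg (by norm_num) (Real.log_nonneg (by nlinarith [norm_nonneg x]))
  have h1 := hm.hasLogPotential.integral_eq_integral hasLogPotential_fubiniStudy hpos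
  have h2 := (hm.hasLogPotential_map h hd).integral_eq_integral hasLogPotential_fubiniStudy hpos
  have hms : Measurable fun x : ℂ => 1 / 2 * Real.log (1 + ‖x‖ ^ 2) :=
    (Real.measurable_log.comp (by fun_prop)).const_mul _
  rw [integrable_map_measure hms.aestronglyMeasurable hmeas.aemeasurable,
    integral_map hmeas.aemeasurable hms.aestronglyMeasurable] at h2
  have h3 := hm.integral_log_eval hF (natDegree_wronskian_le h.natDegree_left h.natDegree_right
    (by omega)) hc
  have h4 := hm.integral_log_eval hF h.natDegree_right ha
  have h5 : (fun x : ℂ => Real.log (sphericalDeriv (ratMap P Q) (x : OnePoint ℂ))) =ᵐ[m] fun z =>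
      Real.log ‖(wronskian Q P).eval z‖ + 2 * (1 / 2 * Real.log (1 + ‖z‖ ^ 2)) -
        2 * Real.log ‖Q.eval z‖ - 2 * (1 / 2 * Real.log (1 + ‖P.eval z / Q.eval z‖ ^ 2)) := by
    filter_upwards [hm.ae_eval_ne_zero (wronskian_ne_zero h (by omega)),
      hm.ae_eval_ne_zero hQ] with x hx1 hx2
    exact log_sphericalDeriv_coe h hx1 hx2
  have i1 := h1.1.const_mul 2
  have i2 := h2.1.const_mul 2
  have i4 := h4.1.const_mul 2
  simp only [Function.comp_def] at i2
  refine ⟨(((h3.1.add i1).sub i4).sub i2).congr h5.symm, ?_⟩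
  have i5 := h3.1.add i1
  have i6 := i5.sub i4
  simp only [Pi.add_def, Pi.sub_def] at i5 i6
  rw [integral_congr_ae h5, integral_sub i6 i2, integral_sub i5 i4, integral_add h3.1 i1]
  simp only [integral_const_mul] at h1 h2 ⊢
  rw [h3.2, h4.2, ha.sum_green_right h hd]
  have hd' : ((2 * d - 2 : ℕ) : ℝ) = 2 * d - 2 := by
    rw [Nat.cast_sub (by omega)]
    push_cast
    ring
  rw [hd']
  -- The two integrals of the Fubini-Study potential, against `m` and its image under `f`, equal the
  -- same integral of the common potential against `ω`. The multiples of `G(1, 0)` cancel as well,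
  -- since `(2d - 2) + 2 (1 - d) = 0`.
  linear_combination 2 * h1.2 - 2 * h2.2

theorem isMaxEntropyMeasure_maxEntropyMeasure (h : IsReduced d P Q) (hd : 2 ≤ d) :
    IsMaxEntropyMeasure d (ratMap P Q) (maxEntropyMeasure d (ratMap P Q)) := by
  have := h.exists_isMaxEntropyMeasure hd
  rw [maxEntropyMeasure, dif_pos this]
  exact this.choose_spec

theorem IsReduced.lyapunovExponent_eq (h : IsReduced d P Q) (hd : 2 ≤ d)
    {κ : ℂ} {c : Fin (2 * d - 2) → ℂ × ℂ} (hc : IsFactorization (2 * d - 2) (wronskian Q P) κ c) :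
    Integrable (fun x => Real.log (sphericalDeriv (ratMap P Q) x))
        (maxEntropyMeasure d (ratMap P Q)) ∧
      lyapunovExponent d (ratMap P Q) =
        Real.log ‖κ‖ + ∑ i, green d (ratLift d P Q) (c i) -
          2 / d * Real.log ‖resultant P Q d d‖ := by
  have hμ := isMaxEntropyMeasure_maxEntropyMeasure h hd
  have h1 := (hμ.isPotential h hd).integral_log_sphericalDeriv h hd hc
  rw [lyapunovExponent, ← hμ.map_comap h hd]
  rw [measurableEmbedding_coe.integrable_map_iff, measurableEmbedding_coe.integral_map]
  exact h1

end Lyapunov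
/-! ### Local holomorphic lifts of a family of rational maps -/

/-- The polynomials `P s`, `Q s` form a holomorphic family of reduced fractions of degree `d`. -/
structure IsHolomorphicLift {G : Type*} [NormedAddCommGroup G] [NormedSpace ℂ G] (d : ℕ)
    (P Q : G → ℂ[X]) (S : Set G) : Prop where
  isOpen : IsOpen S
  isReduced : ∀ s ∈ S, IsReduced d (P s) (Q s)
  left : ∀ k, DifferentiableOn ℂ (fun s => (P s).coeff k) S
  right : ∀ k, DifferentiableOn ℂ (fun s => (Q s).coeff k) S

/-! ### Recovering a rational map from its values -/

section Interpolation

variable {d : ℕ} {P Q p q : ℂ[X]}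

theorem IsReduced.smul (h : IsReduced d P Q) {r : ℂ} (hr : r ≠ 0) :
    IsReduced d (C r * P) (C r * Q) := by
  have hu : IsUnit (C r) := isUnit_C.2 hr.isUnit
  refine ⟨(isCoprime_mul_unit_left hu P Q).2 h.isCoprime, ?_⟩
  rw [natDegree_C_mul hr, natDegree_C_mul hr, h.max_natDegree]

theorem ratMap_smul {r : ℂ} (hr : r ≠ 0) : ratMap (C r * P) (C r * Q) = ratMap P Q := by
  funext x
  induction x using OnePoint.rec with
  | infty => simp [ratMap, natDegree_C_mul hr, hr, mul_div_mul_left]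
  | coe z =>
    simp only [ratMap]
    simp [hr, mul_div_mul_left]

/-- A rational map of degree `d` is determined by its values at `2 d + 1` points. -/
theorem IsReduced.eq_smul_of_interpolation (h : IsReduced d P Q) (hd : 0 < d)
    (hp : p.natDegree ≤ d) (hq : q.natDegree ≤ d) (s : Finset ℂ) (hs : 2 * d < s.card) (y : ℂ → ℂ)
    (hy : ∀ x ∈ s, P.eval x = y x * Q.eval x) (hx : ∀ x ∈ s, p.eval x = y x * q.eval x) :
    ∃ r : ℂ, p = C r * P ∧ q = C r * Q := by
  have h1 : p * Q = P * q := by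
    rw [← sub_eq_zero]
    refine eq_zero_of_natDegree_lt_card_of_eval_eq_zero' _ s (fun x hxs => ?_) ?_
    · simp only [eval_sub, eval_mul, hy x hxs, hx x hxs]
      ring
    · refine lt_of_le_of_lt ((natDegree_sub_le_of_le (natDegree_mul_le_of_le hp h.natDegree_right)
        (natDegree_mul_le_of_le h.natDegree_left hq)).trans ?_) hs
      simp [two_mul]
  have hQ := h.right_ne_zero hd
  obtain ⟨r, rfl⟩ : Q ∣ q := h.isCoprime.symm.dvd_of_dvd_mul_left (Dvd.intro_left p h1)
  have h2 : p = P * r := mul_right_cancel₀ hQ (by rw [h1]; ring)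
  subst h2
  by_cases hr : r = 0
  · exact ⟨0, by simp [hr], by simp [hr]⟩
  have h3 : r.natDegree = 0 := by
    rcases max_choice P.natDegree Q.natDegree with h4 | h4
    · rw [h.max_natDegree] at h4
      have hP : P ≠ 0 := fun h0 => by simp [h0] at h4; omega
      rw [natDegree_mul hP hr] at hp
      omega
    · rw [h.max_natDegree] at h4
      rw [natDegree_mul hQ hr] at hq
      omega
  obtain ⟨c, rfl⟩ := natDegree_eq_zero.1 h3
  exact ⟨c, mul_comm _ _, mul_comm _ _⟩

/-- The polynomial with given coefficients. -/
noncomputable def polyOfCoeffs (v : Fin (d + 1) → ℂ) : ℂ[X] :=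
  ∑ k : Fin (d + 1), C (v k) * X ^ (k : ℕ)

theorem natDegree_polyOfCoeffs (v : Fin (d + 1) → ℂ) : (polyOfCoeffs v).natDegree ≤ d :=
  natDegree_sum_le_of_forall_le _ _ fun k _ => (natDegree_C_mul_X_pow_le _ _).trans (by omega)

theorem coeff_polyOfCoeffs (v : Fin (d + 1) → ℂ) (k : Fin (d + 1)) :
    (polyOfCoeffs v).coeff k = v k := by
  simp [polyOfCoeffs, coeff_X_pow, Fin.val_inj]

theorem coeff_polyOfCoeffs_of_lt (v : Fin (d + 1) → ℂ) {k : ℕ} (hk : d < k) :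
    (polyOfCoeffs v).coeff k = 0 :=
  coeff_eq_zero_of_natDegree_lt ((natDegree_polyOfCoeffs v).trans_lt hk)

theorem eval_polyOfCoeffs (v : Fin (d + 1) → ℂ) (x : ℂ) :
    (polyOfCoeffs v).eval x = ∑ k : Fin (d + 1), x ^ (k : ℕ) * v k := by
  simp only [polyOfCoeffs, eval_finsetSum, eval_mul, eval_C, eval_pow, eval_X, mul_comm]

/-- The matrix of the interpolation problem `p (x i) = y i * q (x i)` for the coefficients of
`p`, `q`, normalized by fixing the coefficient `j`. -/
noncomputable def interpMatrix (j : Fin (d + 1) ⊕ Fin (d + 1))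
    (x y : Fin (d + 1) ⊕ Fin (d + 1) → ℂ) :
    Matrix (Fin (d + 1) ⊕ Fin (d + 1)) (Fin (d + 1) ⊕ Fin (d + 1)) ℂ := fun i =>
  if i = j then Pi.single j 1
  else Sum.elim (fun k => x i ^ (k : ℕ)) (fun k => -(y i * x i ^ (k : ℕ)))

theorem interpMatrix_mulVec_self (j : Fin (d + 1) ⊕ Fin (d + 1))
    (x y v : Fin (d + 1) ⊕ Fin (d + 1) → ℂ) : (interpMatrix j x y).mulVec v j = v j := by
  simp [interpMatrix, Matrix.mulVec]

theorem interpMatrix_mulVec {i j : Fin (d + 1) ⊕ Fin (d + 1)} (hij : i ≠ j)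
    (x y v : Fin (d + 1) ⊕ Fin (d + 1) → ℂ) : (interpMatrix j x y).mulVec v i =
      (polyOfCoeffs fun k => v (Sum.inl k)).eval (x i) -
        y i * (polyOfCoeffs fun k => v (Sum.inr k)).eval (x i) := by
  simp [interpMatrix, Matrix.mulVec, dotProduct, hij, eval_polyOfCoeffs, Finset.mul_sum, mul_assoc,
    sub_eq_add_neg]

/-- Row `j` only carries the normalization; the other `2d + 1` rows are interpolation conditions,
just enough to determine the map. -/
theorem IsReduced.eq_smul_of_mulVec (h : IsReduced d P Q) (hd : 0 < d)
    {j : Fin (d + 1) ⊕ Fin (d + 1)} {x y v : Fin (d + 1) ⊕ Fin (d + 1) → ℂ}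
    (hx : Function.Injective x) (hy : ∀ i, P.eval (x i) = y i * Q.eval (x i))
    (hv : ∀ i ≠ j, (interpMatrix j x y).mulVec v i = 0) :
    ∃ r : ℂ, (polyOfCoeffs fun k => v (Sum.inl k)) = C r * P ∧
      (polyOfCoeffs fun k => v (Sum.inr k)) = C r * Q := by
  classical
  refine h.eq_smul_of_interpolation hd (natDegree_polyOfCoeffs _) (natDegree_polyOfCoeffs _)
    ((Finset.univ.erase j).image x) ?_ (fun z => y (Function.invFun x z)) ?_ ?_
  · rw [Finset.card_image_of_injective _ hx, Finset.card_erase_of_mem (Finset.mem_univ _)]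
    simp
    omega
  · intro z hz
    obtain ⟨i, _, rfl⟩ := Finset.mem_image.1 hz
    rw [Function.leftInverse_invFun hx, hy]
  · intro z hz
    obtain ⟨i, hi, rfl⟩ := Finset.mem_image.1 hz
    rw [Function.leftInverse_invFun hx, ← sub_eq_zero,
      ← interpMatrix_mulVec (Finset.ne_of_mem_erase hi), hv i (Finset.ne_of_mem_erase hi)]

/-- Take `j` to be the place of a non-zero coefficient of `(P, Q)`. A kernel vector is a multiple `r
(P, Q)` whose entry at `j` vanishes, so `r = 0`. -/
theorem IsReduced.exists_det_interpMatrix_ne_zero (h : IsReduced d P Q) (hd : 0 < d) :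
    ∃ j : Fin (d + 1) ⊕ Fin (d + 1), ∀ x y, Function.Injective x →
      (∀ i, P.eval (x i) = y i * Q.eval (x i)) → (interpMatrix j x y).det ≠ 0 := by
  have h1 : ∃ j : Fin (d + 1) ⊕ Fin (d + 1),
      Sum.elim (fun k : Fin (d + 1) => P.coeff k) (fun k : Fin (d + 1) => Q.coeff k) j ≠ 0 := by
    rcases h.coeff_ne_zero hd with h1 | h1
    · exact ⟨Sum.inl (Fin.last d), by simpa using h1⟩
    · exact ⟨Sum.inr (Fin.last d), by simpa using h1⟩
  obtain ⟨j, hj⟩ := h1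
  refine ⟨j, fun x y hx hy h0 => ?_⟩
  obtain ⟨v, hv, hv0⟩ := Matrix.exists_mulVec_eq_zero_iff.2 h0
  obtain ⟨r, hr1, hr2⟩ := h.eq_smul_of_mulVec hd hx hy (j := j) (v := v) fun i _ => by rw [hv0]; rfl
  have hl : ∀ k, v (Sum.inl k) = r * P.coeff k := fun k => by
    rw [← coeff_C_mul, ← hr1, coeff_polyOfCoeffs]
  have hr : ∀ k, v (Sum.inr k) = r * Q.coeff k := fun k => by
    rw [← coeff_C_mul, ← hr2, coeff_polyOfCoeffs]
  have h2 : v j = 0 := by rw [← interpMatrix_mulVec_self j x y v, hv0]; rfl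
  have h3 : r = 0 := by
    rcases j with k | k
    · rw [hl] at h2
      exact (mul_eq_zero.1 h2).resolve_right hj
    · rw [hr] at h2
      exact (mul_eq_zero.1 h2).resolve_right hj
  refine hv (funext fun i => ?_)
  rcases i with k | k
  · simp [hl, h3]
  · simp [hr, h3]

end Interpolation
-- Lifting the family by Cramer's rule
section LocalLift

variable {E : Type*} [NormedAddCommGroup E] [NormedSpace ℂ E] {M : Type*} [TopologicalSpace M]
  [ChartedSpace E M] {G : Type*} [NormedAddCommGroup G] [NormedSpace ℂ G] {d : ℕ}
  {f : M → RiemannSphere → RiemannSphere}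

theorem differentiableAt_chartZero {F : G → RiemannSphere} {s : G}
    (hF : MDifferentiableAt 𝓘(ℂ, G) 𝓘(ℂ) F s) (hs : F s ≠ OnePoint.infty) :
    DifferentiableAt ℂ (fun t => RiemannSphere.chartZero (F t)) s := by
  rw [← mdifferentiableAt_iff_differentiableAt]
  refine MDifferentiableAt.comp (I' := 𝓘(ℂ)) s
    (mdifferentiableAt_atlas (I := 𝓘(ℂ)) (e := RiemannSphere.chartZero) (x := F s) ?_ ?_) hF
  · exact Or.inl rfl
  · rw [RiemannSphere.chartZero_source]
    exact hs

theorem _root_.IsHolomorphicFamily.mdifferentiableAt_eval (hf : IsHolomorphicFamily (E := E) d f)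
    {u : G → M} {s : G} (hu : MDifferentiableAt 𝓘(ℂ, G) 𝓘(ℂ, E) u s) (x : RiemannSphere) :
    MDifferentiableAt 𝓘(ℂ, G) 𝓘(ℂ) (fun s => f (u s) x) s :=
  (hf.holomorphic (u s, x)).comp s (hu.prodMk mdifferentiableAt_const)

theorem eval_eq_chartZero_mul {P Q : ℂ[X]} {x : ℂ}
    (h : ratMap P Q (x : OnePoint ℂ) ≠ OnePoint.infty) :
    P.eval x = RiemannSphere.chartZero (ratMap P Q (x : OnePoint ℂ)) * Q.eval x := by
  by_cases hQ : Q.eval x = 0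
  · exact absurd (if_pos hQ) h
  · have : ratMap P Q (x : OnePoint ℂ) = ((P.eval x / Q.eval x : ℂ) : OnePoint ℂ) := if_neg hQ
    rw [this, RiemannSphere.chartZero_coe, div_mul_cancel₀ _ hQ]

theorem differentiableAt_interpMatrix (j : Fin (d + 1) ⊕ Fin (d + 1))
    (x : Fin (d + 1) ⊕ Fin (d + 1) → ℂ) {y : G → Fin (d + 1) ⊕ Fin (d + 1) → ℂ} {s : G}
    (hy : ∀ i, DifferentiableAt ℂ (fun s => y s i) s) (i k : Fin (d + 1) ⊕ Fin (d + 1)) :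
    DifferentiableAt ℂ (fun s => interpMatrix j x (y s) i k) s := by
  by_cases hij : i = j
  · simp [interpMatrix, hij]
  · rcases k with k | k
    · simp [interpMatrix, hij]
    · simpa [interpMatrix, hij] using (hy i).mul_const _

theorem differentiableAt_det {ι : Type*} [Fintype ι] [DecidableEq ι] {A : G → Matrix ι ι ℂ} {s : G}
    (hA : ∀ i k, DifferentiableAt ℂ (fun s => A s i k) s) :
    DifferentiableAt ℂ (fun s => (A s).det) s := by
  simp only [Matrix.det_apply]
  refine DifferentiableAt.fun_sum fun σ _ => DifferentiableAt.const_smul ?_ _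
  have := HasFDerivAt.finsetProd (u := Finset.univ) fun i _ => (hA (σ i) i).hasFDerivAt
  exact (this.congr_of_eventuallyEq (Eventually.of_forall fun s => by simp)).differentiableAt

/-- Locally, a holomorphic family of rational maps is given by polynomials whose coefficients
depend holomorphically on the parameter. -/
theorem exists_isHolomorphicLift (hf : IsHolomorphicFamily (E := E) d f) (hd : 0 < d)
    {u : G → M} {S : Set G} (hS : IsOpen S) (hu : MDifferentiableOn 𝓘(ℂ, G) 𝓘(ℂ, E) u S) {s₀ : G}
    (hs₀ : s₀ ∈ S) :
    ∃ P Q S', IsHolomorphicLift d P Q S' ∧ s₀ ∈ S' ∧ S' ⊆ S ∧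
      ∀ s ∈ S', f (u s) = ratMap (P s) (Q s) := by
  have hu' : ∀ s ∈ S, MDifferentiableAt 𝓘(ℂ, G) 𝓘(ℂ, E) u s := fun s hs =>
    (hu s hs).mdifferentiableAt (hS.mem_nhds hs)
  obtain ⟨P₀, Q₀, hcop, hdeg, hf₀⟩ := hf.isRationalMap (u s₀)
  have h₀ : IsReduced d P₀ Q₀ := ⟨hcop, hdeg⟩
  have hinf : ({z : ℂ | Q₀.eval z ≠ 0} : Set ℂ).Infinite :=
    (Polynomial.finite_setOfPred_isRoot (h₀.right_ne_zero hd)).infinite_compl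
  obtain ⟨j, hj⟩ := h₀.exists_det_interpMatrix_ne_zero hd
  -- The nodes are distinct points where the map at `s₀` is finite; by continuity it stays finite
  -- there for nearby parameters.
  let x : Fin (d + 1) ⊕ Fin (d + 1) → ℂ := fun i => hinf.natEmbedding _ (Fintype.equivFin _ i : ℕ)
  have hx : Function.Injective x := fun i k hik => by
    have := (hinf.natEmbedding _).injective (Subtype.ext hik)
    exact (Fintype.equivFin _).injective (Fin.ext this)
  have hxQ : ∀ i, Q₀.eval (x i) ≠ 0 := fun i => (hinf.natEmbedding _ _).2
  clear_value x
  let F : G → Fin (d + 1) ⊕ Fin (d + 1) → RiemannSphere := fun s i => f (u s) (x i : OnePoint ℂ)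
  let y : G → Fin (d + 1) ⊕ Fin (d + 1) → ℂ := fun s i => RiemannSphere.chartZero (F s i)
  have hF : ∀ s ∈ S, ∀ i, MDifferentiableAt 𝓘(ℂ, G) 𝓘(ℂ) (fun s => F s i) s := fun s hs i =>
    hf.mdifferentiableAt_eval (hu' s hs) _
  let S₁ : Set G := {s | s ∈ S ∧ ∀ i, F s i ≠ OnePoint.infty}
  have hS₁ : IsOpen S₁ := by
    rw [isOpen_iff_mem_nhds]
    rintro s ⟨hs, hs'⟩
    refine inter_mem (hS.mem_nhds hs) (eventually_all.2 fun i => ?_)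
    exact (hF s hs i).continuousAt.eventually_ne (hs' i)
  have hy : ∀ s ∈ S₁, ∀ i, DifferentiableAt ℂ (fun s => y s i) s := fun s hs i =>
    differentiableAt_chartZero (hF s hs.1 i) (hs.2 i)
  have hA : ∀ s ∈ S₁, ∀ i k, DifferentiableAt ℂ (fun s => interpMatrix j x (y s) i k) s :=
    fun s hs => differentiableAt_interpMatrix j x (hy s hs)
  have hyP : ∀ s ∈ S₁, ∀ P' Q', f (u s) = ratMap P' Q' → ∀ i,
      P'.eval (x i) = y s i * Q'.eval (x i) := by
    intro s hs P' Q' h i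
    have := hs.2 i
    simp only [F, h] at this
    simp only [y, F, h]
    exact eval_eq_chartZero_mul this
  let S₂ : Set G := {s | s ∈ S₁ ∧ (interpMatrix j x (y s)).det ≠ 0}
  have hS₂ : IsOpen S₂ := by
    rw [isOpen_iff_mem_nhds]
    rintro s ⟨hs, hs'⟩
    exact inter_mem (hS₁.mem_nhds hs)
      ((differentiableAt_det (hA s hs)).continuousAt.eventually_ne hs')
  have hs₁ : s₀ ∈ S₁ := by
    refine ⟨hs₀, fun i => ?_⟩
    simp only [F, hf₀]
    rw [show ratMap P₀ Q₀ (x i : OnePoint ℂ) = _ from if_neg (hxQ i)]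
    exact OnePoint.coe_ne_infty _
  have hs₂ : s₀ ∈ S₂ := ⟨hs₁, hj x (y s₀) hx (hyP s₀ hs₁ _ _ hf₀)⟩
  -- Cramer's vector solves the system with right-hand side `det · e_j`. It is polynomial in the
  -- matrix entries, so holomorphic in `s` without division.
  let v : G → Fin (d + 1) ⊕ Fin (d + 1) → ℂ := fun s =>
    Matrix.cramer (interpMatrix j x (y s)) (Pi.single j 1)
  have hv : ∀ s ∈ S₁, ∀ i, DifferentiableAt ℂ (fun s => v s i) s := by
    intro s hs i
    simp only [v, Matrix.cramer_apply]
    refine differentiableAt_det fun a b => ?_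
    by_cases hb : b = i
    · simp [hb]
    · simpa [hb] using hA s hs a b
  have hcoeff : ∀ (e : Fin (d + 1) → Fin (d + 1) ⊕ Fin (d + 1)) (k : ℕ),
      DifferentiableOn ℂ (fun s => (polyOfCoeffs fun k => v s (e k)).coeff k) S₂ := by
    intro e k s hs
    refine DifferentiableAt.differentiableWithinAt ?_
    rcases Nat.lt_or_ge d k with hk | hk
    · simp [coeff_polyOfCoeffs_of_lt _ hk]
    · lift k to Fin (d + 1) using Nat.lt_succ_of_le hk
      simpa only [coeff_polyOfCoeffs] using hv s hs.1 (e k)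
  have key : ∀ s ∈ S₂, ∃ P' Q' r, r ≠ 0 ∧ IsReduced d P' Q' ∧ f (u s) = ratMap P' Q' ∧
      (polyOfCoeffs fun k => v s (Sum.inl k)) = C r * P' ∧
      (polyOfCoeffs fun k => v s (Sum.inr k)) = C r * Q' := by
    intro s hs
    obtain ⟨P', Q', hcop, hdeg, hf'⟩ := hf.isRationalMap (u s)
    have h' : IsReduced d P' Q' := ⟨hcop, hdeg⟩
    have hmul := Matrix.mulVec_cramer (interpMatrix j x (y s)) (Pi.single j 1)
    obtain ⟨r, hr1, hr2⟩ := h'.eq_smul_of_mulVec hd hx (hyP s hs.1 _ _ hf') (j := j) (v := v s)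
      fun i hi => by simp [v, hmul, hi]
    refine ⟨P', Q', r, fun h0 => hs.2 ?_, h', hf', hr1, hr2⟩
    -- The normalized entry is the determinant itself, so a non-zero determinant rules out `r = 0`.
    have h1 : v s j = (interpMatrix j x (y s)).det := by
      rw [← interpMatrix_mulVec_self j x (y s) (v s), hmul]
      simp
    rw [← h1]
    subst h0
    simp only [C_0, zero_mul] at hr1 hr2
    rcases j with k | k
    · rw [← coeff_polyOfCoeffs (fun k => v s (Sum.inl k)), hr1, coeff_zero]
    · rw [← coeff_polyOfCoeffs (fun k => v s (Sum.inr k)), hr2, coeff_zero]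
  refine ⟨_, _, S₂, ⟨hS₂, fun s hs => ?_, hcoeff Sum.inl, hcoeff Sum.inr⟩, hs₂,
    fun s hs => hs.1.1, fun s hs => ?_⟩
  · obtain ⟨P', Q', r, hr, h', -, h1, h2⟩ := key s hs
    rw [h1, h2]
    exact h'.smul hr
  · obtain ⟨P', Q', r, hr, -, h', h1, h2⟩ := key s hs
    rw [h1, h2, ratMap_smul hr, h']

end LocalLift
/-! ### Hölder dependence of sums over the roots of a form -/

theorem exists_wedge_eq_one (a : ℂ × ℂ) (ha : ‖a‖ = 1) :
    ∃ w : ℂ × ℂ, ‖w‖ = 1 ∧ ‖wedge w a‖ = 1 := by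
  rcases max_choice ‖a.1‖ ‖a.2‖ with h | h
  · refine ⟨(0, 1), by simp, ?_⟩
    rw [← Prod.norm_def, ha] at h
    simpa [wedge] using h.symm
  · refine ⟨(1, 0), by simp, ?_⟩
    rw [← Prod.norm_def, ha] at h
    simpa [wedge] using h.symm

/-- Choose `u` to match the coordinate where `a` has modulus one; the other coordinate of `b - u a`
is then the wedge up to a factor of modulus one. -/
theorem exists_norm_sub_smul_le (a b : ℂ × ℂ) (ha : ‖a‖ = 1) (hb : ‖b‖ = 1) :
    ∃ u : ℂ, ‖u‖ ≤ 1 ∧ ‖b - u • a‖ ≤ ‖wedge a b‖ := by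
  rcases max_choice ‖a.1‖ ‖a.2‖ with h | h
  · rw [← Prod.norm_def, ha] at h
    have h0 : a.1 ≠ 0 := norm_ne_zero_iff.1 (by rw [← h]; exact one_ne_zero)
    refine ⟨b.1 / a.1, ?_, ?_⟩
    · rw [norm_div, ← h, div_one, ← hb]
      exact norm_fst_le b
    · have h1 : b - (b.1 / a.1) • a = (0, wedge a b / a.1) := by
        ext
        · simp [h0]
        · simp [wedge]
          field_simp
      rw [h1]
      simp [← h]
  · rw [← Prod.norm_def, ha] at h
    have h0 : a.2 ≠ 0 := norm_ne_zero_iff.1 (by rw [← h]; exact one_ne_zero)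
    refine ⟨b.2 / a.2, ?_, ?_⟩
    · rw [norm_div, ← h, div_one, ← hb]
      exact norm_snd_le b
    · have h1 : b - (b.2 / a.2) • a = (-wedge a b / a.2, 0) := by
        ext
        · simp [wedge]
          field_simp
        · simp [h0]
      rw [h1]
      simp [← h]

theorem norm_prod_wedge_le {m : ℕ} (v : ℂ × ℂ) {b : Fin m → ℂ × ℂ} (hb : ∀ i, ‖b i‖ = 1) :
    ‖∏ i, wedge v (b i)‖ ≤ 2 ^ m * ‖v‖ ^ m := by
  rw [norm_prod, ← mul_pow]
  calc ∏ i, ‖wedge v (b i)‖ ≤ ∏ _i : Fin m, 2 * ‖v‖ :=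
        Finset.prod_le_prod (fun _ _ => norm_nonneg _) fun i _ => by
          simpa [hb] using norm_wedge_le v (b i)
    _ = (2 * ‖v‖) ^ m := by simp

/-- Division of a small form by a linear factor. -/
theorem norm_sub_le_of_norm_wedge_mul_sub_le {m : ℕ} {κ κ' : ℂ} {a : ℂ × ℂ} (ha : ‖a‖ = 1)
    {a' b' : Fin m → ℂ × ℂ} {ε : ℝ} (hε : 0 ≤ ε)
    (h : ∀ v, ‖wedge v a * (κ * ∏ i, wedge v (a' i) - κ' * ∏ i, wedge v (b' i))‖ ≤
      ε * ‖v‖ ^ (m + 1)) (v : ℂ × ℂ) :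
    ‖κ * ∏ i, wedge v (a' i) - κ' * ∏ i, wedge v (b' i)‖ ≤ 2 ^ (m + 2) * ε * ‖v‖ ^ m := by
  have key : ∀ v, ‖v‖ = 1 →
      ‖κ * ∏ i, wedge v (a' i) - κ' * ∏ i, wedge v (b' i)‖ ≤ 2 ^ (m + 2) * ε := by
    intro v hv
    by_cases hva : 1 / 2 ≤ ‖wedge v a‖
    · have h1 := h v
      rw [hv, one_pow, mul_one, norm_mul] at h1
      have h2 : (2 : ℝ) * ε ≤ 2 ^ (m + 2) * ε := by
        have : (1 : ℝ) ≤ 2 ^ m := one_le_pow₀ one_le_two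
        rw [pow_add]
        nlinarith
      nlinarith [norm_nonneg (κ * ∏ i, wedge v (a' i) - κ' * ∏ i, wedge v (b' i))]
    -- Near the zero of the linear factor the quotient is bounded by the maximum principle on the
    -- complex line `v + z w`: for `|z| = 1` the factor has modulus at least `1/2` and the vector
    -- has norm at most `2`.
    · obtain ⟨w, hw, hwa⟩ := exists_wedge_eq_one a ha
      let g : ℂ → ℂ := fun z => κ * ∏ i, wedge (v + z • w) (a' i) - κ' * ∏ i, wedge (v + z • w) (b' i)
      have hg : Differentiable ℂ g := by
        simp only [g, wedge, Prod.fst_add, Prod.snd_add, Prod.smul_fst, Prod.smul_snd, smul_eq_mul]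
        refine ((Differentiable.const_mul ?_ _).sub (Differentiable.const_mul ?_ _))
        · exact Differentiable.fun_finsetProd fun i _ => by fun_prop
        · exact Differentiable.fun_finsetProd fun i _ => by fun_prop
      have h0 : ‖g 0‖ ≤ 2 ^ (m + 2) * ε := by
        refine Complex.norm_le_of_forall_mem_frontier_norm_le (U := Metric.ball 0 1)
          Metric.isBounded_ball hg.diffContOnCl (fun z hz => ?_)
          (subset_closure (Metric.mem_ball_self one_pos))
        rw [frontier_ball _ one_ne_zero, mem_sphere_zero_iff_norm] at hz
        have h1 := h (v + z • w)
        have h2 : ‖v + z • w‖ ≤ 2 := by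
          refine (norm_add_le _ _).trans ?_
          rw [norm_smul, hz, hw, hv]
          norm_num
        have h3 : 1 / 2 ≤ ‖wedge (v + z • w) a‖ := by
          have h4 : wedge (v + z • w) a = z * wedge w a + wedge v a := by
            simp only [wedge, Prod.fst_add, Prod.snd_add, Prod.smul_fst, Prod.smul_snd, smul_eq_mul]
            ring
          have h5 := norm_sub_le_norm_add (z * wedge w a) (wedge v a)
          rw [norm_mul, hz, hwa] at h5
          rw [h4]
          linarith
        have h6 : ε * ‖v + z • w‖ ^ (m + 1) ≤ ε * 2 ^ (m + 1) := by gcongr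
        rw [norm_mul] at h1
        change 1 / 2 ≤ _ at h3
        have h7 := mul_le_mul_of_nonneg_right h3 (norm_nonneg (g z))
        have h8 : (2 : ℝ) ^ (m + 2) * ε = 2 * (ε * 2 ^ (m + 1)) := by ring
        rw [h8]
        change ‖wedge (v + z • w) a‖ * ‖g z‖ ≤ _ at h1
        linarith
      simpa [g] using h0
  by_cases hv : v = 0
  · subst hv
    rcases Nat.eq_zero_or_pos m with rfl | hm
    · have := key (1, 0) (by simp)
      simpa using this
    · have : Nonempty (Fin m) := ⟨⟨0, hm⟩⟩
      have h1 : ∀ c : Fin m → ℂ × ℂ, ∏ i, wedge (0 : ℂ × ℂ) (c i) = 0 := fun c => by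
        simp [wedge, hm.ne']
      simp [h1, hm.ne']
  · have hv0 := norm_ne_zero_iff.2 hv
    have hv1 : ‖((‖v‖ : ℂ)⁻¹) • v‖ = 1 := by
      rw [norm_smul, norm_inv, Complex.norm_real, norm_norm, inv_mul_cancel₀ hv0]
    have h1 := key _ hv1
    simp only [wedge_smul_left, Finset.prod_mul_distrib, Finset.prod_const, Finset.card_univ,
      Fintype.card_fin] at h1
    rw [mul_left_comm κ, mul_left_comm κ', ← mul_sub, norm_mul, norm_pow, norm_inv,
      Complex.norm_real, norm_norm, inv_pow, ← div_eq_inv_mul, div_le_iff₀ (by positivity)] at h1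
    exact h1
/-- A function on `ℂ² ∖ 0` which is logarithmically homogeneous and Hölder continuous on the
unit sphere. -/
structure IsLogHolder (φ : ℂ × ℂ → ℝ) (A α : ℝ) : Prop where
  smul : ∀ (c : ℂ) (v : ℂ × ℂ), c ≠ 0 → v ≠ 0 → φ (c • v) = Real.log ‖c‖ + φ v
  holder : ∀ v w : ℂ × ℂ, ‖v‖ = 1 → ‖w‖ = 1 → |φ v - φ w| ≤ A * ‖v - w‖ ^ α

theorem exists_le_rpow_of_prod_le {m : ℕ} {x : Fin (m + 1) → ℝ} (hx : ∀ i, 0 ≤ x i) {y : ℝ}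
    (h : ∏ i, x i ≤ y) : ∃ i, x i ≤ y ^ (((m + 1 : ℕ) : ℝ)⁻¹) := by
  obtain ⟨i, hi⟩ := Finite.exists_min x
  refine ⟨i, ?_⟩
  have h1 : x i ^ (m + 1) ≤ ∏ j, x j := by
    calc x i ^ (m + 1) = ∏ _j : Fin (m + 1), x i := by simp
      _ ≤ ∏ j, x j := Finset.prod_le_prod (fun _ _ => hx i) fun j _ => hi j
  rw [← Real.pow_rpow_inv_natCast (hx i) (Nat.succ_ne_zero m)]
  exact Real.rpow_le_rpow (pow_nonneg (hx i) _) (h1.trans h) (by positivity)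

/-- Here `|u|` is close to `1`. The unit vector `(u / |u|) a` has the same `φ` as `a` and lies
within `2δ` of `b`, and `log |u|` costs another `2δ`. -/
theorem IsLogHolder.abs_log_add_sub_le {φ : ℂ × ℂ → ℝ} {A α : ℝ} (h : IsLogHolder φ A α)
    (hA : 0 ≤ A) (hα : 0 < α) {a b : ℂ × ℂ} (ha : ‖a‖ = 1) (hb : ‖b‖ = 1) {u : ℂ} {δ : ℝ}
    (hu : ‖u‖ ≤ 1) (hδ : δ ≤ 1 / 2) (hab : ‖b - u • a‖ ≤ δ) :
    1 - δ ≤ ‖u‖ ∧ |Real.log ‖u‖ + φ a - φ b| ≤ A * (2 * δ) ^ α + 2 * δ := by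
  have hu1 : 1 - δ ≤ ‖u‖ := by
    have := norm_sub_norm_le b (u • a)
    rw [norm_smul, ha, hb, mul_one] at this
    linarith
  have hu0 : 0 < ‖u‖ := by linarith
  have huc : (‖u‖ : ℂ) ≠ 0 := by exact_mod_cast hu0.ne'
  refine ⟨hu1, ?_⟩
  set u' : ℂ := (‖u‖ : ℂ)⁻¹ * u with hu'
  have hu'1 : ‖u'‖ = 1 := by
    rw [hu', norm_mul, norm_inv, Complex.norm_real, norm_norm, inv_mul_cancel₀ hu0.ne']
  have ha0 : a ≠ 0 := norm_ne_zero_iff.1 (by rw [ha]; exact one_ne_zero)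
  have h1 : φ (u' • a) = φ a := by
    rw [h.smul u' a (norm_ne_zero_iff.1 (by rw [hu'1]; exact one_ne_zero)) ha0, hu'1,
      Real.log_one, zero_add]
  have h2 : ‖u' • a - b‖ ≤ 2 * δ := by
    have h3 : u' • a - b = (u' - u) • a - (b - u • a) := by
      rw [sub_smul]
      abel
    have h4 : u' - u = (1 - (‖u‖ : ℂ)) * u' := by
      rw [hu']
      field_simp
    have h5 : ‖u' - u‖ = 1 - ‖u‖ := by
      rw [h4, norm_mul, hu'1, mul_one, ← Complex.ofReal_one, ← Complex.ofReal_sub,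
        Complex.norm_real, Real.norm_of_nonneg (by linarith)]
    rw [h3]
    refine (norm_sub_le _ _).trans ?_
    rw [norm_smul, ha, h5]
    linarith
  have h3 := h.holder (u' • a) b (by rw [norm_smul, hu'1, ha, one_mul]) hb
  rw [h1] at h3
  have h4 : A * ‖u' • a - b‖ ^ α ≤ A * (2 * δ) ^ α := by gcongr
  have h5 : |Real.log ‖u‖| ≤ 2 * δ := by
    have h6 : Real.log ‖u‖ ≤ 0 := Real.log_nonpos hu0.le hu
    have h7 := Real.one_sub_inv_le_log_of_pos hu0
    rw [abs_of_nonpos h6]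
    have h8 : ‖u‖⁻¹ ≤ 1 + 2 * δ := by
      rw [inv_le_iff_one_le_mul₀ hu0]
      have : 0 ≤ δ := (norm_nonneg _).trans hab
      nlinarith
    linarith
  calc |Real.log ‖u‖ + φ a - φ b| = |Real.log ‖u‖ + (φ a - φ b)| := by ring_nf
    _ ≤ |Real.log ‖u‖| + |φ a - φ b| := abs_add_le _ _
    _ ≤ A * (2 * δ) ^ α + 2 * δ := by linarith

set_option maxHeartbeats 800000 in
/-- The logarithm of the leading constant of a form plus the sum of a logarithmically homogeneous
Hölder function over its roots depends on the form in a Hölder way. -/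
theorem exists_abs_sum_roots_sub_le {A α : ℝ} (hA : 0 ≤ A) (hα : 0 < α) (hα1 : α ≤ 1) (m : ℕ) :
    ∀ B : ℝ, 1 ≤ B → ∃ β ε₀ K : ℝ, 0 < β ∧ β ≤ 1 ∧ 0 < ε₀ ∧ ε₀ ≤ 1 ∧ 0 ≤ K ∧
      ∀ φ, IsLogHolder φ A α → ∀ (κ κ' : ℂ) (a b : Fin m → ℂ × ℂ), (∀ i, ‖a i‖ = 1) →
        (∀ i, ‖b i‖ = 1) → B⁻¹ ≤ ‖κ‖ → ‖κ‖ ≤ B → B⁻¹ ≤ ‖κ'‖ → ‖κ'‖ ≤ B → ∀ ε, 0 ≤ ε → ε ≤ ε₀ →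
        (∀ v, ‖κ * ∏ i, wedge v (a i) - κ' * ∏ i, wedge v (b i)‖ ≤ ε * ‖v‖ ^ m) →
        |Real.log ‖κ‖ + ∑ i, φ (a i) - (Real.log ‖κ'‖ + ∑ i, φ (b i))| ≤ K * ε ^ β := by
  induction m with
  | zero =>
    intro B hB
    refine ⟨1, 1, B, one_pos, le_rfl, one_pos, le_rfl, by positivity, ?_⟩
    intro φ hφ κ κ' a b ha hb hκ1 hκ2 hκ'1 hκ'2 ε hε hε0 h
    have h1 := h 0
    simp only [Finset.univ_eq_empty, Finset.prod_empty, mul_one, pow_zero] at h1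
    simp only [Finset.univ_eq_empty, Finset.sum_empty, add_zero, Real.rpow_one]
    have h2 : |‖κ‖ - ‖κ'‖| ≤ ε := (abs_norm_sub_norm_le κ κ').trans h1
    have hB0 : (0 : ℝ) < B⁻¹ := by positivity
    refine (abs_log_sub_log_le hB0 hκ1 hκ'1).trans ?_
    rw [_root_.inv_inv]
    gcongr
  | succ m ih =>
    intro B hB
    -- The induction removes one root from each form and replaces `κ'` by `κ' u` with `1/2 ≤ |u| ≤
    -- 1`, hence the bound `2 B`.
    obtain ⟨β, ε₀, K, hβ, hβ1, hε₀, hε₀1, hK, ih⟩ := ih (2 * B) (by linarith)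
    -- If a product of `m + 1` distances is of order `ε`, the least distance is of order
    -- `ε^(1/(m+1))`.
    set γ : ℝ := (((m + 1 : ℕ) : ℝ)⁻¹) with hγ
    have hm1 : (1 : ℝ) ≤ ((m + 1 : ℕ) : ℝ) := by
      push_cast
      linarith [(Nat.cast_nonneg m : (0 : ℝ) ≤ m)]
    have hγ0 : 0 < γ := by positivity
    have hγ1 : γ ≤ 1 := inv_le_one_of_one_le₀ hm1
    -- The factor `2^(m+2)` is the cost of dividing by a linear factor; the other one collects the
    -- initial error and that of moving the root.
    set L : ℝ := 2 ^ (m + 2) * (1 + 2 ^ (m + 1) * B ^ 2) with hL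
    have hL1 : 1 ≤ L := by
      have h1 : (1 : ℝ) ≤ 2 ^ (m + 2) := one_le_pow₀ one_le_two
      have h2 : (0 : ℝ) ≤ 2 ^ (m + 1) * B ^ 2 := by positivity
      nlinarith
    -- The threshold ensures, for `x = ε^γ`, both `L x ≤ ε₀` for the induction hypothesis and `B x ≤
    -- 1/2` for the comparison of the two roots.
    set η : ℝ := min (ε₀ / L) (1 / (2 * B)) with hη
    have hη0 : 0 < η := by positivity
    have hη1 : η ≤ 1 := (min_le_right _ _).trans (by
      rw [div_le_one (by positivity)]
      linarith)
    refine ⟨γ * (α * β), η ^ (m + 1), K * L + 2 * A * B + 2 * B, by positivity,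
      mul_le_one₀ hγ1 (by positivity) (mul_le_one₀ hα1 hβ.le hβ1), by positivity,
      pow_le_one₀ hη0.le hη1, by positivity, ?_⟩
    intro φ hφ κ κ' a b ha hb hκ1 hκ2 hκ'1 hκ'2 ε hε hεη h
    have hB0 : 0 < B := by linarith
    set x : ℝ := ε ^ γ with hx
    have hx0 : 0 ≤ x := Real.rpow_nonneg hε _
    have hxη : x ≤ η := by
      have := Real.rpow_le_rpow hε hεη hγ0.le
      rwa [Real.pow_rpow_inv_natCast hη0.le (Nat.succ_ne_zero m)] at this
    have hx1 : x ≤ 1 := hxη.trans hη1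
    have hε1 : ε ≤ 1 := hεη.trans (pow_le_one₀ hη0.le hη1)
    have hεx : ε ≤ x := by
      have := Real.rpow_le_rpow_of_exponent_ge' hε hε1 hγ0.le hγ1
      rwa [Real.rpow_one] at this
    have hxL : L * x ≤ ε₀ := by
      have := hxη.trans (min_le_left _ _)
      rw [le_div_iff₀ (by positivity)] at this
      linarith
    have hxB : B * x ≤ 1 / 2 := by
      have := hxη.trans (min_le_right _ _)
      rw [le_div_iff₀ (by positivity)] at this
      linarith
    -- a root of the second form close to the first root of the first one
    obtain ⟨j, hj⟩ : ∃ j, ‖wedge (a 0) (b j)‖ ≤ B * x := by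
      have h1 := h (a 0)
      rw [ha, one_pow, mul_one, Finset.prod_eq_zero (Finset.mem_univ 0), mul_zero, zero_sub,
        norm_neg, norm_mul, norm_prod] at h1
      · have h2 : ∏ i, ‖wedge (a 0) (b i)‖ ≤ B * ε := by
          have h3 : 0 ≤ ∏ i, ‖wedge (a 0) (b i)‖ := Finset.prod_nonneg fun _ _ => norm_nonneg _
          have h4 := mul_le_mul_of_nonneg_right hκ'1 h3
          rw [← div_le_iff₀' hB0, div_eq_inv_mul]
          exact h4.trans h1
        obtain ⟨j, hj⟩ := exists_le_rpow_of_prod_le (fun i => norm_nonneg _) h2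
        refine ⟨j, hj.trans ?_⟩
        rw [Real.mul_rpow hB0.le hε]
        gcongr
        exact Real.rpow_le_self_of_one_le hB hγ1
      · simp [wedge, mul_comm]
    obtain ⟨u, hu, hbu⟩ := exists_norm_sub_smul_le (a 0) (b j) (ha 0) (hb j)
    obtain ⟨hu1, hφu⟩ := hφ.abs_log_add_sub_le hA hα (ha 0) (hb j) hu hxB (hbu.trans hj)
    have hu2 : 1 / 2 ≤ ‖u‖ := by linarith
    set a' : Fin m → ℂ × ℂ := fun i => a i.succ with ha'
    set b' : Fin m → ℂ × ℂ := fun i => b (j.succAbove i) with hb'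
    -- Replacing the factor of `b j` by that of `u • a 0` costs at most `2^(m+1) B (B x) ‖v‖^(m+1)`
    -- and makes the factor of `a 0` common to both forms.
    have hdiv : ∀ v, ‖wedge v (a 0) * (κ * ∏ i, wedge v (a' i) -
        (κ' * u) * ∏ i, wedge v (b' i))‖ ≤ (ε + 2 ^ (m + 1) * B * (B * x)) * ‖v‖ ^ (m + 1) := by
      intro v
      have h1 := h v
      rw [Fin.prod_univ_succ, Fin.prod_univ_succAbove _ j] at h1
      have h2 : wedge v (a 0) * (κ * ∏ i, wedge v (a' i) - (κ' * u) * ∏ i, wedge v (b' i)) =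
          (κ * (wedge v (a 0) * ∏ i, wedge v (a' i)) - κ' * (wedge v (b j) * ∏ i, wedge v (b' i))) +
            κ' * (wedge v (b j - u • a 0) * ∏ i, wedge v (b' i)) := by
        simp only [wedge, Prod.fst_sub, Prod.snd_sub, Prod.smul_fst, Prod.smul_snd, smul_eq_mul]
        ring
      have h3 := norm_prod_wedge_le v (b := b') fun i => hb _
      have h4 := norm_wedge_le v (b j - u • a 0)
      have h5 := hbu.trans hj
      have h6 : ‖κ' * (wedge v (b j - u • a 0) * ∏ i, wedge v (b' i))‖ ≤
          B * ((2 * ‖v‖ * (B * x)) * (2 ^ m * ‖v‖ ^ m)) := by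
        rw [norm_mul, norm_mul]
        gcongr
        exact h4.trans (by gcongr)
      rw [h2]
      refine (norm_add_le _ _).trans ((add_le_add h1 h6).trans_eq ?_)
      ring
    have hκu1 : (2 * B)⁻¹ ≤ ‖κ' * u‖ := by
      rw [mul_inv, norm_mul, mul_comm]
      exact mul_le_mul hκ'1 (by linarith) (by positivity) (norm_nonneg _)
    have hκu2 : ‖κ' * u‖ ≤ 2 * B := by
      rw [norm_mul]
      exact (mul_le_of_le_one_right (norm_nonneg _) hu).trans (by linarith)
    have hκ3 : (2 * B)⁻¹ ≤ ‖κ‖ := (inv_anti₀ hB0 (by linarith)).trans hκ1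
    have hεL : 2 ^ (m + 2) * (ε + 2 ^ (m + 1) * B * (B * x)) ≤ L * x := by
      have : 2 ^ (m + 2) * (ε + 2 ^ (m + 1) * B * (B * x)) ≤
          2 ^ (m + 2) * (x + 2 ^ (m + 1) * B * (B * x)) := by gcongr
      refine this.trans_eq ?_
      rw [hL]
      ring
    have hε' : 0 ≤ ε + 2 ^ (m + 1) * B * (B * x) := by positivity
    have h1 := ih φ hφ κ (κ' * u) a' b' (fun i => ha _) (fun i => hb _) hκ3 (by linarith) hκu1 hκu2
      (L * x) (by positivity) hxL fun v =>
        (norm_sub_le_of_norm_wedge_mul_sub_le (ha 0) hε' hdiv v).trans (by gcongr)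
    have hκ'0 : ‖κ'‖ ≠ 0 := (lt_of_lt_of_le (by positivity) hκ'1).ne'
    rw [norm_mul, Real.log_mul hκ'0 (by linarith)] at h1
    rw [Fin.sum_univ_succ, Fin.sum_univ_succAbove (fun i => φ (b i)) j]
    have h2 : Real.log ‖κ‖ + (φ (a 0) + ∑ i : Fin m, φ (a i.succ)) -
        (Real.log ‖κ'‖ + (φ (b j) + ∑ i, φ (b (j.succAbove i)))) =
        (Real.log ‖κ‖ + ∑ i, φ (a' i) - (Real.log ‖κ'‖ + Real.log ‖u‖ + ∑ i, φ (b' i))) +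
          (Real.log ‖u‖ + φ (a 0) - φ (b j)) := by ring
    rw [h2]
    refine (abs_add_le _ _).trans ((add_le_add h1 hφu).trans ?_)
    have e0 : ε ^ (γ * (α * β)) = x ^ (α * β) := by rw [hx, Real.rpow_mul hε]
    have hαβ : 0 ≤ α * β := by positivity
    have e1 : (L * x) ^ β ≤ L * x ^ (α * β) := by
      rw [Real.mul_rpow (by positivity) hx0]
      have := Real.rpow_le_rpow_of_exponent_ge' hx0 hx1 hαβ (mul_le_of_le_one_left hβ.le hα1)
      exact mul_le_mul (Real.rpow_le_self_of_one_le hL1 hβ1) this (Real.rpow_nonneg hx0 _)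
        (by positivity)
    have e2 : (2 * (B * x)) ^ α ≤ 2 * B * x ^ (α * β) := by
      rw [← mul_assoc, Real.mul_rpow (by positivity) hx0]
      have := Real.rpow_le_rpow_of_exponent_ge' hx0 hx1 hαβ (mul_le_of_le_one_right hα.le hβ1)
      exact mul_le_mul (Real.rpow_le_self_of_one_le (by linarith) hα1) this
        (Real.rpow_nonneg hx0 _) (by positivity)
    have e3 : x ≤ x ^ (α * β) := by
      have := Real.rpow_le_rpow_of_exponent_ge' hx0 hx1 hαβ (mul_le_one₀ hα1 hβ.le hβ1)
      rwa [Real.rpow_one] at this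
    rw [e0]
    calc K * (L * x) ^ β + (A * (2 * (B * x)) ^ α + 2 * (B * x)) ≤
        K * (L * x ^ (α * β)) + (A * (2 * B * x ^ (α * β)) + 2 * (B * x ^ (α * β))) := by gcongr
      _ = (K * L + 2 * A * B + 2 * B) * x ^ (α * β) := by ring
/-- Among `m + 1` fixed directions, one is away from any `m` given points of the projective line. -/
theorem exists_forall_le_norm_wedge {m : ℕ} (a : Fin m → ℂ × ℂ) :
    ∃ k : Fin (m + 1), ∀ i, (2 * m + 2 : ℝ)⁻¹ * ‖a i‖ ≤ ‖wedge (a i) ((k : ℕ), 1)‖ := by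
  by_contra! h
  choose i hi using h
  -- By the pigeonhole principle two distinct directions `(k, 1)` and `(l, 1)` are too close to the
  -- same vector. Subtracting the wedges bounds its second coordinate, then its first, below its own
  -- norm.
  obtain ⟨k, l, hkl, hik⟩ := Fintype.exists_ne_map_eq_of_card_lt i (by simp)
  have hk := hi k
  have hl := hi l
  rw [← hik] at hl
  set v := a (i k)
  have hm : (0 : ℝ) < 2 * m + 2 := by positivity
  set δ : ℝ := (2 * m + 2 : ℝ)⁻¹ * ‖v‖ with hδ
  have h1 : ‖v.2‖ < 2 * δ := by
    have h2 : v.2 * (((l : ℕ) : ℤ) - ((k : ℕ) : ℤ) : ℤ) =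
        wedge v ((k : ℕ), 1) - wedge v ((l : ℕ), 1) := by
      simp [wedge]
      ring
    have h3 : (1 : ℝ) ≤ ‖((((l : ℕ) : ℤ) - ((k : ℕ) : ℤ) : ℤ) : ℂ)‖ := by
      rw [Complex.norm_intCast]
      have : ((l : ℕ) : ℤ) - ((k : ℕ) : ℤ) ≠ 0 := fun h0 => hkl (Fin.ext (by omega))
      exact_mod_cast Int.one_le_abs this
    calc ‖v.2‖ ≤ ‖v.2 * (((l : ℕ) : ℤ) - ((k : ℕ) : ℤ) : ℤ)‖ := by
          rw [norm_mul]
          exact le_mul_of_one_le_right (norm_nonneg _) h3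
      _ < 2 * δ := by
          rw [h2]
          linarith [norm_sub_le (wedge v ((k : ℕ), 1)) (wedge v ((l : ℕ), 1))]
  have h4 : ‖v.1‖ < δ + m * (2 * δ) := by
    have h5 : v.1 = wedge v ((k : ℕ), 1) + v.2 * (k : ℕ) := by simp [wedge]
    have h6 : ((k : ℕ) : ℝ) ≤ m := by exact_mod_cast Nat.lt_succ_iff.1 k.2
    have h7 : ‖v.2 * (k : ℕ)‖ ≤ m * (2 * δ) := by
      rw [norm_mul, Complex.norm_natCast, mul_comm]
      gcongr
    rw [h5]
    exact (norm_add_le _ _).trans_lt (by linarith)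
  have h8 : ‖v‖ = (2 * m + 2) * δ := by
    rw [hδ, mul_inv_cancel_left₀ hm.ne']
  have h9 : ‖v‖ < ‖v‖ := by
    conv_lhs => rw [Prod.norm_def]
    have : 0 ≤ δ := by positivity
    refine max_lt ?_ ?_ <;> rw [h8] <;> nlinarith [(Nat.cast_nonneg m : (0 : ℝ) ≤ m)]
  exact lt_irrefl _ h9

theorem eventually_closedBall_subset {X : Type*} [PseudoMetricSpace X] {S : Set X} {s₀ : X} (hS : S ∈ 𝓝 s₀) :
    ∀ᶠ r in 𝓝[>] (0 : ℝ), Metric.closedBall s₀ r ⊆ S := by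
  obtain ⟨R, hR, hball⟩ := Metric.nhds_basis_closedBall.mem_iff.1 hS
  filter_upwards [Ioc_mem_nhdsGT hR] with r hr
  exact (Metric.closedBall_subset_closedBall hr.2).trans hball

/-! ### Local Lipschitz bounds for holomorphic coefficients -/

section LocalLipschitz

variable {G : Type*} [NormedAddCommGroup G] [NormedSpace ℂ G]

/-- This is the Schwarz lemma on balls of radius `R / 2` about `y`, where `f` stays within `2` of `f
y`. The constant does not depend on the small radius `r`, so several such bounds can be imposed at
once. -/
theorem exists_eventually_norm_sub_le {f : G → ℂ} {S : Set G} (hS : IsOpen S)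
    (hf : DifferentiableOn ℂ f S) {s₀ : G} (hs₀ : s₀ ∈ S) :
    ∃ Λ, 0 ≤ Λ ∧ ∀ᶠ r in 𝓝[>] (0 : ℝ), ∀ x ∈ Metric.closedBall s₀ r, ∀ y ∈ Metric.closedBall s₀ r,
      ‖f x - f y‖ ≤ Λ * dist x y := by
  have h1 : ∀ᶠ x in 𝓝 s₀, x ∈ S ∧ ‖f x - f s₀‖ < 1 := by
    refine (hS.eventually_mem hs₀).and ?_
    have := (hf.continuousOn.continuousAt (hS.mem_nhds hs₀)).eventually
      (Metric.ball_mem_nhds (f s₀) one_pos)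
    filter_upwards [this] with x hx
    rwa [← dist_eq_norm]
  obtain ⟨R, hR, hball⟩ := Metric.eventually_nhds_iff_ball.1 h1
  refine ⟨2 / (R / 2), by positivity, ?_⟩
  filter_upwards [Ioo_mem_nhdsGT (show (0 : ℝ) < R / 4 by positivity)] with r hr x hx y hy
  have hy' : dist y s₀ ≤ R / 4 := (Metric.mem_closedBall.1 hy).trans hr.2.le
  have hx' : dist x s₀ < R / 4 := (Metric.mem_closedBall.1 hx).trans_lt hr.2
  have hsub : Metric.ball y (R / 2) ⊆ Metric.ball s₀ R := by
    refine Metric.ball_subset_ball' ?_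
    linarith
  have hyR : y ∈ Metric.ball s₀ R := hsub (Metric.mem_ball_self (by positivity))
  have key := Complex.dist_le_div_mul_dist_of_mapsTo_ball (f := f) (c := y) (R₁ := R / 2) (R₂ := 2)
    (z := x) (hf.mono fun z hz => (hball z (hsub hz)).1) (fun z hz => ?_) ?_
  · rwa [dist_eq_norm] at key
  · have h2 := (hball z (hsub hz)).2
    have h3 := (hball y hyR).2
    rw [← dist_eq_norm] at h2 h3
    exact Metric.ball_subset_closedBall (Metric.mem_ball.2
      (by linarith [dist_triangle_right (f z) (f y) (f s₀)]))
  · rw [Metric.mem_ball]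
    linarith [dist_triangle_right x y s₀]

theorem exists_eventually_forall_norm_sub_le {ι : Type*} [Finite ι] {f : ι → G → ℂ} {S : Set G}
    (hS : IsOpen S) (hf : ∀ i, DifferentiableOn ℂ (f i) S) {s₀ : G} (hs₀ : s₀ ∈ S) :
    ∃ Λ, 0 ≤ Λ ∧ ∀ᶠ r in 𝓝[>] (0 : ℝ), ∀ i, ∀ x ∈ Metric.closedBall s₀ r,
      ∀ y ∈ Metric.closedBall s₀ r, ‖f i x - f i y‖ ≤ Λ * dist x y := by
  have := Fintype.ofFinite ι
  choose Λ hΛ h using fun i => exists_eventually_norm_sub_le hS (hf i) hs₀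
  refine ⟨∑ i, Λ i, Finset.sum_nonneg fun i _ => hΛ i, eventually_all.2 fun i => ?_⟩
  filter_upwards [h i] with r hr x hx y hy
  refine (hr x hx y hy).trans ?_
  gcongr
  exact Finset.single_le_sum (fun i _ => hΛ i) (Finset.mem_univ i)

namespace IsHolomorphicLift

variable {d : ℕ} {P Q : G → ℂ[X]} {S : Set G}

/-- Near every point a holomorphic family of polynomials is bounded and Lipschitz. -/
theorem _root_.RationalFamily.exists_eventually_coeff_le {p : G → ℂ[X]} (hS : IsOpen S)
    (hp : ∀ k, DifferentiableOn ℂ (fun s => (p s).coeff k) S) (m : ℕ) {s₀ : G} (hs₀ : s₀ ∈ S) :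
    ∃ Λ, 0 ≤ Λ ∧ ∀ᶠ r in 𝓝[>] (0 : ℝ),
      (∀ t ∈ Metric.closedBall s₀ r, ∀ i ≤ m, ‖(p t).coeff i‖ ≤ Λ) ∧
      ∀ t ∈ Metric.closedBall s₀ r, ∀ s ∈ Metric.closedBall s₀ r, ∀ i ≤ m,
        ‖(p t).coeff i - (p s).coeff i‖ ≤ Λ * dist t s := by
  obtain ⟨Λ, hΛ, h⟩ := exists_eventually_forall_norm_sub_le (ι := Fin (m + 1))
    (f := fun i s => (p s).coeff i) hS (fun i => hp i) hs₀
  have hΛ' : 0 ≤ ∑ i ∈ Finset.range (m + 1), ‖(p s₀).coeff i‖ :=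
    Finset.sum_nonneg fun _ _ => norm_nonneg _
  refine ⟨Λ + ∑ i ∈ Finset.range (m + 1), ‖(p s₀).coeff i‖, by positivity, ?_⟩
  filter_upwards [h, Ioo_mem_nhdsGT (zero_lt_one' ℝ)] with r hr hr1
  refine ⟨fun t ht i hi => ?_, fun t ht s hs i hi => ?_⟩
  · have h1 := hr ⟨i, Nat.lt_succ_of_le hi⟩ t ht s₀ (Metric.mem_closedBall_self hr1.1.le)
    have h2 : ‖(p s₀).coeff i‖ ≤ ∑ i ∈ Finset.range (m + 1), ‖(p s₀).coeff i‖ :=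
      Finset.single_le_sum (f := fun i => ‖(p s₀).coeff i‖) (fun i _ => norm_nonneg _)
        (Finset.mem_range.2 (Nat.lt_succ_of_le hi))
    have h3 : Λ * dist t s₀ ≤ Λ :=
      mul_le_of_le_one_right hΛ ((Metric.mem_closedBall.1 ht).trans hr1.2.le)
    have h4 := norm_sub_norm_le ((p t).coeff i) ((p s₀).coeff i)
    simp only at h1
    linarith
  · refine (hr ⟨i, Nat.lt_succ_of_le hi⟩ t ht s hs).trans ?_
    gcongr
    linarith

theorem exists_isLipschitzFamily (h : IsHolomorphicLift d P Q S) {s₀ : G} (hs₀ : s₀ ∈ S) :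
    ∃ Λ, ∀ᶠ r in 𝓝[>] (0 : ℝ), IsLipschitzFamily d P Q (Metric.closedBall s₀ r) Λ := by
  obtain ⟨Λ₁, hΛ₁, h₁⟩ := exists_eventually_coeff_le h.isOpen h.left d hs₀
  obtain ⟨Λ₂, hΛ₂, h₂⟩ := exists_eventually_coeff_le h.isOpen h.right d hs₀
  refine ⟨Λ₁ + Λ₂, ?_⟩
  filter_upwards [h₁, h₂, eventually_closedBall_subset (h.isOpen.mem_nhds hs₀)] with r hr1 hr2 hr3
  have e1 : Λ₁ ≤ Λ₁ + Λ₂ := by linarith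
  have e2 : Λ₂ ≤ Λ₁ + Λ₂ := by linarith
  exact ⟨by positivity, fun t ht => h.isReduced t (hr3 ht),
    fun t ht i hi => (hr1.1 t ht i hi).trans e1, fun t ht i hi => (hr2.1 t ht i hi).trans e2,
    fun t ht s hs i hi => (hr1.2 t ht s hs i hi).trans (by gcongr),
    fun t ht s hs i hi => (hr2.2 t ht s hs i hi).trans (by gcongr)⟩

theorem _root_.RationalFamily.differentiableOn_coeff_mul {p q : G → ℂ[X]}
    (hp : ∀ k, DifferentiableOn ℂ (fun s => (p s).coeff k) S)
    (hq : ∀ k, DifferentiableOn ℂ (fun s => (q s).coeff k) S) (k : ℕ) :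
    DifferentiableOn ℂ (fun s => (p s * q s).coeff k) S := by
  simp only [coeff_mul]
  exact DifferentiableOn.fun_sum fun x _ => (hp x.1).mul (hq x.2)

theorem differentiableOn_coeff_wronskian (h : IsHolomorphicLift d P Q S) (k : ℕ) :
    DifferentiableOn ℂ (fun s => (wronskian (Q s) (P s)).coeff k) S := by
  have hP' : ∀ k, DifferentiableOn ℂ (fun s => (derivative (P s)).coeff k) S := fun k => by
    simp only [coeff_derivative]
    exact (h.left _).mul_const _
  have hQ' : ∀ k, DifferentiableOn ℂ (fun s => (derivative (Q s)).coeff k) S := fun k => by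
    simp only [coeff_derivative]
    exact (h.right _).mul_const _
  simp only [wronskian, coeff_sub]
  exact (differentiableOn_coeff_mul h.right hP' k).sub (differentiableOn_coeff_mul hQ' h.left k)

theorem _root_.RationalFamily.differentiableOn_resultant {p q : G → ℂ[X]} (m n : ℕ)
    (hp : ∀ k, DifferentiableOn ℂ (fun s => (p s).coeff k) S)
    (hq : ∀ k, DifferentiableOn ℂ (fun s => (q s).coeff k) S) :
    DifferentiableOn ℂ (fun s => resultant (p s) (q s) m n) S := by
  have key : ∀ i k, DifferentiableOn ℂ (fun s => sylvester (p s) (q s) m n i k) S := by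
    intro i k
    simp only [sylvester, Matrix.of_apply]
    refine Fin.addCases (fun k => ?_) (fun k => ?_) k
    · simp only [Fin.addCases_left]
      split_ifs
      · exact hq _
      · fun_prop
    · simp only [Fin.addCases_right]
      split_ifs
      · exact hp _
      · fun_prop
  simp only [resultant, Matrix.det_apply]
  refine DifferentiableOn.fun_sum fun σ _ => DifferentiableOn.const_smul ?_ _
  intro s hs
  have := HasFDerivWithinAt.finsetProd (u := Finset.univ) fun i _ =>
    (key (σ i) i s hs).hasFDerivWithinAt
  exact (this.congr (fun s _ => by simp) (by simp)).differentiableWithinAt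

end IsHolomorphicLift

end LocalLipschitz
-- Bounds for the leading constant and Hölder continuity of the exponent
theorem norm_homEval_le {m : ℕ} {p : ℂ[X]} {M : ℝ} (hp : ∀ i ≤ m, ‖p.coeff i‖ ≤ M) (v : ℂ × ℂ) :
    ‖homEval m p v‖ ≤ (m + 1) * M * ‖v‖ ^ m := by
  rw [homEval]
  refine (norm_sum_le _ _).trans ?_
  calc ∑ i ∈ Finset.range (m + 1), ‖p.coeff i * v.1 ^ i * v.2 ^ (m - i)‖ ≤
      ∑ i ∈ Finset.range (m + 1), M * ‖v‖ ^ m := by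
        refine Finset.sum_le_sum fun i hi => ?_
        have hi' := Nat.lt_succ_iff.1 (Finset.mem_range.1 hi)
        have hM : 0 ≤ M := (norm_nonneg _).trans (hp i hi')
        rw [norm_mul, norm_mul, norm_pow, norm_pow, mul_assoc, ← Nat.add_sub_cancel' hi', pow_add,
          Nat.add_sub_cancel_left]
        gcongr
        · exact hp i hi'
        · exact norm_fst_le v
        · exact norm_snd_le v
    _ = (m + 1) * M * ‖v‖ ^ m := by
        simp
        ring

theorem homEval_sub {m : ℕ} {p q : ℂ[X]} (v : ℂ × ℂ) :
    homEval m (p - q) v = homEval m p v - homEval m q v := by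
  simp only [homEval, coeff_sub, sub_mul, Finset.sum_sub_distrib]

namespace IsFactorization

variable {m : ℕ} {p : ℂ[X]} {κ : ℂ} {a : Fin m → ℂ × ℂ}

theorem exists_homEval_ne_zero (h : IsFactorization m p κ a) : ∃ v, homEval m p v ≠ 0 := by
  obtain ⟨k, hk⟩ := exists_forall_le_norm_wedge a
  refine ⟨((k : ℕ), 1), ?_⟩
  rw [h.homEval_eq]
  refine mul_ne_zero h.ne_zero (Finset.prod_ne_zero_iff.2 fun i _ h0 => ?_)
  have h1 := hk i
  have h2 : wedge (a i) ((k : ℕ), 1) = -wedge ((k : ℕ), 1) (a i) := by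
    simp only [wedge]
    ring
  rw [h2, h0, h.norm_eq_one, neg_zero, norm_zero, mul_one] at h1
  exact absurd h1 (not_le.2 (by positivity))

theorem norm_homEval_le (h : IsFactorization m p κ a) (v : ℂ × ℂ) :
    ‖homEval m p v‖ ≤ ‖κ‖ * (2 ^ m * ‖v‖ ^ m) := by
  rw [h.homEval_eq, norm_mul]
  gcongr
  exact norm_prod_wedge_le v h.norm_eq_one

/-- Evaluate the form at a direction that is uniformly away from all its roots. -/
theorem norm_le (h : IsFactorization m p κ a) {M : ℝ} (hp : ∀ i ≤ m, ‖p.coeff i‖ ≤ M) :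
    ‖κ‖ ≤ (m + 1) * M * (m + 1) ^ m * (2 * m + 2) ^ m := by
  obtain ⟨k, hk⟩ := exists_forall_le_norm_wedge a
  have hM : 0 ≤ M := (norm_nonneg _).trans (hp 0 (Nat.zero_le _))
  have h1 := RationalFamily.norm_homEval_le hp ((k : ℕ), 1)
  have h2 : ‖(((k : ℕ) : ℂ), (1 : ℂ))‖ ≤ m + 1 := by
    refine max_le ?_ ?_
    · simp only [Complex.norm_natCast]
      have : (k : ℕ) ≤ m + 1 := k.2.le
      exact_mod_cast this
    · simp
  have h3 : ((2 * m + 2 : ℝ)⁻¹) ^ m ≤ ‖∏ i, wedge ((k : ℕ), 1) (a i)‖ := by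
    rw [norm_prod]
    calc ((2 * m + 2 : ℝ)⁻¹) ^ m = ∏ _i : Fin m, (2 * m + 2 : ℝ)⁻¹ := by simp
      _ ≤ _ := Finset.prod_le_prod (fun _ _ => by positivity) fun i _ => by
        have h4 := hk i
        have h5 : wedge (a i) ((k : ℕ), 1) = -wedge ((k : ℕ), 1) (a i) := by
          simp only [wedge]
          ring
        rwa [h5, norm_neg, h.norm_eq_one, mul_one] at h4
  rw [h.homEval_eq, norm_mul] at h1
  have h6 : ‖κ‖ * ((2 * m + 2 : ℝ)⁻¹) ^ m ≤ (m + 1) * M * (m + 1) ^ m :=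
    (mul_le_mul_of_nonneg_left h3 (norm_nonneg _)).trans (h1.trans (by gcongr))
  rwa [inv_pow, ← div_eq_mul_inv, div_le_iff₀ (by positivity)] at h6

end IsFactorization

namespace IsHolomorphicLift

variable {G : Type*} [NormedAddCommGroup G] [NormedSpace ℂ G]
  {d : ℕ} {P Q : G → ℂ[X]} {S : Set G}

/-- The upper bound comes from the coefficients. For the lower bound, fix `v` at which the form of
parameter `s₀` does not vanish; nearby forms stay away from `0` at `v`, whereas their modulus there
is at most `|κ| 2^m ‖v‖^m`. -/
theorem exists_eventually_norm_kappa_le (h : IsHolomorphicLift d P Q S) (hd : 2 ≤ d) {s₀ : G}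
    (hs₀ : s₀ ∈ S) :
    ∃ B, 1 ≤ B ∧ ∀ᶠ r in 𝓝[>] (0 : ℝ), ∀ t ∈ Metric.closedBall s₀ r, ∀ κ c,
      IsFactorization (2 * d - 2) (wronskian (Q t) (P t)) κ c → B⁻¹ ≤ ‖κ‖ ∧ ‖κ‖ ≤ B := by
  set m := 2 * d - 2 with hm
  obtain ⟨Λ, hΛ, h₁⟩ := exists_eventually_coeff_le h.isOpen h.differentiableOn_coeff_wronskian m hs₀
  have h0 := h.isReduced s₀ hs₀
  obtain ⟨κ₀, c₀, hc₀⟩ := exists_isFactorization (wronskian_ne_zero h0 (by omega))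
    (natDegree_wronskian_le h0.natDegree_left h0.natDegree_right (by omega))
  obtain ⟨v, hv⟩ := hc₀.exists_homEval_ne_zero
  have hv0 : 0 < ‖homEval m (wronskian (Q s₀) (P s₀)) v‖ := norm_pos_iff.2 hv
  have hcont : ContinuousAt (fun s => ‖homEval m (wronskian (Q s) (P s)) v‖) s₀ := by
    refine ContinuousAt.norm ?_
    simp only [homEval]
    refine tendsto_finsetSum _ fun i _ => ?_
    exact ((((h.differentiableOn_coeff_wronskian i).continuousOn.continuousAt
      (h.isOpen.mem_nhds hs₀)).mul continuousAt_const).mul continuousAt_const).tendsto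
  have h₂ := eventually_closedBall_subset (hcont.eventually (lt_mem_nhds (half_lt_self hv0)))
  set ℓ := ‖homEval m (wronskian (Q s₀) (P s₀)) v‖ / 2 with hℓ
  have hℓ0 : 0 < ℓ := by positivity
  set U : ℝ := (m + 1) * Λ * (m + 1) ^ m * (2 * m + 2) ^ m with hU
  have hU0 : 0 ≤ U := by positivity
  set D : ℝ := 2 ^ m * ‖v‖ ^ m with hD
  have hD0 : 0 ≤ D := by positivity
  refine ⟨1 + U + D / ℓ, by linarith [div_nonneg hD0 hℓ0.le], ?_⟩
  filter_upwards [h₁, h₂] with r hr1 hr2 t ht κ c hc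
  have h3 : ℓ < ‖homEval m (wronskian (Q t) (P t)) v‖ := hr2 ht
  have h4 := hc.norm_homEval_le v
  have h5 := hc.norm_le (hr1.1 t ht)
  have hB0 : (0 : ℝ) < 1 + U + D / ℓ := by linarith [div_nonneg hD0 hℓ0.le]
  refine ⟨?_, by linarith [div_nonneg hD0 hℓ0.le]⟩
  rw [inv_le_iff_one_le_mul₀ hB0, mul_comm]
  have h6 : 1 ≤ D / ℓ * ‖κ‖ := by
    rw [div_mul_eq_mul_div, le_div_iff₀ hℓ0, one_mul, mul_comm]
    linarith
  nlinarith [norm_nonneg κ]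

theorem exists_eventually_abs_log_resultant_sub_le (h : IsHolomorphicLift d P Q S) (hd : 2 ≤ d)
    {s₀ : G} (hs₀ : s₀ ∈ S) :
    ∃ Λ, 0 ≤ Λ ∧ ∀ᶠ r in 𝓝[>] (0 : ℝ), ∀ t ∈ Metric.closedBall s₀ r,
      ∀ s ∈ Metric.closedBall s₀ r,
        |Real.log ‖resultant (P t) (Q t) d d‖ - Real.log ‖resultant (P s) (Q s) d d‖| ≤
          Λ * dist t s := by
  have hdiff := differentiableOn_resultant d d h.left h.right
  obtain ⟨Λ, hΛ, h₁⟩ := exists_eventually_norm_sub_le h.isOpen hdiff hs₀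
  have hv0 : 0 < ‖resultant (P s₀) (Q s₀) d d‖ :=
    norm_pos_iff.2 ((h.isReduced s₀ hs₀).resultant_ne_zero hd)
  have hcont := (hdiff.continuousOn.continuousAt (h.isOpen.mem_nhds hs₀)).norm
  have h₂ := eventually_closedBall_subset (hcont.eventually (lt_mem_nhds (half_lt_self hv0)))
  refine ⟨(‖resultant (P s₀) (Q s₀) d d‖ / 2)⁻¹ * Λ, by positivity, ?_⟩
  filter_upwards [h₁, h₂] with r hr1 hr2 t ht s hs
  refine (abs_log_sub_log_le (half_pos hv0) (le_of_lt (hr2 ht)) (le_of_lt (hr2 hs))).trans ?_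
  rw [mul_assoc]
  gcongr
  exact (abs_norm_sub_norm_le _ _).trans (hr1 t ht s hs)

/-- The increment of the exponent splits into the motion of the roots with `G` frozen at `t`, the
motion of `G` at the roots of parameter `s`, and the variation of the resultant. -/
theorem exists_holder [FiniteDimensional ℂ G] (h : IsHolomorphicLift d P Q S) (hd : 2 ≤ d)
    {s₀ : G} (hs₀ : s₀ ∈ S) :
    ∃ α A r : ℝ, 0 < α ∧ α ≤ 1 ∧ 0 ≤ A ∧ 0 < r ∧ Metric.closedBall s₀ r ⊆ S ∧
      ∀ t ∈ Metric.closedBall s₀ r, ∀ s ∈ Metric.closedBall s₀ r,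
        |lyapunovExponent d (ratMap (P t) (Q t)) - lyapunovExponent d (ratMap (P s) (Q s))| ≤
          A * dist t s ^ α := by
  have := FiniteDimensional.proper ℂ G
  set m := 2 * d - 2 with hm
  obtain ⟨Λ, hΛ⟩ := h.exists_isLipschitzFamily hs₀
  obtain ⟨r₁, hr₁, hr₁0⟩ := (hΛ.and self_mem_nhdsWithin).exists
  obtain ⟨C, Λ', hΛ', hF⟩ := hr₁.exists_isHomFamily (isCompact_closedBall s₀ r₁) hd
  obtain ⟨α, A, hα, hα1, hA, hG⟩ := hF.exists_holder hΛ' hd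
  obtain ⟨B, hB, hκ⟩ := h.exists_eventually_norm_kappa_le hd hs₀
  obtain ⟨N, hN, hres⟩ := h.exists_eventually_abs_log_resultant_sub_le hd hs₀
  obtain ⟨W, hW, hcoeff⟩ := exists_eventually_coeff_le h.isOpen h.differentiableOn_coeff_wronskian
    m hs₀
  obtain ⟨β, ε₀, K, hβ, hβ1, hε₀, hε₀1, hK, hroots⟩ := exists_abs_sum_roots_sub_le hA hα hα1 m B hB
  set Z : ℝ := (m + 1) * W with hZ
  have hZ0 : 0 ≤ Z := by positivity
  have hsmall : ∀ᶠ r in 𝓝[>] (0 : ℝ), r < min r₁ (min (1 / 2) (ε₀ / (2 * (Z + 1)))) := by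
    refine nhdsWithin_le_nhds (gt_mem_nhds ?_)
    have : 0 < r₁ := hr₁0
    positivity
  obtain ⟨r, hr1, hr2, hr3, hr4, hr5, hr0⟩ := (hκ.and (hres.and (hcoeff.and (hsmall.and
    ((eventually_closedBall_subset (h.isOpen.mem_nhds hs₀)).and self_mem_nhdsWithin))))).exists
  have hr0 : 0 < r := hr0
  refine ⟨α * β, K * Z ^ β + m * A + 2 / d * N, r, by positivity, mul_le_one₀ hα1 hβ.le hβ1,
    by positivity, hr0, hr5, fun t ht s hs => ?_⟩
  have hrr₁ := (lt_min_iff.1 hr4).1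
  have hr12 := (lt_min_iff.1 (lt_min_iff.1 hr4).2).1
  have hrε := (lt_min_iff.1 (lt_min_iff.1 hr4).2).2
  have hsub := Metric.closedBall_subset_closedBall (x := s₀) hrr₁.le
  have hdist : dist t s ≤ 2 * r := by
    have h1 := dist_triangle_right t s s₀
    have h2 := Metric.mem_closedBall.1 ht
    have h3 := Metric.mem_closedBall.1 hs
    linarith
  have hdist0 : 0 ≤ dist t s := dist_nonneg
  have hdist1 : dist t s ≤ 1 := by linarith
  have hε : Z * dist t s ≤ ε₀ := by
    rw [lt_div_iff₀ (by positivity)] at hrε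
    calc Z * dist t s ≤ (Z + 1) * (2 * r) := by gcongr; linarith
      _ ≤ ε₀ := by linarith
  have fact : ∀ t ∈ Metric.closedBall s₀ r, ∃ κ c,
      IsFactorization m (wronskian (Q t) (P t)) κ c := fun t ht => by
    have h0 := h.isReduced t (hr5 ht)
    exact exists_isFactorization (wronskian_ne_zero h0 (by omega))
      (natDegree_wronskian_le h0.natDegree_left h0.natDegree_right (by omega))
  obtain ⟨κ, c, hc⟩ := fact t ht
  obtain ⟨κ', c', hc'⟩ := fact s hs
  have hφ : IsLogHolder (green d (ratLift d (P t) (Q t))) A α := by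
    refine ⟨fun a v ha hv => (hF.isHomLift t (hsub ht)).green_smul ha hv, fun v w hv hw => ?_⟩
    simpa using hG t (hsub ht) t (hsub ht) v w hv hw
  -- The Wronskian forms differ by at most `Z dist(t, s) ‖v‖^m`, a multiple of the variation of
  -- their coefficients.
  have e1 := hroots _ hφ κ κ' c c' hc.norm_eq_one hc'.norm_eq_one (hr1 t ht κ c hc).1
    (hr1 t ht κ c hc).2 (hr1 s hs κ' c' hc').1 (hr1 s hs κ' c' hc').2 (Z * dist t s)
    (by positivity) hε fun v => by
      rw [← hc.homEval_eq, ← hc'.homEval_eq, ← homEval_sub]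
      refine (norm_homEval_le (M := W * dist t s) (fun i hi => ?_) v).trans_eq ?_
      · rw [coeff_sub]
        exact hr3.2 t ht s hs i hi
      · rw [hZ]
        ring
  have e2 : |∑ i, green d (ratLift d (P t) (Q t)) (c' i) -
      ∑ i, green d (ratLift d (P s) (Q s)) (c' i)| ≤ m * (A * dist t s ^ α) := by
    rw [← Finset.sum_sub_distrib]
    refine (Finset.abs_sum_le_sum_abs _ _).trans ?_
    calc _ ≤ ∑ _i : Fin m, A * dist t s ^ α := Finset.sum_le_sum fun i _ => by
          simpa using hG t (hsub ht) s (hsub hs) (c' i) (c' i) (hc'.norm_eq_one i)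
            (hc'.norm_eq_one i)
      _ = m * (A * dist t s ^ α) := by simp
  have e3 := hr2 t ht s hs
  rw [((h.isReduced t (hr5 ht)).lyapunovExponent_eq hd hc).2,
    ((h.isReduced s (hr5 hs)).lyapunovExponent_eq hd hc').2]
  have hd0 : (0 : ℝ) < d := by positivity
  have hαβ : 0 ≤ α * β := by positivity
  have f1 : (Z * dist t s) ^ β ≤ Z ^ β * dist t s ^ (α * β) := by
    rw [Real.mul_rpow hZ0 hdist0]
    gcongr ?_ * ?_
    exact Real.rpow_le_rpow_of_exponent_ge' hdist0 hdist1 hαβ (mul_le_of_le_one_left hβ.le hα1)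
  have f2 : dist t s ^ α ≤ dist t s ^ (α * β) :=
    Real.rpow_le_rpow_of_exponent_ge' hdist0 hdist1 hαβ (mul_le_of_le_one_right hα.le hβ1)
  have f3 : dist t s ≤ dist t s ^ (α * β) := by
    have := Real.rpow_le_rpow_of_exponent_ge' hdist0 hdist1 hαβ (mul_le_one₀ hα1 hβ.le hβ1)
    rwa [Real.rpow_one] at this
  have e4 : |2 / (d : ℝ) * (Real.log ‖resultant (P t) (Q t) d d‖ -
      Real.log ‖resultant (P s) (Q s) d d‖)| ≤ 2 / d * (N * dist t s) := by
    rw [abs_mul, abs_of_nonneg (by positivity)]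
    gcongr
  calc _ = |(Real.log ‖κ‖ + ∑ i, green d (ratLift d (P t) (Q t)) (c i) -
          (Real.log ‖κ'‖ + ∑ i, green d (ratLift d (P t) (Q t)) (c' i))) +
        (∑ i, green d (ratLift d (P t) (Q t)) (c' i) -
          ∑ i, green d (ratLift d (P s) (Q s)) (c' i)) -
        2 / d * (Real.log ‖resultant (P t) (Q t) d d‖ -
          Real.log ‖resultant (P s) (Q s) d d‖)| := by
        congr 1
        ring
    _ ≤ K * (Z * dist t s) ^ β + m * (A * dist t s ^ α) + 2 / d * (N * dist t s) :=
        (abs_sub _ _).trans (add_le_add ((abs_add_le _ _).trans (add_le_add e1 e2)) e4)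
    _ ≤ K * (Z ^ β * dist t s ^ (α * β)) + m * (A * dist t s ^ (α * β)) +
        2 / d * (N * dist t s ^ (α * β)) := by gcongr
    _ = _ := by ring

end IsHolomorphicLift
/-! ### Subharmonic functions -/

section Subharmonic

theorem exists_polynomial_of_mem_span_fourier {f : C(UnitAddCircle, ℂ)}
    (hf : f ∈ Submodule.span ℂ (Set.range (fourier (T := 1)))) :
    ∃ p q : ℂ[X], ∀ x, f x = p.eval (AddCircle.toCircle x : ℂ) +
      (starRingEnd ℂ) (q.eval (AddCircle.toCircle x : ℂ)) := by
  induction hf using Submodule.span_induction with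
  | mem f hf =>
    obtain ⟨n, rfl⟩ := hf
    rcases le_total 0 n with hn | hn
    · lift n to ℕ using hn
      refine ⟨X ^ n, 0, fun x => ?_⟩
      simp [fourier_apply, AddCircle.toCircle_nsmul]
    · obtain ⟨k, rfl⟩ := Int.exists_eq_neg_ofNat hn
      refine ⟨0, X ^ k, fun x => ?_⟩
      rw [fourier_neg]
      simp [fourier_apply, AddCircle.toCircle_nsmul]
  | zero => exact ⟨0, 0, by simp⟩
  | add f g _ _ hf hg =>
    obtain ⟨p, q, h⟩ := hf
    obtain ⟨p', q', h'⟩ := hg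
    refine ⟨p + p', q + q', fun x => ?_⟩
    simp only [ContinuousMap.add_apply, h, h', eval_add, map_add]
    ring
  | smul c f _ hf =>
    obtain ⟨p, q, h⟩ := hf
    refine ⟨C c * p, C ((starRingEnd ℂ) c) * q, fun x => ?_⟩
    simp only [ContinuousMap.smul_apply, h, smul_eq_mul, eval_mul, eval_C, map_mul,
      Complex.conj_conj]
    ring

/-- Continuous functions on a circle are uniform limits of real parts of entire functions. -/
theorem exists_differentiable_abs_sub_re_le {g : ℂ → ℝ} {a : ℂ} {r : ℝ} (hr : 0 < r)
    (hg : ContinuousOn g (Metric.sphere a r)) {ε : ℝ} (hε : 0 < ε) :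
    ∃ P : ℂ → ℂ, Differentiable ℂ P ∧ ∀ z ∈ Metric.sphere a r, |g z - (P z).re| ≤ ε := by
  have hmem : ∀ x : UnitAddCircle, a + r * (AddCircle.toCircle x : ℂ) ∈ Metric.sphere a r := by
    intro x
    simp [abs_of_pos hr, Circle.norm_coe]
  let F : C(UnitAddCircle, ℂ) :=
    { toFun := fun x => (g (a + r * (AddCircle.toCircle x : ℂ)) : ℂ)
      continuous_toFun := by
        refine Complex.continuous_ofReal.comp (hg.comp_continuous ?_ hmem)
        exact continuous_const.add (continuous_const.mul
          (continuous_induced_dom.comp AddCircle.continuous_toCircle)) }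
  have hF : F ∈ (Submodule.span ℂ (Set.range (fourier (T := 1)))).topologicalClosure := by
    rw [span_fourier_closure_eq_top]
    trivial
  obtain ⟨f, hf, hfF⟩ := Metric.mem_closure_iff.1 hF ε hε
  obtain ⟨p, q, hpq⟩ := exists_polynomial_of_mem_span_fourier hf
  have hr' : (r : ℂ) ≠ 0 := by exact_mod_cast hr.ne'
  refine ⟨fun z => (p + q).eval ((z - a) / r), ?_, fun z hz => ?_⟩
  · exact (p + q).differentiable.comp (by fun_prop)
  · have h1 : ‖(z - a) / r‖ = 1 := by
      rw [mem_sphere_iff_norm] at hz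
      rw [norm_div, hz, Complex.norm_real, Real.norm_of_nonneg hr.le, div_self hr.ne']
    obtain ⟨θ, hθ⟩ := (Complex.norm_eq_one_iff _).1 h1
    have h2 : (AddCircle.toCircle ((θ / (2 * Real.pi) : ℝ) : UnitAddCircle) : ℂ) = (z - a) / r := by
      rw [AddCircle.toCircle_apply_mk, Circle.coe_exp, ← hθ]
      congr 2
      have := Real.pi_ne_zero
      push_cast
      field_simp
    have h3 := (ContinuousMap.dist_lt_iff hε).1 hfF ((θ / (2 * Real.pi) : ℝ) : UnitAddCircle)
    rw [hpq, h2, dist_eq_norm] at h3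
    have h4 : F ((θ / (2 * Real.pi) : ℝ) : UnitAddCircle) = (g z : ℂ) := by
      change ((g _ : ℝ) : ℂ) = _
      rw [h2]
      congr 2
      field_simp
      ring
    rw [h4] at h3
    refine le_trans ?_ h3.le
    refine le_trans (le_of_eq ?_) (Complex.abs_re_le_norm _)
    congr 1
    simp

theorem circleAverage_re {P : ℂ → ℂ} (hP : Differentiable ℂ P) (a : ℂ) (r : ℝ) :
    Real.circleAverage (fun z => (P z).re) a r = (P a).re := by
  have h1 : CircleIntegrable P a r := hP.continuous.continuousOn.circleIntegrable'
  have h2 := Complex.reCLM.circleAverage_comp_comm h1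
  rw [DiffContOnCl.circleAverage hP.diffContOnCl] at h2
  exact h2

/-- A form of Jensen's inequality for a holomorphic function with a continuous majorant. -/
theorem norm_le_exp_circleAverage {R : ℂ → ℂ} {h : ℂ → ℝ} {a : ℂ} {r : ℝ} (hr : 0 < r)
    (hR : DifferentiableOn ℂ R (Metric.closedBall a r)) (hh : ContinuousOn h (Metric.sphere a r))
    (hle : ∀ z ∈ Metric.sphere a r, ‖R z‖ ≤ Real.exp (h z)) :
    ‖R a‖ ≤ Real.exp (Real.circleAverage h a r) := by
  have hhi : CircleIntegrable h a r := by
    refine ContinuousOn.circleIntegrable hr.le hh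
  have key : ∀ ε > 0, ‖R a‖ ≤ Real.exp (Real.circleAverage h a r + 2 * ε) := by
    intro ε hε
    -- With `Re P` within `ε` of `h` on the circle, the maximum principle for `R exp(-P)` gives the
    -- inequality up to `2ε`: one `ε` from the boundary bound, one from the mean of `Re P`.
    obtain ⟨P, hP, hPε⟩ := exists_differentiable_abs_sub_re_le hr hh hε
    have h1 : DiffContOnCl ℂ (fun z => R z * Complex.exp (-P z)) (Metric.ball a r) := by
      refine DifferentiableOn.diffContOnCl ?_
      rw [closure_ball _ hr.ne']
      exact hR.mul (Complex.differentiable_exp.comp hP.neg).differentiableOn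
    have h2 := Complex.norm_le_of_forall_mem_frontier_norm_le Metric.isBounded_ball h1 (C := Real.exp ε)
      (fun z hz => ?_) (subset_closure (Metric.mem_ball_self hr))
    · rw [norm_mul, Complex.norm_exp, Complex.neg_re, Real.exp_neg, ← div_eq_mul_inv,
        div_le_iff₀ (Real.exp_pos _), ← Real.exp_add] at h2
      refine h2.trans (Real.exp_le_exp.2 ?_)
      have h3 : Real.circleAverage (fun z => (P z).re) a r ≤
          Real.circleAverage (fun z => h z + ε) a r := by
        refine Real.circleAverage_mono
          (Complex.continuous_re.comp hP.continuous).continuousOn.circleIntegrable'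
          (hhi.add (circleIntegrable_const _ _ _)) fun z hz => ?_
        rw [abs_of_pos hr] at hz
        have := (abs_le.1 (hPε z hz)).1
        linarith
      rw [circleAverage_re hP, Real.circleAverage_fun_add hhi (circleIntegrable_const _ _ _),
        Real.circleAverage_const] at h3
      linarith
    · rw [frontier_ball _ hr.ne'] at hz
      rw [norm_mul, Complex.norm_exp, Complex.neg_re]
      have h3 := (abs_le.1 (hPε z hz)).2
      calc ‖R z‖ * Real.exp (-(P z).re) ≤ Real.exp (h z) * Real.exp (-(P z).re) := by
            gcongr
            exact hle z hz
        _ = Real.exp (h z - (P z).re) := by rw [← Real.exp_add, sub_eq_add_neg]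
        _ ≤ Real.exp ε := Real.exp_le_exp.2 h3
  have hcont : Tendsto (fun ε : ℝ => Real.exp (Real.circleAverage h a r + 2 * ε)) (𝓝[>] 0)
      (𝓝 (Real.exp (Real.circleAverage h a r + 2 * 0))) :=
    (Continuous.tendsto (by fun_prop) 0).mono_left nhdsWithin_le_nhds
  rw [mul_zero, add_zero] at hcont
  exact ge_of_tendsto hcont (eventually_mem_nhdsWithin.mono fun ε hε => key ε hε)

theorem circleAverage_norm_sub_sq (a z : ℂ) (r : ℝ) :
    Real.circleAverage (fun w => ‖w - a‖ ^ 2) z r = ‖z - a‖ ^ 2 + r ^ 2 := by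
  have h1 : ∀ w ∈ Metric.sphere z |r|, ‖w - a‖ ^ 2 =
      (2 * (starRingEnd ℂ) (z - a) * (w - z) + ((‖z - a‖ ^ 2 + r ^ 2 : ℝ) : ℂ)).re := by
    intro w hw
    rw [mem_sphere_iff_norm] at hw
    have h2 : r ^ 2 = ‖w - z‖ ^ 2 := by rw [hw, sq_abs]
    rw [h2, ← Complex.normSq_eq_norm_sq, ← Complex.normSq_eq_norm_sq, ← Complex.normSq_eq_norm_sq,
      Complex.normSq_apply, Complex.normSq_apply, Complex.normSq_apply]
    simp
    ring
  rw [Real.circleAverage_congr_sphere h1, circleAverage_re (by fun_prop), sub_self,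
    mul_zero, zero_add, Complex.ofReal_re]

/-- The maximum principle for functions satisfying the local sub-mean value inequality. -/
theorem le_of_local_submean {v : ℂ → ℝ} {a : ℂ} {r B : ℝ} (hr : 0 < r)
    (hv : ContinuousOn v (Metric.closedBall a r))
    (hloc : ∀ z ∈ Metric.ball a r, ∃ᶠ ρ in 𝓝[>] (0 : ℝ), v z ≤ Real.circleAverage v z ρ)
    (hB : ∀ z ∈ Metric.sphere a r, v z ≤ B) : v a ≤ B := by
  have key : ∀ η > 0, v a ≤ B + η * r ^ 2 := by
    intro η hη
    -- The term `η |z - a|²` adds `η ρ²` to circular means, which makes the sub-mean inequality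
    -- strict and an interior maximum impossible.
    have hc : ContinuousOn (fun z => v z + η * ‖z - a‖ ^ 2) (Metric.closedBall a r) :=
      hv.add (Continuous.continuousOn (by fun_prop))
    obtain ⟨z, hz, hmax⟩ := (isCompact_closedBall a r).exists_isMaxOn
      (Metric.nonempty_closedBall.2 hr.le) hc
    have hmax' : ∀ w ∈ Metric.closedBall a r, v w + η * ‖w - a‖ ^ 2 ≤ v z + η * ‖z - a‖ ^ 2 :=
      fun w hw => hmax hw
    have h1 := hmax' a (Metric.mem_closedBall_self hr.le)
    simp only [sub_self, norm_zero, ne_eq, OfNat.ofNat_ne_zero, not_false_eq_true, zero_pow,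
      mul_zero, add_zero] at h1
    rcases (Metric.mem_closedBall.1 hz).lt_or_eq with hzr | hzr
    · exfalso
      have h2 : ∀ᶠ ρ in 𝓝[>] (0 : ℝ), Metric.closedBall z ρ ⊆ Metric.ball a r ∧ 0 < ρ :=
        (eventually_closedBall_subset (Metric.isOpen_ball.mem_nhds hzr)).and self_mem_nhdsWithin
      obtain ⟨ρ, hρ, hsub, hρ0⟩ := ((hloc z hzr).and_eventually h2).exists
      have hsub' : Metric.sphere z |ρ| ⊆ Metric.closedBall a r := by
        rw [abs_of_pos hρ0]
        exact Metric.sphere_subset_closedBall.trans (hsub.trans Metric.ball_subset_closedBall)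
      have i1 : CircleIntegrable v z ρ := (hv.mono hsub').circleIntegrable'
      have i2 : CircleIntegrable (fun w => η * ‖w - a‖ ^ 2) z ρ :=
        (Continuous.continuousOn (by fun_prop)).circleIntegrable'
      have h3 : Real.circleAverage (fun w => v w + η * ‖w - a‖ ^ 2) z ρ ≤
          v z + η * ‖z - a‖ ^ 2 :=
        Real.circleAverage_mono_on_of_le_circle (i1.add i2) fun w hw => hmax' w (hsub' hw)
      have h4 : Real.circleAverage (fun w => η * ‖w - a‖ ^ 2) z ρ = η * (‖z - a‖ ^ 2 + ρ ^ 2) := by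
        rw [← circleAverage_norm_sub_sq]
        exact Real.circleAverage_fun_smul (a := η)
      rw [Real.circleAverage_fun_add i1 i2, h4] at h3
      have : 0 < η * ρ ^ 2 := by positivity
      linarith
    · have h2 := hB z hzr
      rw [← dist_eq_norm, hzr] at h1
      linarith
  have hcont : Tendsto (fun η : ℝ => B + η * r ^ 2) (𝓝[>] 0) (𝓝 (B + 0 * r ^ 2)) :=
    (Continuous.tendsto (by fun_prop) 0).mono_left nhdsWithin_le_nhds
  rw [zero_mul, add_zero] at hcont
  exact ge_of_tendsto hcont (eventually_mem_nhdsWithin.mono fun η hη => key η hη)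

/-- For continuous functions the sub-mean value inequality is a local property. -/
theorem isSubharmonicOn_of_local {u : ℂ → ℝ} {U : Set ℂ} (hU : IsOpen U) (hu : ContinuousOn u U)
    (hloc : ∀ z ∈ U, ∃ᶠ ρ in 𝓝[>] (0 : ℝ), u z ≤ Real.circleAverage u z ρ) :
    IsSubharmonicOn u U := by
  have hint : ∀ (a : ℂ) (r : ℝ), 0 < r → Metric.closedBall a r ⊆ U → CircleIntegrable u a r :=
    fun a r hr h => (hu.mono (Metric.sphere_subset_closedBall.trans h)).circleIntegrable hr.le
  refine ⟨hu.upperSemicontinuousOn, hint, fun a r hr hsub => ?_⟩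
  have hus : ContinuousOn u (Metric.sphere a r) :=
    hu.mono (Metric.sphere_subset_closedBall.trans hsub)
  have key : ∀ ε > 0, u a ≤ Real.circleAverage u a r + 2 * ε := by
    intro ε hε
    -- Subtracting the harmonic function `Re P`, close to `u` on the circle, preserves the local
    -- inequality and reduces the claim to the maximum principle.
    obtain ⟨P, hP, hPε⟩ := exists_differentiable_abs_sub_re_le hr hus hε
    have hPc : Continuous fun z => (P z).re := Complex.continuous_re.comp hP.continuous
    have h1 : u a - (P a).re ≤ ε := by
      refine le_of_local_submean (v := fun z => u z - (P z).re) hr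
        ((hu.mono hsub).sub hPc.continuousOn) (fun z hz => ?_)
        fun z hz => (abs_le.1 (hPε z hz)).2
      have hzU := hsub (Metric.ball_subset_closedBall hz)
      refine ((hloc z hzU).and_eventually ((eventually_closedBall_subset (hU.mem_nhds hzU)).and
        self_mem_nhdsWithin)).mono fun ρ hρ => ?_
      rw [Real.circleAverage_fun_sub (hint z ρ hρ.2.2 hρ.2.1) hPc.continuousOn.circleIntegrable',
        circleAverage_re hP]
      linarith [hρ.1]
    have h2 : Real.circleAverage (fun z => (P z).re) a r ≤
        Real.circleAverage (fun z => u z + ε) a r := by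
      refine Real.circleAverage_mono hPc.continuousOn.circleIntegrable'
        ((hint a r hr hsub).add (circleIntegrable_const _ _ _)) fun z hz => ?_
      rw [abs_of_pos hr] at hz
      have := (abs_le.1 (hPε z hz)).1
      linarith
    rw [circleAverage_re hP, Real.circleAverage_fun_add (hint a r hr hsub)
      (circleIntegrable_const _ _ _), Real.circleAverage_const] at h2
    linarith
  have hcont : Tendsto (fun ε : ℝ => Real.circleAverage u a r + 2 * ε) (𝓝[>] 0)
      (𝓝 (Real.circleAverage u a r + 2 * 0)) :=
    (Continuous.tendsto (by fun_prop) 0).mono_left nhdsWithin_le_nhds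
  rw [mul_zero, add_zero] at hcont
  exact ge_of_tendsto hcont (eventually_mem_nhdsWithin.mono fun ε hε => key ε hε)

end Subharmonic
/-! ### Plurisubharmonicity of the Lyapunov exponent -/

section ResultantBounds

variable {d m : ℕ} {P Q W : ℂ[X]} {B : ℝ} {κ : ℂ} {c : Fin m → ℂ × ℂ}

/-- The form `v ↦ Fⁿ(v) ∧ (e, 1)` of degree `dⁿ`, where `F` is the homogeneous lift of `P / Q`. -/
noncomputable def iterWedgePoly (d : ℕ) (P Q : ℂ[X]) (n : ℕ) (e : ℂ) : ℂ[X] :=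
  (iterPoly d P Q n).1 - C e * (iterPoly d P Q n).2

theorem natDegree_iterWedgePoly (d : ℕ) (P Q : ℂ[X]) (n : ℕ) (e : ℂ) :
    (iterWedgePoly d P Q n e).natDegree ≤ d ^ n := by
  have h := natDegree_iterPoly d P Q n
  exact (natDegree_sub_le_of_le h.1 ((natDegree_C_mul_le _ _).trans h.2)).trans (by simp)

theorem homEval_iterWedgePoly (d : ℕ) (P Q : ℂ[X]) (n : ℕ) (e : ℂ) (v : ℂ × ℂ) :
    homEval (d ^ n) (iterWedgePoly d P Q n e) v = wedge ((ratLift d P Q)^[n] v) (e, 1) := by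
  rw [← homEval_iterPoly, iterWedgePoly, homEval_sub, homEval_C_mul, wedge]
  ring

theorem IsHomLift.abs_pow_mul_green_sub_le {F : ℂ × ℂ → ℂ × ℂ} (hF : IsHomLift d F B)
    {v : ℂ × ℂ} (hv : v ≠ 0) (n : ℕ) :
    |(d : ℝ) ^ n * green d F v - Real.log ‖F^[n] v‖| ≤ B := by
  rw [← hF.green_iterate hv]
  exact hF.abs_green_sub_log_le (hF.iterate_ne_zero hv n)

theorem IsFactorization.pow_mul_prod_exp (hc : IsFactorization m W κ c) (N : ℕ) (φ : ℂ × ℂ → ℝ)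
    (D : ℝ) :
    ‖κ‖ ^ N * ∏ i, Real.exp (N * φ (c i) + D) =
      Real.exp (N * (Real.log ‖κ‖ + ∑ i, φ (c i)) + m * D) := by
  rw [← Real.exp_sum, Finset.sum_add_distrib, ← Finset.mul_sum]
  have : ‖κ‖ ^ N = Real.exp (N * Real.log ‖κ‖) := by
    rw [← Real.log_pow, Real.exp_log (pow_pos (norm_pos_iff.2 hc.ne_zero) _)]
  rw [this, ← Real.exp_add]
  congr 1
  simp
  ring

/-- By the product formula the modulus is `|κ|^(dⁿ) ∏ |Fⁿ(cᵢ) ∧ (k, 1)|`, and `log ‖Fⁿ(cᵢ)‖` is `dⁿ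
G(cᵢ)` up to the error `B`, independent of `n`. -/
theorem IsFactorization.norm_resultant_le (hc : IsFactorization m W κ c)
    (hF : IsHomLift d (ratLift d P Q) B) (n : ℕ) (k : Fin (m + 1)) :
    ‖resultant W (iterWedgePoly d P Q n (k : ℕ)) m (d ^ n)‖ ≤
      Real.exp ((d : ℝ) ^ n * (Real.log ‖κ‖ + ∑ i, green d (ratLift d P Q) (c i)) +
        m * (B + Real.log (2 * m + 2))) := by
  rw [hc.norm_resultant _ _ (natDegree_iterWedgePoly _ _ _ _ _)]
  have h1 := hc.pow_mul_prod_exp (d ^ n) (green d (ratLift d P Q)) (B + Real.log (2 * m + 2))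
  push_cast at h1
  rw [← h1]
  gcongr with i
  have h2 := (abs_le.1 (hF.abs_pow_mul_green_sub_le (hc.ne_zero' i) n)).1
  have h3 := norm_pos_iff.2 (hF.iterate_ne_zero (hc.ne_zero' i) n)
  have h4 : ‖(((k : ℕ) : ℂ), (1 : ℂ))‖ ≤ m + 1 := by
    refine max_le ?_ ?_
    · simp only [Complex.norm_natCast]
      have : (k : ℕ) ≤ m + 1 := k.2.le
      exact_mod_cast this
    · simp
  rw [homEval_iterWedgePoly]
  calc _ ≤ 2 * ‖(ratLift d P Q)^[n] (c i)‖ * ‖(((k : ℕ) : ℂ), (1 : ℂ))‖ := norm_wedge_le _ _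
    _ ≤ 2 * ‖(ratLift d P Q)^[n] (c i)‖ * (m + 1) := by gcongr
    _ = Real.exp (Real.log ‖(ratLift d P Q)^[n] (c i)‖ + Real.log (2 * m + 2)) := by
        rw [Real.exp_add, Real.exp_log h3, Real.exp_log (by positivity)]
        ring
    _ ≤ _ := Real.exp_le_exp.2 (by linarith)

/-- One of the `m + 1` directions is uniformly transverse to all the vectors `Fⁿ(cᵢ)`. The choice
depends on `n` and on the map, but comes from a fixed finite set. -/
theorem IsFactorization.exists_le_norm_resultant (hc : IsFactorization m W κ c)
    (hF : IsHomLift d (ratLift d P Q) B) (n : ℕ) :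
    ∃ k : Fin (m + 1), Real.exp ((d : ℝ) ^ n * (Real.log ‖κ‖ +
        ∑ i, green d (ratLift d P Q) (c i)) - m * (B + Real.log (2 * m + 2))) ≤
      ‖resultant W (iterWedgePoly d P Q n (k : ℕ)) m (d ^ n)‖ := by
  obtain ⟨k, hk⟩ := exists_forall_le_norm_wedge fun i => (ratLift d P Q)^[n] (c i)
  refine ⟨k, ?_⟩
  rw [hc.norm_resultant _ _ (natDegree_iterWedgePoly _ _ _ _ _)]
  have h1 := hc.pow_mul_prod_exp (d ^ n) (green d (ratLift d P Q)) (-(B + Real.log (2 * m + 2)))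
  push_cast at h1
  rw [mul_neg, ← sub_eq_add_neg] at h1
  rw [← h1]
  gcongr with i
  have h2 := (abs_le.1 (hF.abs_pow_mul_green_sub_le (hc.ne_zero' i) n)).2
  have h3 := norm_pos_iff.2 (hF.iterate_ne_zero (hc.ne_zero' i) n)
  rw [homEval_iterWedgePoly]
  refine le_trans ?_ (hk i)
  calc _ ≤ Real.exp (-Real.log (2 * m + 2) + Real.log ‖(ratLift d P Q)^[n] (c i)‖) :=
        Real.exp_le_exp.2 (by linarith)
    _ = _ := by
        rw [Real.exp_add, Real.exp_log h3, Real.exp_neg, Real.exp_log (by positivity)]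

end ResultantBounds

/-! ### Holomorphy of the iterated forms and the sub-mean value inequality -/

namespace IsHolomorphicLift

section

variable {G : Type*} [NormedAddCommGroup G] [NormedSpace ℂ G] {d : ℕ} {P Q : G → ℂ[X]} {S : Set G}

theorem _root_.RationalFamily.differentiableOn_coeff_pow {p : G → ℂ[X]}
    (hp : ∀ k, DifferentiableOn ℂ (fun s => (p s).coeff k) S) (n k : ℕ) :
    DifferentiableOn ℂ (fun s => (p s ^ n).coeff k) S := by
  induction n generalizing k with
  | zero => simp
  | succ n ih =>
    simp only [pow_succ]
    exact differentiableOn_coeff_mul ih hp k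

theorem _root_.RationalFamily.differentiableOn_coeff_sum_form {d : ℕ} {P A B : G → ℂ[X]}
    (hP : ∀ k, DifferentiableOn ℂ (fun s => (P s).coeff k) S)
    (hA : ∀ k, DifferentiableOn ℂ (fun s => (A s).coeff k) S)
    (hB : ∀ k, DifferentiableOn ℂ (fun s => (B s).coeff k) S) (k : ℕ) :
    DifferentiableOn ℂ (fun s => (∑ i ∈ Finset.range (d + 1),
      C ((P s).coeff i) * (A s ^ i * B s ^ (d - i))).coeff k) S := by
  simp only [finsetSum_coeff, coeff_C_mul]
  exact DifferentiableOn.fun_sum fun i _ => (hP i).mul (differentiableOn_coeff_mul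
    (differentiableOn_coeff_pow hA _) (differentiableOn_coeff_pow hB _) k)

theorem differentiableOn_coeff_iterPoly (h : IsHolomorphicLift d P Q S) (n : ℕ) :
    (∀ k, DifferentiableOn ℂ (fun s => (iterPoly d (P s) (Q s) n).1.coeff k) S) ∧
      ∀ k, DifferentiableOn ℂ (fun s => (iterPoly d (P s) (Q s) n).2.coeff k) S := by
  induction n with
  | zero => simp [iterPoly]
  | succ n ih =>
    exact ⟨fun k => differentiableOn_coeff_sum_form h.left ih.1 ih.2 k,
      fun k => differentiableOn_coeff_sum_form h.right ih.1 ih.2 k⟩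

theorem differentiableOn_coeff_iterWedgePoly (h : IsHolomorphicLift d P Q S) (n : ℕ) (e : ℂ)
    (k : ℕ) : DifferentiableOn ℂ (fun s => (iterWedgePoly d (P s) (Q s) n e).coeff k) S := by
  simp only [iterWedgePoly, coeff_sub, coeff_C_mul]
  exact ((h.differentiableOn_coeff_iterPoly n).1 k).sub
    (((h.differentiableOn_coeff_iterPoly n).2 k).const_mul _)

theorem continuousOn_lyapunovExponent [FiniteDimensional ℂ G] (h : IsHolomorphicLift d P Q S)
    (hd : 2 ≤ d) : ContinuousOn (fun s => lyapunovExponent d (ratMap (P s) (Q s))) S := by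
  intro s₀ hs₀
  obtain ⟨α, A, r, hα, hα1, hA, hr, hsub, hle⟩ := h.exists_holder hd hs₀
  have h1 := (holderOnWith_of_dist_le
    (f := fun s => lyapunovExponent d (ratMap (P s) (Q s))) hA hα.le hle).continuousOn
    (by simpa using hα)
  exact (h1.continuousAt (Metric.closedBall_mem_nhds s₀ hr)).continuousWithinAt

end

variable {d : ℕ} {P Q : ℂ → ℂ[X]} {S : Set ℂ}

set_option maxHeartbeats 1600000 in
-- The functions `T n k` are holomorphic with `log |T n k| ≤ d^(n+1) χ + D` on the disc, and some
-- `k` gives `log |T n k| ≥ d^(n+1) χ - D` at the centre. Jensen's inequality gives the claim up to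
-- `2 D / d^(n+1)`.
theorem eventually_lyapunovExponent_le_circleAverage (h : IsHolomorphicLift d P Q S) (hd : 2 ≤ d)
    {s₀ : ℂ} (hs₀ : s₀ ∈ S) :
    ∀ᶠ r in 𝓝[>] (0 : ℝ), lyapunovExponent d (ratMap (P s₀) (Q s₀)) ≤
      Real.circleAverage (fun s => lyapunovExponent d (ratMap (P s) (Q s))) s₀ r := by
  obtain ⟨Λ, hΛ⟩ := h.exists_isLipschitzFamily hs₀
  filter_upwards [hΛ, eventually_closedBall_subset (h.isOpen.mem_nhds hs₀), self_mem_nhdsWithin]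
    with r hr hsub hr0
  have hr0 : 0 < r := hr0
  obtain ⟨B, Λ', hΛ', hF⟩ := hr.exists_isHomFamily (isCompact_closedBall s₀ r) hd
  set u : ℂ → ℝ := fun s => lyapunovExponent d (ratMap (P s) (Q s)) with hu
  change u s₀ ≤ _
  have huc : ContinuousOn u (Metric.sphere s₀ r) :=
    (h.continuousOn_lyapunovExponent hd).mono (Metric.sphere_subset_closedBall.trans hsub)
  have hui : CircleIntegrable u s₀ r := huc.circleIntegrable hr0.le
  set m := 2 * d - 2 with hm
  set D : ℝ := d * (m * (B + Real.log (2 * m + 2))) with hD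
  have hd0 : (0 : ℝ) < d := by positivity
  have fact : ∀ t ∈ S, ∃ κ c, IsFactorization m (wronskian (Q t) (P t)) κ c := fun t ht => by
    have h0 := h.isReduced t ht
    exact exists_isFactorization (wronskian_ne_zero h0 (by omega))
      (natDegree_wronskian_le h0.natDegree_left h0.natDegree_right (by omega))
  -- the holomorphic functions whose logarithms approximate the Lyapunov exponent
  let T : ℕ → ℕ → ℂ → ℂ := fun n k s =>
    resultant (wronskian (Q s) (P s)) (iterWedgePoly d (P s) (Q s) n k) m (d ^ n) ^ d /
      resultant (P s) (Q s) d d ^ (2 * d ^ n)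
  have hTdiff (n k : ℕ) : DifferentiableOn ℂ (T n k) (Metric.closedBall s₀ r) := by
    refine DifferentiableOn.mono (t := S) ?_ hsub
    refine ((differentiableOn_resultant _ _ h.differentiableOn_coeff_wronskian
      (h.differentiableOn_coeff_iterWedgePoly n k)).pow d).div
      ((differentiableOn_resultant _ _ h.left h.right).pow _) fun s hs =>
        pow_ne_zero _ ((h.isReduced s hs).resultant_ne_zero hd)
  have hT (n k : ℕ) (s : ℂ) : ‖T n k s‖ =
      ‖resultant (wronskian (Q s) (P s)) (iterWedgePoly d (P s) (Q s) n k) m (d ^ n)‖ ^ d /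
        ‖resultant (P s) (Q s) d d‖ ^ (2 * d ^ n) := by
    simp only [T, norm_div, norm_pow]
  clear_value T D
  have hexp (s : ℂ) (hs : s ∈ S) (κ : ℂ) (c : Fin m → ℂ × ℂ)
      (hc : IsFactorization m (wronskian (Q s) (P s)) κ c) (n : ℕ) (x : ℝ) :
      -- The exponents `d` and `2 dⁿ` in `T` are those that clear the denominator in `(2 / d) log
      -- |Res|` after scaling the exponent by `d^(n+1)`.
      Real.exp ((d : ℝ) ^ n * (Real.log ‖κ‖ + ∑ i, green d (ratLift d (P s) (Q s)) (c i)) + x) ^ d /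
        ‖resultant (P s) (Q s) d d‖ ^ (2 * d ^ n) = Real.exp ((d : ℝ) ^ (n + 1) * u s + d * x) := by
    have hres := norm_pos_iff.2 ((h.isReduced s hs).resultant_ne_zero hd)
    have h1 : ‖resultant (P s) (Q s) d d‖ ^ (2 * d ^ n) =
        Real.exp (2 * d ^ n * Real.log ‖resultant (P s) (Q s) d d‖) := by
      rw [← Real.exp_log (pow_pos hres _), Real.log_pow]
      push_cast
      rfl
    rw [h1, ← Real.exp_nat_mul, ← Real.exp_sub, hu]
    simp only
    rw [((h.isReduced s hs).lyapunovExponent_eq hd hc).2]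
    congr 1
    field_simp
    ring
  clear_value u m
  have key (n : ℕ) : u s₀ ≤ Real.circleAverage u s₀ r + 2 * D / (d : ℝ) ^ (n + 1) := by
    obtain ⟨κ, c, hc⟩ := fact s₀ hs₀
    -- The index is chosen at the centre only: the upper bound on the circle holds for every `k`.
    obtain ⟨k, hk⟩ := hc.exists_le_norm_resultant
      (hF.isHomLift s₀ (Metric.mem_closedBall_self hr0.le)) n
    have h1 : Real.exp ((d : ℝ) ^ (n + 1) * u s₀ - D) ≤ ‖T n k s₀‖ := by
      rw [sub_eq_add_neg] at hk
      have h5 := hexp s₀ hs₀ κ c hc n (-(m * (B + Real.log (2 * m + 2))))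
      rw [mul_neg, ← hD] at h5
      rw [sub_eq_add_neg, hT, ← h5]
      gcongr
    have h6 : ∀ s ∈ Metric.sphere s₀ r, ‖T n k s‖ ≤ Real.exp ((d : ℝ) ^ (n + 1) * u s + D) := by
      intro s hs
      have hs' := Metric.sphere_subset_closedBall hs
      obtain ⟨κ', c', hc'⟩ := fact s (hsub hs')
      have h5 := hexp s (hsub hs') κ' c' hc' n (m * (B + Real.log (2 * m + 2)))
      rw [← hD] at h5
      rw [hT, ← h5]
      gcongr
      exact hc'.norm_resultant_le (hF.isHomLift s hs') n k
    have h2 := norm_le_exp_circleAverage hr0 (hTdiff n k)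
      (h := fun s => (d : ℝ) ^ (n + 1) * u s + D)
      ((continuousOn_const.mul huc).add continuousOn_const) h6
    have h3 := Real.exp_le_exp.1 (h1.trans h2)
    have hui' : CircleIntegrable (fun s => (d : ℝ) ^ (n + 1) * u s) s₀ r :=
      (continuousOn_const.mul huc).circleIntegrable hr0.le
    have h4 : Real.circleAverage (fun s => (d : ℝ) ^ (n + 1) * u s) s₀ r =
        (d : ℝ) ^ (n + 1) * Real.circleAverage u s₀ r :=
      Real.circleAverage_fun_smul (a := (d : ℝ) ^ (n + 1))
    rw [Real.circleAverage_fun_add hui' (circleIntegrable_const _ _ _),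
      Real.circleAverage_const, h4] at h3
    rw [← sub_le_iff_le_add', le_div_iff₀ (by positivity)]
    linarith
  have hlim : Tendsto (fun n : ℕ => Real.circleAverage u s₀ r + 2 * D / (d : ℝ) ^ (n + 1)) atTop
      (𝓝 (Real.circleAverage u s₀ r + 0)) := by
    refine tendsto_const_nhds.add (tendsto_const_nhds.div_atTop ?_)
    exact (tendsto_pow_atTop_atTop_of_one_lt (by exact_mod_cast hd)).comp (tendsto_add_atTop_nat 1)
  rw [add_zero] at hlim
  exact ge_of_tendsto' hlim key

end IsHolomorphicLift
-- Families over a complex manifold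
section Families

variable {E : Type*} [NormedAddCommGroup E] [NormedSpace ℂ E] {M : Type*} [TopologicalSpace M]
  [ChartedSpace E M] {d : ℕ} {f : M → RiemannSphere → RiemannSphere}

theorem isLocallyHolder_lyapunovExponent [FiniteDimensional ℂ E] [IsManifold 𝓘(ℂ, E) ω M]
    (hf : IsHolomorphicFamily (E := E) d f) (hd : 2 ≤ d) :
    IsLocallyHolder E (fun t => lyapunovExponent d (f t)) := by
  intro t₀
  have : IsManifold 𝓘(ℂ, E) 1 M := IsManifold.of_le (n := ω) le_top
  have hs₀ : chartAt E t₀ t₀ ∈ (chartAt E t₀).target := mem_chart_target E t₀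
  obtain ⟨P, Q, S', hlift, hs', hsub, heq⟩ := exists_isHolomorphicLift hf (by omega)
    (chartAt E t₀).open_target (mdifferentiableOn_atlas_symm (I := 𝓘(ℂ, E)) (chart_mem_atlas E t₀)) hs₀
  obtain ⟨α, A, r, hα, hα1, hA, hr, hrS, hle⟩ := hlift.exists_holder hd hs'
  refine ⟨α.toNNReal, A.toNNReal, by simpa using hα, by simpa using hα1,
    Metric.closedBall (chartAt E t₀ t₀) r, Metric.closedBall_mem_nhds _ hr, hrS.trans hsub,
    holderOnWith_of_dist_le hA hα.le fun x hx y hy => ?_⟩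
  simp only [Function.comp_apply, heq x (hrS hx), heq y (hrS hy), Real.dist_eq]
  exact hle x hx y hy

theorem continuous_lyapunovExponent [FiniteDimensional ℂ E] [IsManifold 𝓘(ℂ, E) ω M]
    (hf : IsHolomorphicFamily (E := E) d f) (hd : 2 ≤ d) :
    Continuous (fun t => lyapunovExponent d (f t)) := by
  rw [continuous_iff_continuousAt]
  intro t₀
  obtain ⟨α, A, hα, -, V, hV, -, hH⟩ := isLocallyHolder_lyapunovExponent hf hd t₀
  have h1 := (hH.continuousOn hα).continuousAt hV
  have h2 := h1.comp ((chartAt E t₀).continuousAt (mem_chart_source E t₀))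
  refine h2.congr ?_
  filter_upwards [(chartAt E t₀).open_source.mem_nhds (mem_chart_source E t₀)] with t ht
  simp [(chartAt E t₀).left_inv ht]

theorem isPlurisubharmonic_lyapunovExponent [FiniteDimensional ℂ E] [IsManifold 𝓘(ℂ, E) ω M]
    (hf : IsHolomorphicFamily (E := E) d f) (hd : 2 ≤ d) :
    IsPlurisubharmonic E (fun t => lyapunovExponent d (f t)) := by
  have hcont := continuous_lyapunovExponent hf hd
  refine ⟨hcont.upperSemicontinuous, fun U γ hU hγ => ?_⟩
  -- As `χ ∘ γ` is continuous, it suffices to treat small circles, on which the family pulled back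
  -- by `γ` has a holomorphic lift.
  refine isSubharmonicOn_of_local hU (hcont.comp_continuousOn hγ.continuousOn) fun s₀ hs₀ => ?_
  obtain ⟨P, Q, S', hlift, hs', hsub, heq⟩ := exists_isHolomorphicLift hf (by omega) hU hγ hs₀
  refine Eventually.frequently ?_
  filter_upwards [hlift.eventually_lyapunovExponent_le_circleAverage hd hs',
    eventually_closedBall_subset (hlift.isOpen.mem_nhds hs'), self_mem_nhdsWithin] with r hr hrS hr0
  have h1 : Set.EqOn ((fun t => lyapunovExponent d (f t)) ∘ γ)
      (fun s => lyapunovExponent d (ratMap (P s) (Q s))) (Metric.sphere s₀ |r|) := by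
    intro s hs
    rw [abs_of_pos hr0] at hs
    simp only [Function.comp_apply, heq s (hrS (Metric.sphere_subset_closedBall hs))]
  rw [Real.circleAverage_congr_sphere h1, Function.comp_apply, heq s₀ hs']
  exact hr

end Families
end RationalFamily

theorem proposition1p11 {E : Type*} [NormedAddCommGroup E] [NormedSpace ℂ E]
    [FiniteDimensional ℂ E] {M : Type*} [TopologicalSpace M] [ChartedSpace E M]
    [IsManifold 𝓘(ℂ, E) ω M] (d : ℕ) (hd : 2 ≤ d) (f : M → RiemannSphere → RiemannSphere)
    (hf : IsHolomorphicFamily (E := E) d f) :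
    (∀ t, IsMaxEntropyMeasure d (f t) (maxEntropyMeasure d (f t)) ∧
      Integrable (fun x => Real.log (sphericalDeriv (f t) x)) (maxEntropyMeasure d (f t))) ∧
    IsPlurisubharmonic E (fun t => lyapunovExponent d (f t)) ∧
    IsLocallyHolder E (fun t => lyapunovExponent d (f t)) := by
  refine ⟨fun t => ?_, RationalFamily.isPlurisubharmonic_lyapunovExponent hf hd,
    RationalFamily.isLocallyHolder_lyapunovExponent hf hd⟩
  obtain ⟨P, Q, hcop, hdeg, hft⟩ := hf.isRationalMap t
  have h : RationalFamily.IsReduced d P Q := ⟨hcop, hdeg⟩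
  obtain ⟨κ, c, hc⟩ := RationalFamily.exists_isFactorization
    (RationalFamily.wronskian_ne_zero h (by omega))
    (RationalFamily.natDegree_wronskian_le h.natDegree_left h.natDegree_right (by omega))
  rw [hft]
  exact ⟨RationalFamily.isMaxEntropyMeasure_maxEntropyMeasure h hd,
    (h.lyapunovExponent_eq hd hc).1⟩
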